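/- **Enhanced-Enhancement lower bound.** Let $(\mathbf X,\mathbf Y_1,\mathbf Y_2)$ be zero-mean jointly Gaussian random vectors of lengths $k,k_1,k_2$. For a random vector or tuple $\mathbf Z$ write $K_{\mathbf X|\mathbf Z}=E[(\mathbf X-E[\mathbf X|\mathbf Z])(\mathbf X-E[\mathbf X|\mathbf Z])^T]$, and assume that $K_{\mathbf X|\mathbf Y_1}$ and $K_{\mathbf X|\mathbf Y_2}$ are invertible. Write $A\preceq B$ if $B-A$ is positive semidefinite, and $A\leftrightarrow B\leftrightarrow C$ if $A$ and $C$ are conditionally independent given $B$. For $i\in\{1,2\}$ let $\Gamma_i$ be a linear mapping from $k\times k$ to $k_0\times k_0$ positive semidefinite matrices such that $A\preceq B$ implies $\Gamma_i(A)\preceq\Gamma_i(B)$, and let $\mathbf D=(D_1,D_2)$ with $D_1,D_2$ positive definite $k_0\times k_0$ matrices. Let $(\mathbf X_t,\mathbf Y_{1t},\mathbf Y_{2t})_{t\ge1}$ be i.i.d. copies of $(\mathbf X,\mathbf Y_1,\mathbf Y_2)$. An $(n,M,D_1,D_2)$ code ($n\ge1$) consists of (measurable) maps $f:(\mathbb R^{k})^n\to\{1,\dots,M\}$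 and $g_i:\{1,\dots,M\}\times(\mathbb R^{k_i})^n\to(\mathbb R^{k})^n$ such that, with $\widehat{\mathbf X}_i^n=g_i(f(\mathbf X^n),\mathbf Y_i^n)$, $$E\Big[\tfrac1n\sum_{t=1}^n\Gamma_i\big((\mathbf X_t-\widehat{\mathbf X}_{it})(\mathbf X_t-\widehat{\mathbf X}_{it})^T\big)\Big]\preceq D_i,\qquad i\in\{1,2\}$$ (in particular the expectation is finite). A rate $R$ is $\mathbf D$-achievable if for every $\epsilon>0$ there is an $(n,M,D_1+\epsilon I,D_2+\epsilon I)$ code with $n^{-1}\log M\le R+\epsilon$, and $R(\mathbf D)=\inf\{R: R\text{ is }\mathbf D\text{-achievable}\}$. Let $S_G$ be the set of finite-length random vectors $\mathbf Y$, zero-mean jointly Gaussian with $(\mathbf X,\mathbf Y_1,\mathbf Y_2)$, such that $\mathbf X\leftrightarrow\mathbf Y\leftrightarrow(\mathbf Y_1,\mathbf Y_2)$ and $K_{\mathbf X|\mathbf Y}$ is invertible. For $\mathbf Y\in S_G$ put $$\widetilde K=K^{-1}_{\mathbf X|\mathbf Y}-K^{-1}_{\mathbf X|\mathbf Y_2},\qquad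 \widehat K=K^{-1}_{\mathbf X|\mathbf Y}-K^{-1}_{\mathbf X|\mathbf Y_1}.$$ Let $\bar C_{l1}(\mathbf D)$ and $\bar C_{l2}(\mathbf D)$ be the sets of triples $(\mathbf W,\mathbf U,\mathbf V)$ of random vectors of arbitrary finite lengths, jointly distributed with $(\mathbf X,\mathbf Y_1,\mathbf Y_2,\mathbf Y)$, such that $(\mathbf W,\mathbf U,\mathbf V)\leftrightarrow\mathbf X\leftrightarrow(\mathbf Y_1,\mathbf Y_2,\mathbf Y)$, $K_{\mathbf X|\mathbf W,\mathbf U,\mathbf V,\mathbf Y}$ is invertible, and respectively $$\bar C_{l1}(\mathbf D):\quad \Gamma_1(K_{\mathbf X|\mathbf W,\mathbf U,\mathbf Y_1})\preceq D_1,\qquad \Gamma_2\big((K^{-1}_{\mathbf X|\mathbf W,\mathbf U,\mathbf V,\mathbf Y}-\widetilde K)^{-1}\big)\preceq D_2;$$ $$\bar C_{l2}(\mathbf D):\quad \Gamma_1\big((K^{-1}_{\mathbf X|\mathbf W,\mathbf U,\mathbf V,\mathbf Y}-\widehat K)^{-1}\big)\preceq D_1,\qquad \Gamma_2(K_{\mathbf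 X|\mathbf W,\mathbf V,\mathbf Y_2})\preceq D_2.$$ Let $$R_{lo1}=I(\mathbf X;\mathbf W,\mathbf U|\mathbf Y_1)+I(\mathbf X;\mathbf V|\mathbf W,\mathbf U,\mathbf Y),\qquad R_{lo2}=I(\mathbf X;\mathbf W,\mathbf V|\mathbf Y_2)+I(\mathbf X;\mathbf U|\mathbf W,\mathbf V,\mathbf Y),$$ with values in $[0,\infty]$ (mutual information and rates use the same logarithm). Then $$R(\mathbf D)\ \ge\ \max\Big\{\sup_{\mathbf Y\in S_G}\ \inf_{\bar C_{l1}(\mathbf D)}R_{lo1},\ \sup_{\mathbf Y\in S_G}\ \inf_{\bar C_{l2}(\mathbf D)}R_{lo2}\Big\},$$ where an infimum over the empty set is $+\infty$ and a supremum over the empty set is $0$. -/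

import Mathlib

open MeasureTheory ProbabilityTheory
open scoped ENNReal

namespace VectorGaussianRD

noncomputable section

/-- Real (column) vectors of length `n`. -/
abbrev Vec (n : ℕ) : Type := Fin n → ℝ

/-! ### Conditional covariance, conditional mutual information, Markov chains -/

/-- The conditional (error) covariance matrix
`K_{X|Z} = E[(X - E[X|Z]) (X - E[X|Z])ᵀ]` of a random vector `X` given a random element `Z`. -/
def condCov {Ω β : Type} [MeasurableSpace Ω] [MeasurableSpace β] {k : ℕ}
    (μ : Measure Ω) (X : Ω → Vec k) (Z : Ω → β) : Matrix (Fin k) (Fin k) ℝ :=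
  Matrix.of fun i j =>
    ∫ ω, (X ω i - (μ[(fun ω' => X ω' i) | MeasurableSpace.comap Z inferInstance]) ω)
        * (X ω j - (μ[(fun ω' => X ω' j) | MeasurableSpace.comap Z inferInstance]) ω) ∂μ

/-- The conditional mutual information `I(A; B | C)` (in nats), that is, the Kullback-Leibler
divergence `D(P_{C,A,B} ‖ P_C ⊗ (P_{A|C} × P_{B|C}))`. -/
def condMutualInfo {Ω α β γ : Type} [MeasurableSpace Ω] [MeasurableSpace α]
    [StandardBorelSpace α] [Nonempty α] [MeasurableSpace β] [StandardBorelSpace β] [Nonempty β]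
    [MeasurableSpace γ] (μ : Measure Ω) [IsFiniteMeasure μ]
    (A : Ω → α) (B : Ω → β) (C : Ω → γ) : ℝ≥0∞ :=
  InformationTheory.klDiv (μ.map fun ω => (C ω, A ω, B ω))
    ((μ.map C) ⊗ₘ ((condDistrib A C μ) ×ₖ (condDistrib B C μ)))

/-- The Markov chain `A ↔ B ↔ C`: `A` and `C` are conditionally independent given `B`. -/
def MarkovChain {Ω α β γ : Type} [MeasurableSpace Ω] [StandardBorelSpace Ω]
    [MeasurableSpace α] [MeasurableSpace β] [MeasurableSpace γ]
    (μ : Measure Ω) [IsFiniteMeasure μ] (A : Ω → α) (B : Ω → β) (C : Ω → γ) : Prop :=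
  ∃ hB : Measurable B,
    CondIndepFun (MeasurableSpace.comap B inferInstance) hB.comap_le A C μ

/-! ### Codes, achievable rates and the rate-distortion function -/

/-- A distortion mapping `Γ`: linear, and monotone for the Loewner order on positive semidefinite
matrices (hence it sends positive semidefinite matrices to positive semidefinite ones). Only its
values on positive semidefinite matrices are ever used. -/
structure DistortionMap (k k₀ : ℕ) where
  toLin : Matrix (Fin k) (Fin k) ℝ →ₗ[ℝ] Matrix (Fin k₀) (Fin k₀) ℝ
  mono : ∀ A B : Matrix (Fin k) (Fin k) ℝ, A.PosSemidef → B.PosSemidef →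
    (B - A).PosSemidef → (toLin B - toLin A).PosSemidef

/-- Sample space of one source letter `(X, Y₁, Y₂)`. -/
abbrev Source (k k₁ k₂ : ℕ) : Type := Vec k × Vec k₁ × Vec k₂

/-- `Γ (e eᵀ)` for an error vector `e`. -/
def errorDistortion {k k₀ : ℕ} (Γ : DistortionMap k k₀) (e : Vec k) :
    Matrix (Fin k₀) (Fin k₀) ℝ :=
  Γ.toLin (Matrix.vecMulVec e e)

/-- The reconstruction `xhat` of the block `x`, both random on `(Ω, μ)`, meets the constraint
`E[(1/n) ∑ₜ Γ((Xₜ - X̂ₜ)(Xₜ - X̂ₜ)ᵀ)] ⪯ D` (the expectation being finite). -/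
def MeetsDistortion {Ω : Type} [MeasurableSpace Ω] {k k₀ n : ℕ} (μ : Measure Ω)
    (Γ : DistortionMap k k₀) (D : Matrix (Fin k₀) (Fin k₀) ℝ)
    (x xhat : Ω → Fin n → Vec k) : Prop :=
  (∀ t a b, Integrable (fun ω => errorDistortion Γ (x ω t - xhat ω t) a b) μ) ∧
  (D - Matrix.of fun a b =>
    ∫ ω, ((1 / (n : ℝ)) • ∑ t, errorDistortion Γ (x ω t - xhat ω t)) a b ∂μ).PosSemidef

/-- An `(n, M, D₁, D₂)` code for the memoryless source with letter distribution `P`. -/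
structure Code {k k₁ k₂ k₀ : ℕ} (P : Measure (Source k k₁ k₂)) (Γ₁ Γ₂ : DistortionMap k k₀)
    (D₁ D₂ : Matrix (Fin k₀) (Fin k₀) ℝ) (n M : ℕ) where
  f : (Fin n → Vec k) → Fin M
  g₁ : Fin M × (Fin n → Vec k₁) → Fin n → Vec k
  g₂ : Fin M × (Fin n → Vec k₂) → Fin n → Vec k
  measurable_f : Measurable f
  measurable_g₁ : Measurable g₁
  measurable_g₂ : Measurable g₂
  distortion₁ : MeetsDistortion (Measure.pi fun _ : Fin n => P) Γ₁ D₁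
    (fun s t => (s t).1) (fun s => g₁ (f fun t => (s t).1, fun t => (s t).2.1))
  distortion₂ : MeetsDistortion (Measure.pi fun _ : Fin n => P) Γ₂ D₂
    (fun s t => (s t).1) (fun s => g₂ (f fun t => (s t).1, fun t => (s t).2.2))

/-- The rate `R` is `(D₁, D₂)`-achievable. -/
def Achievable {k k₁ k₂ k₀ : ℕ} (P : Measure (Source k k₁ k₂)) (Γ₁ Γ₂ : DistortionMap k k₀)
    (D₁ D₂ : Matrix (Fin k₀) (Fin k₀) ℝ) (R : ℝ) : Prop :=
  ∀ ε : ℝ, 0 < ε → ∃ n M : ℕ, 0 < n ∧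
    Nonempty (Code P Γ₁ Γ₂ (D₁ + ε • 1) (D₂ + ε • 1) n M) ∧
    Real.log (M : ℝ) / (n : ℝ) ≤ R + ε

/-- The rate-distortion function `R(D) = inf {R : R is D-achievable}`. -/
def rateDistortion {k k₁ k₂ k₀ : ℕ} (P : Measure (Source k k₁ k₂)) (Γ₁ Γ₂ : DistortionMap k k₀)
    (D₁ D₂ : Matrix (Fin k₀) (Fin k₀) ℝ) : EReal :=
  ⨅ (R : ℝ) (_ : Achievable P Γ₁ Γ₂ D₁ D₂ R), (R : EReal)

/-! ### The Enhanced-Enhancement lower bound -/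

/-- `R_{lo1} = I(X; W, U | Y₁) + I(X; V | W, U, Y)`. -/
def Rlo1 {Ω : Type} [MeasurableSpace Ω] {k k₁ m a b c : ℕ} (μ : Measure Ω) [IsFiniteMeasure μ]
    (X : Ω → Vec k) (Y₁ : Ω → Vec k₁) (Y : Ω → Vec m)
    (W : Ω → Vec a) (U : Ω → Vec b) (V : Ω → Vec c) : ℝ≥0∞ :=
  condMutualInfo μ X (fun ω => (W ω, U ω)) Y₁
    + condMutualInfo μ X V (fun ω => (W ω, U ω, Y ω))

/-- `R_{lo2} = I(X; W, V | Y₂) + I(X; U | W, V, Y)`. -/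
def Rlo2 {Ω : Type} [MeasurableSpace Ω] {k k₂ m a b c : ℕ} (μ : Measure Ω) [IsFiniteMeasure μ]
    (X : Ω → Vec k) (Y₂ : Ω → Vec k₂) (Y : Ω → Vec m)
    (W : Ω → Vec a) (U : Ω → Vec b) (V : Ω → Vec c) : ℝ≥0∞ :=
  condMutualInfo μ X (fun ω => (W ω, V ω)) Y₂
    + condMutualInfo μ X U (fun ω => (W ω, V ω, Y ω))

/-- Sample space of `((X, Y₁, Y₂), Y)` with `Y` of length `m`. -/
abbrev Enhanced (k k₁ k₂ m : ℕ) : Type := Source k k₁ k₂ × Vec m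

/-- Sample space of `(((X, Y₁, Y₂), Y), W, U, V)`. -/
abbrev Aux (k k₁ k₂ m a b c : ℕ) : Type := Enhanced k k₁ k₂ m × Vec a × Vec b × Vec c

/-- `S_G`, described by joint laws: `Q` is a law of `((X, Y₁, Y₂), Y)` with first marginal the
given source law `P`, zero-mean jointly Gaussian, with `X ↔ Y ↔ (Y₁, Y₂)`; the matrix `K_{X|Y}`,
whose inverse enters the bound, is invertible. -/
structure IsSG {k k₁ k₂ m : ℕ} (P : Measure (Source k k₁ k₂))
    (Q : ProbabilityMeasure (Enhanced k k₁ k₂ m)) : Prop where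
  marginal : (Q : Measure (Enhanced k k₁ k₂ m)).map Prod.fst = P
  gaussian : IsGaussian (Q : Measure (Enhanced k k₁ k₂ m))
  centered : ∫ s, s ∂(Q : Measure (Enhanced k k₁ k₂ m)) = 0
  markov : MarkovChain (Q : Measure (Enhanced k k₁ k₂ m))
    (fun s => s.1.1) (fun s => s.2) (fun s => s.1.2)
  invertible : IsUnit
    (condCov (Q : Measure (Enhanced k k₁ k₂ m)) (fun s => s.1.1) (fun s => s.2))

instance instStandardBorelSpaceEnhanced (k k₁ k₂ m : ℕ) :
    StandardBorelSpace (Enhanced k k₁ k₂ m) :=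
  inferInstanceAs (StandardBorelSpace ((Vec k × Vec k₁ × Vec k₂) × Vec m))

instance instStandardBorelSpaceAux (k k₁ k₂ m a b c : ℕ) :
    StandardBorelSpace (Aux k k₁ k₂ m a b c) :=
  haveI : StandardBorelSpace (Vec a × Vec b × Vec c) := inferInstance
  StandardBorelSpace.prod

section AuxCoordinates

variable {k k₁ k₂ m a b c : ℕ}

/-- The source vector. -/
def xC (ω : Aux k k₁ k₂ m a b c) : Vec k := ω.1.1.1
/-- Side information of decoder 1. -/
def y₁C (ω : Aux k k₁ k₂ m a b c) : Vec k₁ := ω.1.1.2.1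
/-- Side information of decoder 2. -/
def y₂C (ω : Aux k k₁ k₂ m a b c) : Vec k₂ := ω.1.1.2.2
/-- The enhanced side information. -/
def yC (ω : Aux k k₁ k₂ m a b c) : Vec m := ω.1.2
/-- The auxiliary vector `W`. -/
def wC (ω : Aux k k₁ k₂ m a b c) : Vec a := ω.2.1
/-- The auxiliary vector `U`. -/
def uC (ω : Aux k k₁ k₂ m a b c) : Vec b := ω.2.2.1
/-- The auxiliary vector `V`. -/
def vC (ω : Aux k k₁ k₂ m a b c) : Vec c := ω.2.2.2

/-- `K̃ = K_{X|Y}⁻¹ - K_{X|Y₂}⁻¹`. -/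
def KTilde (μ : Measure (Aux k k₁ k₂ m a b c)) : Matrix (Fin k) (Fin k) ℝ :=
  (condCov μ xC yC)⁻¹ - (condCov μ xC y₂C)⁻¹

/-- `K̂ = K_{X|Y}⁻¹ - K_{X|Y₁}⁻¹`. -/
def KHat (μ : Measure (Aux k k₁ k₂ m a b c)) : Matrix (Fin k) (Fin k) ℝ :=
  (condCov μ xC yC)⁻¹ - (condCov μ xC y₁C)⁻¹

/-- `K_{X|W,U,V,Y}`. -/
def KAll (μ : Measure (Aux k k₁ k₂ m a b c)) : Matrix (Fin k) (Fin k) ℝ :=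
  condCov μ xC (fun ω => (wC ω, uC ω, vC ω, yC ω))

/-- The constraint set `C̄_{l1}(D)`, described by joint laws `ρ` of `(X, Y₁, Y₂, Y, W, U, V)`
that extend the law `Q` of `(X, Y₁, Y₂, Y)`. -/
structure IsCbar1 {k₀ : ℕ} (Γ₁ Γ₂ : DistortionMap k k₀) (D₁ D₂ : Matrix (Fin k₀) (Fin k₀) ℝ)
    (Q : ProbabilityMeasure (Enhanced k k₁ k₂ m))
    (ρ : ProbabilityMeasure (Aux k k₁ k₂ m a b c)) : Prop where
  marginal : (ρ : Measure (Aux k k₁ k₂ m a b c)).map Prod.fst = Q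
  markov : MarkovChain (ρ : Measure (Aux k k₁ k₂ m a b c))
    (fun ω => (wC ω, uC ω, vC ω)) xC (fun ω => (y₁C ω, y₂C ω, yC ω))
  invertible : IsUnit (KAll (ρ : Measure (Aux k k₁ k₂ m a b c)))
  decoder₁ : (D₁ - Γ₁.toLin (condCov (ρ : Measure (Aux k k₁ k₂ m a b c)) xC
    (fun ω => (wC ω, uC ω, y₁C ω)))).PosSemidef
  decoder₂ : (D₂ - Γ₂.toLin ((KAll (ρ : Measure (Aux k k₁ k₂ m a b c)))⁻¹
    - KTilde (ρ : Measure (Aux k k₁ k₂ m a b c)))⁻¹).PosSemidef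

/-- The constraint set `C̄_{l2}(D)`, described by joint laws `ρ` of `(X, Y₁, Y₂, Y, W, U, V)`
that extend the law `Q` of `(X, Y₁, Y₂, Y)`. -/
structure IsCbar2 {k₀ : ℕ} (Γ₁ Γ₂ : DistortionMap k k₀) (D₁ D₂ : Matrix (Fin k₀) (Fin k₀) ℝ)
    (Q : ProbabilityMeasure (Enhanced k k₁ k₂ m))
    (ρ : ProbabilityMeasure (Aux k k₁ k₂ m a b c)) : Prop where
  marginal : (ρ : Measure (Aux k k₁ k₂ m a b c)).map Prod.fst = Q
  markov : MarkovChain (ρ : Measure (Aux k k₁ k₂ m a b c))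
    (fun ω => (wC ω, uC ω, vC ω)) xC (fun ω => (y₁C ω, y₂C ω, yC ω))
  invertible : IsUnit (KAll (ρ : Measure (Aux k k₁ k₂ m a b c)))
  decoder₁ : (D₁ - Γ₁.toLin ((KAll (ρ : Measure (Aux k k₁ k₂ m a b c)))⁻¹
    - KHat (ρ : Measure (Aux k k₁ k₂ m a b c)))⁻¹).PosSemidef
  decoder₂ : (D₂ - Γ₂.toLin (condCov (ρ : Measure (Aux k k₁ k₂ m a b c)) xC
    (fun ω => (wC ω, vC ω, y₂C ω)))).PosSemidef

end AuxCoordinates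

/-- `inf` of `R_{lo1}` over `C̄_{l1}(D)`, for a fixed law `Q` of `(X, Y₁, Y₂, Y)`. The auxiliary
random vectors may have any finite lengths. -/
def infRlo1 {k k₁ k₂ k₀ m : ℕ} (Γ₁ Γ₂ : DistortionMap k k₀)
    (D₁ D₂ : Matrix (Fin k₀) (Fin k₀) ℝ)
    (Q : ProbabilityMeasure (Enhanced k k₁ k₂ m)) : ℝ≥0∞ :=
  ⨅ (a : ℕ) (b : ℕ) (c : ℕ) (ρ : ProbabilityMeasure (Aux k k₁ k₂ m a b c))
    (_ : IsCbar1 Γ₁ Γ₂ D₁ D₂ Q ρ),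
    Rlo1 (ρ : Measure (Aux k k₁ k₂ m a b c)) xC y₁C yC wC uC vC

/-- `inf` of `R_{lo2}` over `C̄_{l2}(D)`, for a fixed law `Q` of `(X, Y₁, Y₂, Y)`. -/
def infRlo2 {k k₁ k₂ k₀ m : ℕ} (Γ₁ Γ₂ : DistortionMap k k₀)
    (D₁ D₂ : Matrix (Fin k₀) (Fin k₀) ℝ)
    (Q : ProbabilityMeasure (Enhanced k k₁ k₂ m)) : ℝ≥0∞ :=
  ⨅ (a : ℕ) (b : ℕ) (c : ℕ) (ρ : ProbabilityMeasure (Aux k k₁ k₂ m a b c))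
    (_ : IsCbar2 Γ₁ Γ₂ D₁ D₂ Q ρ),
    Rlo2 (ρ : Measure (Aux k k₁ k₂ m a b c)) xC y₂C yC wC uC vC

/-- The Enhanced-Enhancement lower bound
`max {sup_{S_G} inf_{C̄_{l1}(D)} R_{lo1}, sup_{S_G} inf_{C̄_{l2}(D)} R_{lo2}}`. -/
def enhancedELB {k k₁ k₂ k₀ : ℕ} (P : Measure (Source k k₁ k₂)) (Γ₁ Γ₂ : DistortionMap k k₀)
    (D₁ D₂ : Matrix (Fin k₀) (Fin k₀) ℝ) : ℝ≥0∞ :=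
  max
    (⨆ (m : ℕ) (Q : ProbabilityMeasure (Enhanced k k₁ k₂ m)) (_ : IsSG P Q),
      infRlo1 Γ₁ Γ₂ D₁ D₂ Q)
    (⨆ (m : ℕ) (Q : ProbabilityMeasure (Enhanced k k₁ k₂ m)) (_ : IsSG P Q),
      infRlo2 Γ₁ Γ₂ D₁ D₂ Q)

end

end VectorGaussianRD

open VectorGaussianRD

open scoped NNReal Matrix
open InformationTheory

namespace VectorGaussianRD

noncomputable section

set_option linter.unusedSectionVars false

/-! ### Kullback-Leibler divergence of observed laws -/

section Divergence

variable {Ω α β γ δ : Type} [MeasurableSpace Ω] [MeasurableSpace α] [MeasurableSpace β]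
  [MeasurableSpace γ] [MeasurableSpace δ]

/-! Fix an achievable R, a law in S_G and δ > 0. It suffices to exhibit one triple (W, U, V) in the
constraint set with rate at most R + δ, and a code provides it. Call the decoders a and b: a = 1, b
= 2 for the first bound, and the reverse for the second. With message J and random time T, take W =
(T, J, Ya off T, Y before T), V = (Yb off T, Y off T, X before T), and leave the third vector empty.
Decoder a can run on (W, Ya) and decoder b on (W, V, Yb), so the conditional expectations do at
least as well as the code (`meanDistortion_sub_condCov_posSemidef`).

Rate. Instead of entropies, the proof uses divergences from a reference law under which the message
is uniform and independent of the source. The true law is at most M times the reference, so every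
divergence D(·) is finite and at most log M (`klDiv_updateLaw_le`). If A and B are conditionally
independent given C under the reference, then I(A;B|C) = D(C,A,B) + D(C) - D(C,A) - D(C,B)
(`condMutualInfo_add_obsDiv`). With G denoting W without T, the chain X ↔ Y ↔ (Ya, Yb) bounds the
sum of the two informations by the average over t of D(G,V,Y,X) + D(G,Y) - D(G,Ya) - D(G,V,Y,Ya,Yb)
(`rate_le_of_index`). These terms are dominated by increments in t of A_t = D(J, all Ya, Y before t)
and B_t = D(J, all (Y,Ya,Yb), X before t). Since A_n ≤ B_0, their sum telescopes to at most B_n ≤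
log M (`sum_obsDiv_block_le`).

Enhanced constraint. With η and ηb the errors of X given Y and given Yb, the Gaussian vector n =
K_{X|Y}⁻¹ η - K_{X|Yb}⁻¹ ηb has covariance K̃ and is independent of (X, Yb), while K̃ X - n is a
function of (Y, Yb) (`exists_enhancement_noise`). Revealing Y to decoder b therefore reveals an
independent noisy look at X, which raises the inverse error covariance by at least K̃
(`enhanced_condCov`). Because Yb adds nothing to (Y, W, V), this gives (K_{X|W,V,Y}⁻¹ - K̃)⁻¹ ⪯
K_{X|W,V,Yb}, and monotonicity of Γ concludes (`channel_enhancement`).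

Exactness. Codes only meet D + εI, and K_{X|W,V,Y} must be invertible. The code is therefore
time-shared with a fine quantizer, whose distortion lies well below D and pays for ε, and with a
blank test that reveals nothing and keeps the error covariance nondegenerate (`test_distortion`,
`condCov_posDef_of_blank`). -/

lemma klDiv_map_of_leftInverse (μ ν : Measure α) [IsFiniteMeasure μ] [IsFiniteMeasure ν]
    {f : α → β} {g : β → α} (hf : Measurable f) (hg : Measurable g) (h : ∀ x, g (f x) = x) :
    klDiv (μ.map f) (ν.map f) = klDiv μ ν := by
  refine le_antisymm (klDiv_map_le μ ν hf) ?_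
  have h' : g ∘ f = id := funext h
  have := klDiv_map_le (μ.map f) (ν.map f) hg
  rwa [Measure.map_map hg hf, Measure.map_map hg hf, h', Measure.map_id, Measure.map_id] at this

/-- The divergence between the laws of the observation `Z` under two measures. -/
def obsDiv (P m : Measure Ω) (Z : Ω → β) : ℝ≥0∞ := klDiv (P.map Z) (m.map Z)

/-- Data processing. Every later comparison of divergences amounts to naming the function `h` that
computes one observation from another. -/
lemma obsDiv_le_of_comp {P m : Measure Ω} [IsFiniteMeasure P] [IsFiniteMeasure m]
    {Z : Ω → β} {Z' : Ω → γ} (h : γ → β) (hh : Measurable h) (hZ' : Measurable Z')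
    (e : ∀ ω, Z ω = h (Z' ω)) : obsDiv P m Z ≤ obsDiv P m Z' := by
  have e' : Z = h ∘ Z' := funext e
  have := klDiv_map_le (P.map Z') (m.map Z') hh
  rwa [Measure.map_map hh hZ', Measure.map_map hh hZ', ← e'] at this

lemma obsDiv_map {Ω' : Type} [MeasurableSpace Ω'] (P m : Measure Ω) {f : Ω → Ω'}
    (hf : Measurable f) {Z : Ω' → β} (hZ : Measurable Z) :
    obsDiv (P.map f) (m.map f) Z = obsDiv P m (fun ω => Z (f ω)) := by
  unfold obsDiv
  rw [Measure.map_map hZ hf, Measure.map_map hZ hf]; rfl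

lemma obsDiv_le_klDiv {P m : Measure Ω} [IsFiniteMeasure P] [IsFiniteMeasure m]
    {Z : Ω → β} (hZ : Measurable Z) : obsDiv P m Z ≤ klDiv P m :=
  klDiv_map_le P m hZ

/-- A measure dominated by `c` times another one has divergence at most `log c`. -/
lemma klDiv_le_log {P m : Measure Ω} [IsProbabilityMeasure P] [IsProbabilityMeasure m]
    {c : ℝ} (hc : 1 ≤ c) (h : P ≤ ENNReal.ofReal c • m) :
    klDiv P m ≤ ENNReal.ofReal (Real.log c) := by
  have hac : P ≪ m := (Measure.absolutelyContinuous_of_le h).trans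
    (Measure.smul_absolutelyContinuous)
  -- The domination of measures becomes a pointwise bound on the density by comparing integrals over
  -- all sets.
  have hle : ∀ᵐ x ∂m, P.rnDeriv m x ≤ ENNReal.ofReal c := by
    refine ae_le_of_forall_setLIntegral_le_of_sigmaFinite (Measure.measurable_rnDeriv P m) ?_
    intro s hs _
    rw [Measure.setLIntegral_rnDeriv hac, setLIntegral_const]
    exact (h s).trans (by simp)
  have hllr : ∀ᵐ x ∂P, llr P m x ≤ Real.log c := by
    filter_upwards [hac.ae_le hle, Measure.rnDeriv_pos hac] with x hx hx0
    unfold llr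
    refine Real.log_le_log (ENNReal.toReal_pos hx0.ne' (ne_top_of_le_ne_top (by simp) hx)) ?_
    exact ENNReal.toReal_le_of_le_ofReal (by linarith) hx
  -- `klDiv` is infinite unless the log-likelihood ratio is integrable. Here `klFun` is evaluated on
  -- the compact interval [0, c], where it is bounded.
  have hkl : Integrable (fun x => klFun (P.rnDeriv m x).toReal) m := by
    have hcont : ContinuousOn klFun (Set.Icc 0 c) := continuous_klFun.continuousOn
    obtain ⟨B, hB⟩ := (isCompact_Icc.image_of_continuousOn hcont).isBounded.exists_norm_le
    refine Integrable.of_bound (measurable_klFun.comp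
      (Measure.measurable_rnDeriv P m).ennreal_toReal).aestronglyMeasurable B ?_
    filter_upwards [hle] with x hx
    exact hB _ ⟨_, ⟨ENNReal.toReal_nonneg, ENNReal.toReal_le_of_le_ofReal (by linarith) hx⟩, rfl⟩
  have hint := (integrable_klFun_rnDeriv_iff hac).1 hkl
  rw [klDiv_of_ac_of_integrable hac hint]
  refine ENNReal.ofReal_le_ofReal ?_
  have := integral_mono_ae hint (integrable_const (Real.log c)) hllr
  simpa using this

/-! ### Conditional independence through a kernel -/

/-- Given `(C, A)`, the conditional law of `B` is `κ C`; in particular `A` and `B` are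
conditionally independent given `C`. -/
def FactorsVia (μ : Measure Ω) (A : Ω → α) (B : Ω → β) (C : Ω → γ) (κ : Kernel γ β) : Prop :=
  μ.map (fun ω => ((C ω, A ω), B ω)) = (μ.map fun ω => (C ω, A ω)) ⊗ₘ κ.prodMkRight α

lemma lintegral_eq_of_map_eq_compProd {μ : Measure Ω} [IsFiniteMeasure μ] {X : Ω → γ} {Y : Ω → β}
    (hX : Measurable X) (hY : Measurable Y) {κ : Kernel γ β} [IsSFiniteKernel κ]
    (h : μ.map (fun ω => (X ω, Y ω)) = μ.map X ⊗ₘ κ) {f : γ × β → ℝ≥0∞} (hf : Measurable f) :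
    ∫⁻ ω, f (X ω, Y ω) ∂μ = ∫⁻ ω, ∫⁻ b, f (X ω, b) ∂(κ (X ω)) ∂μ := by
  rw [← lintegral_map (f := f) (g := fun ω => (X ω, Y ω)) hf (by fun_prop), h,
    Measure.lintegral_compProd hf, lintegral_map (Measurable.lintegral_kernel_prod_right' hf) hX]

lemma map_compProd_comap {μ : Measure α} [SFinite μ] {h : α → γ} (hh : Measurable h)
    (η : Kernel γ β) [IsSFiniteKernel η] :
    (μ ⊗ₘ η.comap h hh).map (Prod.map h id) = (μ.map h) ⊗ₘ η := by
  refine Measure.ext_of_lintegral _ fun f hf => ?_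
  rw [lintegral_map hf (by fun_prop), Measure.lintegral_compProd (by fun_prop),
    Measure.lintegral_compProd hf, lintegral_map (by fun_prop) hh]
  rfl

/-- The kernel sees only `C`, so any statistic of `(C, A)` may replace `A` without changing the
kernel. -/
lemma FactorsVia.comp {μ : Measure Ω} [IsFiniteMeasure μ] {A : Ω → α} {B : Ω → β} {C : Ω → γ}
    {κ : Kernel γ β} [IsSFiniteKernel κ] (h : FactorsVia μ A B C κ)
    (hA : Measurable A) (hB : Measurable B) (hC : Measurable C)
    {g : γ × α → δ} (hg : Measurable g) : FactorsVia μ (fun ω => g (C ω, A ω)) B C κ := by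
  unfold FactorsVia at *
  have hk : Measurable (fun p : γ × α => (p.1, g p)) := by fun_prop
  have := map_compProd_comap (μ := μ.map fun ω => (C ω, A ω)) hk (κ.prodMkRight δ)
  rw [Measure.map_map hk (by fun_prop)] at this
  have e : (κ.prodMkRight δ).comap (fun p : γ × α => (p.1, g p)) hk = κ.prodMkRight α := by
    ext1 p; rfl
  rw [e, ← h, Measure.map_map (by fun_prop) (by fun_prop)] at this
  exact this

lemma FactorsVia.map_prod {μ : Measure Ω} [IsFiniteMeasure μ] {A : Ω → α} {B : Ω → β} {C : Ω → γ}
    {κ : Kernel γ β} [IsSFiniteKernel κ] (h : FactorsVia μ A B C κ)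
    (hA : Measurable A) (hB : Measurable B) (hC : Measurable C) :
    μ.map (fun ω => (C ω, B ω)) = μ.map C ⊗ₘ κ := by
  unfold FactorsVia at h
  have := map_compProd_comap (μ := μ.map fun ω => (C ω, A ω)) (measurable_fst (α := γ) (β := α)) κ
  rw [Measure.map_map (by fun_prop) (by fun_prop)] at this
  change Measure.map _ (_ ⊗ₘ κ.prodMkRight α) = _ at this
  rw [← h, Measure.map_map (by fun_prop) (by fun_prop)] at this
  exact this

lemma FactorsVia.of_map_eq {Ω' : Type} [MeasurableSpace Ω'] {μ : Measure Ω}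
    {f : Ω → Ω'} (hf : Measurable f) {A : Ω' → α} {B : Ω' → β} {C : Ω' → γ} {κ : Kernel γ β}
    (hA : Measurable A) (hB : Measurable B) (hC : Measurable C)
    (h : FactorsVia μ (fun ω => A (f ω)) (fun ω => B (f ω)) (fun ω => C (f ω)) κ) :
    FactorsVia (μ.map f) A B C κ := by
  unfold FactorsVia at *
  rw [Measure.map_map (by fun_prop) hf, Measure.map_map (by fun_prop) hf]
  exact h

/-- Adjoining an independent coordinate to the conditioned variable. -/
lemma FactorsVia.prod_left {N : Type} [MeasurableSpace N] {μ : Measure Ω} [IsFiniteMeasure μ]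
    {ν : Measure N} [IsFiniteMeasure ν] {A : Ω → α} {B : Ω → β} {C : Ω → γ}
    {κ : Kernel γ β} [IsSFiniteKernel κ] (h : FactorsVia μ A B C κ)
    (hA : Measurable A) (hB : Measurable B) (hC : Measurable C) :
    FactorsVia (ν.prod μ) (fun p => (p.1, A p.2)) (fun p => B p.2) (fun p => C p.2) κ := by
  unfold FactorsVia at *
  refine Measure.ext_of_lintegral _ fun f hf => ?_
  have key : ∀ n, ∫⁻ ω, f ((C ω, (n, A ω)), B ω) ∂μ
      = ∫⁻ ω, ∫⁻ b, f ((C ω, (n, A ω)), b) ∂(κ (C ω)) ∂μ := by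
    intro n
    exact lintegral_eq_of_map_eq_compProd (f := fun q => f ((q.1.1, (n, q.1.2)), q.2))
      (hC.prodMk hA) hB h (by fun_prop)
  rw [lintegral_map hf (by fun_prop), Measure.lintegral_compProd hf,
    lintegral_map (Measurable.lintegral_kernel_prod_right' (by fun_prop)) (by fun_prop),
    lintegral_prod _ (by fun_prop), lintegral_prod _ (by
      have : Measurable fun x => ∫⁻ b, f (x, b) ∂(Kernel.prodMkRight (N × α) κ) x :=
        Measurable.lintegral_kernel_prod_right' hf
      exact (this.comp (show Measurable fun a : N × Ω => (C a.2, a.1, A a.2) by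
        fun_prop)).aemeasurable)]
  exact lintegral_congr key

/-- A function of one independent coordinate, given another function of it and the other
coordinate. -/
lemma factorsVia_prod {N : Type} [MeasurableSpace N] {ν : Measure N} [IsFiniteMeasure ν]
    {μ : Measure Ω} [IsFiniteMeasure μ] [StandardBorelSpace β] [Nonempty β]
    {G : N → γ} {V : N → β} {A : Ω → α} {C : Ω → δ} (hG : Measurable G) (hV : Measurable V)
    (hA : Measurable A) (hC : Measurable C) :
    FactorsVia (ν.prod μ) (fun p => A p.2) (fun p => V p.1) (fun p => (G p.1, C p.2))
      ((condDistrib V G ν).comap Prod.fst measurable_fst) := by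
  unfold FactorsVia
  refine Measure.ext_of_lintegral _ fun f hf => ?_
  have key : ∀ ω, ∫⁻ n, f (((G n, C ω), A ω), V n) ∂ν
      = ∫⁻ n, ∫⁻ b, f (((G n, C ω), A ω), b) ∂(condDistrib V G ν (G n)) ∂ν := by
    intro ω
    have h := compProd_map_condDistrib (μ := ν) (mβ := inferInstance) (X := G) (Y := V) hV.aemeasurable
    exact lintegral_eq_of_map_eq_compProd (f := fun q => f (((q.1, C ω), A ω), q.2)) hG hV h.symm
      (by fun_prop)
  have hm : Measurable fun x => ∫⁻ b, f (x, b) ∂(Kernel.prodMkRight α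
      ((condDistrib V G ν).comap Prod.fst (measurable_fst (α := γ) (β := δ)))) x :=
        Measurable.lintegral_kernel_prod_right' hf
  rw [lintegral_map hf (by fun_prop), Measure.lintegral_compProd hf,
    lintegral_map hm (by fun_prop),
    lintegral_prod_symm _ (by fun_prop), lintegral_prod_symm _ (by
      exact (hm.comp (show Measurable fun a : N × Ω => ((G a.1, C a.2), A a.2) by
        fun_prop)).aemeasurable)]
  exact lintegral_congr key

/-- Observing in addition a variable generated from the observation by the same kernel under both
measures does not increase the divergence. -/
lemma obsDiv_prod_eq_of_factorsVia {P m : Measure Ω} [IsFiniteMeasure P] [IsFiniteMeasure m]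
    {A : Ω → α} {B : Ω → β} {C : Ω → γ} {κ : Kernel γ β} [IsMarkovKernel κ]
    (hP : FactorsVia P A B C κ) (hm : FactorsVia m A B C κ) :
    obsDiv P m (fun ω => ((C ω, A ω), B ω)) = obsDiv P m (fun ω => (C ω, A ω)) := by
  unfold obsDiv
  rw [hP, hm, klDiv_compProd_left]

/-! ### Conditional mutual information as a combination of divergences -/

lemma compProd_prod_map_left (μ : Measure γ) [IsFiniteMeasure μ] (κ : Kernel γ α)
    (η : Kernel γ β) [IsFiniteKernel κ] [IsFiniteKernel η] :
    (μ ⊗ₘ (κ ×ₖ η)).map (fun p => ((p.1, p.2.1), p.2.2)) = (μ ⊗ₘ κ) ⊗ₘ η.prodMkRight α := by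
  refine Measure.ext_of_lintegral _ fun f hf => ?_
  rw [lintegral_map hf (by fun_prop), Measure.lintegral_compProd (by fun_prop),
    Measure.lintegral_compProd hf,
    Measure.lintegral_compProd (Measurable.lintegral_kernel_prod_right' hf)]
  refine lintegral_congr fun c => ?_
  rw [Kernel.lintegral_prod _ _ _ (by fun_prop)]
  rfl

lemma compProd_prod_map_right (μ : Measure γ) [IsFiniteMeasure μ] (κ : Kernel γ α)
    (η : Kernel γ β) [IsFiniteKernel κ] [IsFiniteKernel η] :
    (μ ⊗ₘ (κ ×ₖ η)).map (fun p => ((p.1, p.2.2), p.2.1)) = (μ ⊗ₘ η) ⊗ₘ κ.prodMkRight β := by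
  refine Measure.ext_of_lintegral _ fun f hf => ?_
  rw [lintegral_map hf (by fun_prop), Measure.lintegral_compProd (by fun_prop),
    Measure.lintegral_compProd hf,
    Measure.lintegral_compProd (Measurable.lintegral_kernel_prod_right' hf)]
  refine lintegral_congr fun c => ?_
  rw [Kernel.prod_apply, lintegral_prod_symm _ (by fun_prop)]
  rfl

/-- The identity I(A;B|C) = D(C,A,B) + D(C) - D(C,A) - D(C,B), obtained by applying the chain rule
for divergence to (C,A,B) in two orders. The additive form holds in `ℝ≥0∞` with no finiteness
assumption. Only the reference `m` needs the factorization; `P` is arbitrary. -/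
lemma condMutualInfo_add_obsDiv [StandardBorelSpace α] [Nonempty α] [StandardBorelSpace β]
    [Nonempty β] {P m : Measure Ω} [IsFiniteMeasure P] [IsFiniteMeasure m]
    {A : Ω → α} {B : Ω → β} {C : Ω → γ} (hA : Measurable A) (hB : Measurable B)
    (hC : Measurable C) {κ : Kernel γ β} [IsMarkovKernel κ] (h : FactorsVia m A B C κ) :
    condMutualInfo P A B C
        + (obsDiv P m (fun ω => (C ω, A ω)) + obsDiv P m (fun ω => (C ω, B ω)))
      = obsDiv P m (fun ω => ((C ω, A ω), B ω)) + obsDiv P m C := by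
  have hmB := h.map_prod hA hB hC
  have hCA : P.map (fun ω => (C ω, A ω)) = P.map C ⊗ₘ condDistrib A C P :=
    (compProd_map_condDistrib hA.aemeasurable).symm
  have hCB : P.map (fun ω => (C ω, B ω)) = P.map C ⊗ₘ condDistrib B C P :=
    (compProd_map_condDistrib hB.aemeasurable).symm
  have hCAB : P.map (fun ω => ((C ω, A ω), B ω)) = P.map (fun ω => (C ω, A ω)) ⊗ₘ
      condDistrib B (fun ω => (C ω, A ω)) P := (compProd_map_condDistrib hB.aemeasurable).symm
  have hCBA : P.map (fun ω => ((C ω, B ω), A ω)) = P.map (fun ω => (C ω, B ω)) ⊗ₘ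
      condDistrib A (fun ω => (C ω, B ω)) P := (compProd_map_condDistrib hA.aemeasurable).symm
  have e1 : obsDiv P m (fun ω => ((C ω, A ω), B ω)) = obsDiv P m (fun ω => (C ω, A ω))
      + klDiv (P.map (fun ω => ((C ω, A ω), B ω)))
        (P.map (fun ω => (C ω, A ω)) ⊗ₘ κ.prodMkRight α) := by
    unfold obsDiv
    rw [h, hCAB, klDiv_compProd_eq_add]
  -- The second argument is P_C ⊗ (P_{A|C} × κ), which can be read with `A` first or with `B` first.
  have e2 : klDiv (P.map (fun ω => ((C ω, A ω), B ω)))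
        (P.map (fun ω => (C ω, A ω)) ⊗ₘ κ.prodMkRight α)
      = klDiv (P.map (fun ω => ((C ω, B ω), A ω)))
        ((P.map C ⊗ₘ κ) ⊗ₘ (condDistrib A C P).prodMkRight β) := by
    rw [hCA, ← compProd_prod_map_left, ← compProd_prod_map_right]
    have hf1 : Measurable (fun p : γ × α × β => ((p.1, p.2.1), p.2.2)) := by fun_prop
    have hf2 : Measurable (fun p : γ × α × β => ((p.1, p.2.2), p.2.1)) := by fun_prop
    have a1 : P.map (fun ω => ((C ω, A ω), B ω))
        = (P.map (fun ω => (C ω, A ω, B ω))).map (fun p => ((p.1, p.2.1), p.2.2)) := by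
      rw [Measure.map_map hf1 (by fun_prop)]; rfl
    have a2 : P.map (fun ω => ((C ω, B ω), A ω))
        = (P.map (fun ω => (C ω, A ω, B ω))).map (fun p => ((p.1, p.2.2), p.2.1)) := by
      rw [Measure.map_map hf2 (by fun_prop)]; rfl
    rw [a1, a2, klDiv_map_of_leftInverse (g := fun q => (q.1.1, q.1.2, q.2)) _ _ hf1
      (by fun_prop) (fun _ => rfl), klDiv_map_of_leftInverse (g := fun q => (q.1.1, q.2, q.1.2))
      _ _ hf2 (by fun_prop) (fun _ => rfl)]
  -- Once `B` is split off first, what remains compares the joint law with P_C ⊗ (P_{A|C} ×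
  -- P_{B|C}), and this divergence is the conditional mutual information.
  have e3 : klDiv (P.map (fun ω => ((C ω, B ω), A ω)))
        ((P.map C ⊗ₘ κ) ⊗ₘ (condDistrib A C P).prodMkRight β)
      = klDiv (P.map C ⊗ₘ condDistrib B C P) (P.map C ⊗ₘ κ) + condMutualInfo P A B C := by
    rw [hCBA, klDiv_compProd_eq_add, ← hCB, ← hCBA]
    congr 1
    have hf2 : Measurable (fun p : γ × α × β => ((p.1, p.2.2), p.2.1)) := by fun_prop
    have a2 : P.map (fun ω => ((C ω, B ω), A ω))
        = (P.map (fun ω => (C ω, A ω, B ω))).map (fun p => ((p.1, p.2.2), p.2.1)) := by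
      rw [Measure.map_map hf2 (by fun_prop)]; rfl
    rw [hCB, ← compProd_prod_map_right, a2, klDiv_map_of_leftInverse
      (g := fun q => (q.1.1, q.2, q.1.2)) _ _ hf2 (by fun_prop) (fun _ => rfl)]
    rfl
  have e4 : obsDiv P m (fun ω => (C ω, B ω))
      = obsDiv P m C + klDiv (P.map C ⊗ₘ condDistrib B C P) (P.map C ⊗ₘ κ) := by
    unfold obsDiv
    rw [hmB, hCB, klDiv_compProd_eq_add]
  rw [e1, e2, e3, e4]
  ring

end Divergence

/-- The conditioning variable may be recoded by an injection with a measurable left inverse. This is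
needed because the auxiliary variables are finally encoded as real vectors. -/
lemma FactorsVia.cond_comp {Ω α β γ δ : Type} [MeasurableSpace Ω] [MeasurableSpace α]
    [MeasurableSpace β] [MeasurableSpace γ] [MeasurableSpace δ]
    {μ : Measure Ω} [IsFiniteMeasure μ] {A : Ω → α} {B : Ω → β} {C : Ω → γ}
    {κ : Kernel γ β} [IsSFiniteKernel κ] (h : FactorsVia μ A B C κ)
    (hA : Measurable A) (hB : Measurable B) (hC : Measurable C)
    {g : γ → δ} (hg : Measurable g) {g' : δ → γ} (hg' : Measurable g')
    (hgg : ∀ c, g' (g c) = c) :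
    FactorsVia μ A B (fun ω => g (C ω)) (κ.comap g' hg') := by
  unfold FactorsVia at *
  have hk : Measurable (fun p : γ × α => (g p.1, p.2)) := by fun_prop
  have := map_compProd_comap (μ := μ.map fun ω => (C ω, A ω)) hk
    ((κ.comap g' hg').prodMkRight α)
  rw [Measure.map_map hk (by fun_prop)] at this
  have e : ((κ.comap g' hg').prodMkRight α).comap (fun p : γ × α => (g p.1, p.2)) hk
      = κ.prodMkRight α := by
    ext1 p; simp [Kernel.comap_apply, Kernel.prodMkRight_apply, hgg]
  rw [e, ← h, Measure.map_map (by fun_prop) (by fun_prop)] at this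
  exact this

lemma condMutualInfo_map {Ω Ω' α β γ : Type} [MeasurableSpace Ω] [MeasurableSpace Ω']
    [MeasurableSpace α] [StandardBorelSpace α] [Nonempty α] [MeasurableSpace β]
    [StandardBorelSpace β] [Nonempty β] [MeasurableSpace γ]
    (μ : Measure Ω) [IsFiniteMeasure μ] {f : Ω → Ω'} (hf : Measurable f)
    {A : Ω' → α} {B : Ω' → β} {C : Ω' → γ}
    (hA : Measurable A) (hB : Measurable B) (hC : Measurable C) :
    condMutualInfo (μ.map f) A B C
      = condMutualInfo μ (fun ω => A (f ω)) (fun ω => B (f ω)) (fun ω => C (f ω)) := by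
  unfold condMutualInfo
  rw [Measure.map_map (by fun_prop) hf, Measure.map_map hC hf]
  congr 1
  refine Measure.compProd_congr ?_
  have h1 := condDistrib_map (ν := μ) (f := f) (X := C) (Y := A) (mα := inferInstance)
    (mβ := inferInstance) hC.aemeasurable hA.aemeasurable hf.aemeasurable
  have h2 := condDistrib_map (ν := μ) (f := f) (X := C) (Y := B) (mα := inferInstance)
    (mβ := inferInstance) hC.aemeasurable hB.aemeasurable hf.aemeasurable
  filter_upwards [h1, h2] with c hc1 hc2
  rw [Kernel.prod_apply, Kernel.prod_apply, hc1, hc2]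
  rfl

/-! ### Mixtures over a finite index -/

section Mixture

variable {ι Ω β : Type} [Fintype ι] [MeasurableSpace ι] [DiscreteMeasurableSpace ι]
  [MeasurableSpace Ω] [MeasurableSpace β]

/-- The joint law of an index with weights `p` and an observation with law `μ t` given the
index `t`. -/
def mixture (p : ι → ℝ≥0) (μ : ι → Measure Ω) : Measure (ι × Ω) :=
  ∑ t, p t • (μ t).map (Prod.mk t)

lemma lintegral_mixture (p : ι → ℝ≥0) (μ : ι → Measure Ω) {f : ι × Ω → ℝ≥0∞}
    (hf : Measurable f) :
    ∫⁻ q, f q ∂(mixture p μ) = ∑ t, (p t : ℝ≥0∞) * ∫⁻ ω, f (t, ω) ∂(μ t) := by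
  unfold mixture
  rw [lintegral_finsetSum_measure]
  refine Finset.sum_congr rfl fun t _ => ?_
  rw [lintegral_smul_measure, lintegral_map hf (by fun_prop)]
  rfl

lemma measurable_of_slices {γ : Type} [MeasurableSpace γ] {f : ι × Ω → γ}
    (h : ∀ t, Measurable fun ω => f (t, ω)) : Measurable f :=
  measurable_from_prod_countable_right h

instance (p : ι → ℝ≥0) (μ : ι → Measure Ω) [∀ t, IsFiniteMeasure (μ t)] :
    IsFiniteMeasure (mixture p μ) := by
  unfold mixture; infer_instance

lemma mixture_map (p : ι → ℝ≥0) (μ : ι → Measure Ω) {Z : ι → Ω → β}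
    (hZ : ∀ t, Measurable (Z t)) :
    (mixture p μ).map (fun q => (q.1, Z q.1 q.2)) = mixture p fun t => (μ t).map (Z t) := by
  have hm : Measurable fun q : ι × Ω => (q.1, Z q.1 q.2) :=
    measurable_fst.prodMk (measurable_of_slices hZ)
  refine Measure.ext_of_lintegral _ fun f hf => ?_
  rw [lintegral_map hf hm, lintegral_mixture _ _ (by fun_prop), lintegral_mixture _ _ hf]
  refine Finset.sum_congr rfl fun t _ => ?_
  rw [lintegral_map (by fun_prop) (hZ t)]

/-- The weights agree under both laws and the index is observed, so the density on the slice `t` is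
that of `μ t` with respect to `ν t`, and the divergence averages. -/
lemma klDiv_mixture (p : ι → ℝ≥0) (μ ν : ι → Measure Ω) [∀ t, IsFiniteMeasure (μ t)]
    [∀ t, IsFiniteMeasure (ν t)] (hac : ∀ t, μ t ≪ ν t) :
    klDiv (mixture p μ) (mixture p ν) = ∑ t, (p t : ℝ≥0∞) * klDiv (μ t) (ν t) := by
  set F : ι × Ω → ℝ≥0∞ := fun q => (μ q.1).rnDeriv (ν q.1) q.2 with hF
  have hFm : Measurable F := measurable_of_slices fun t => Measure.measurable_rnDeriv (μ t) (ν t)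
  have hd : mixture p μ = (mixture p ν).withDensity F := by
    refine Measure.ext_of_lintegral _ fun f hf => ?_
    rw [lintegral_withDensity_eq_lintegral_mul _ hFm hf, lintegral_mixture _ _ hf,
      lintegral_mixture _ _ (hFm.mul hf)]
    refine Finset.sum_congr rfl fun t _ => ?_
    rw [← lintegral_rnDeriv_mul (hac t) (by fun_prop)]
    rfl
  have hac' : mixture p μ ≪ mixture p ν := by
    rw [hd]; exact withDensity_absolutelyContinuous _ _
  have hr : (mixture p μ).rnDeriv (mixture p ν) =ᵐ[mixture p ν] F := by
    rw [hd]; exact Measure.rnDeriv_withDensity _ hFm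
  rw [klDiv_eq_lintegral_klFun_of_ac hac']
  have : ∫⁻ q, ENNReal.ofReal (klFun ((mixture p μ).rnDeriv (mixture p ν) q).toReal) ∂(mixture p ν)
      = ∫⁻ q, ENNReal.ofReal (klFun (F q).toReal) ∂(mixture p ν) :=
    lintegral_congr_ae (by filter_upwards [hr] with q hq; rw [hq])
  rw [this, lintegral_mixture _ _ (by fun_prop)]
  exact Finset.sum_congr rfl fun t _ => by rw [klDiv_eq_lintegral_klFun_of_ac (hac t)]

lemma obsDiv_mixture (p : ι → ℝ≥0) (μ ν : ι → Measure Ω) [∀ t, IsFiniteMeasure (μ t)]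
    [∀ t, IsFiniteMeasure (ν t)] (hac : ∀ t, μ t ≪ ν t) {Z : ι → Ω → β}
    (hZ : ∀ t, Measurable (Z t)) :
    obsDiv (mixture p μ) (mixture p ν) (fun q => (q.1, Z q.1 q.2))
      = ∑ t, (p t : ℝ≥0∞) * obsDiv (μ t) (ν t) (Z t) := by
  unfold obsDiv
  rw [mixture_map p μ hZ, mixture_map p ν hZ, klDiv_mixture]
  exact fun t => (hac t).map (hZ t)

/-- The law of a random index with weights `p`. -/
def indexLaw (p : ι → ℝ≥0) : Measure ι := ∑ t, p t • Measure.dirac t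

lemma indexLaw_prod (p : ι → ℝ≥0) (μ : Measure Ω) [SFinite μ] :
    (indexLaw p).prod μ = mixture p fun _ => μ := by
  have hs : SFinite (indexLaw p) := by unfold indexLaw; infer_instance
  refine Measure.ext_of_lintegral _ fun f hf => ?_
  rw [lintegral_prod _ hf.aemeasurable, lintegral_mixture _ _ hf]
  unfold indexLaw
  rw [lintegral_finsetSum_measure]
  refine Finset.sum_congr rfl fun t _ => ?_
  rw [lintegral_smul_measure, lintegral_dirac]
  rfl

lemma isProbabilityMeasure_indexLaw {p : ι → ℝ≥0} (hp : ∑ t, p t = 1) :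
    IsProbabilityMeasure (indexLaw p) := by
  constructor
  unfold indexLaw
  have : (∑ t, (p t • Measure.dirac t : Measure ι)) Set.univ = ∑ t, (p t : ℝ≥0∞) := by
    rw [Measure.finsetSum_apply]
    refine Finset.sum_congr rfl fun t _ => ?_
    rw [Measure.smul_apply]; simp [ENNReal.smul_def]
  rw [this, ← ENNReal.ofNNReal_finsetSum, hp]; simp

end Mixture

/-! ### The rate of a mixture of single-letter tests -/

section Rate

variable {ι N E α β βa βb ζ ξ δ₁ δ₂ γ : Type} [Fintype ι] [MeasurableSpace ι]
  [DiscreteMeasurableSpace ι] [MeasurableSpace N] [MeasurableSpace E] [MeasurableSpace α]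
  [MeasurableSpace β] [MeasurableSpace βa] [MeasurableSpace βb] [MeasurableSpace ζ]
  [MeasurableSpace ξ] [MeasurableSpace δ₁] [MeasurableSpace δ₂] [MeasurableSpace γ]

/-- The law of a pair obtained from independent `n ∼ ν`, `e ∼ Q` by updating `n` according to the
source value `x e`. -/
def updateLaw (ν : Measure N) (Q : Measure E) (x : E → α) (φ : N → α → N) : Measure (N × E) :=
  (ν.prod Q).map fun q => (φ q.1 (x q.2), q.2)

lemma isProbabilityMeasure_updateLaw (ν : Measure N) (Q : Measure E) [IsProbabilityMeasure ν]
    [IsProbabilityMeasure Q] {x : E → α} (hx : Measurable x) {φ : N → α → N}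
    (hφ : Measurable (Function.uncurry φ)) : IsProbabilityMeasure (updateLaw ν Q x φ) := by
  refine Measure.isProbabilityMeasure_map (Measurable.aemeasurable ?_)
  exact (hφ.comp (show Measurable fun q : N × E => (q.1, x q.2) by fun_prop)).prodMk measurable_snd

/-- The update uses the letter only through `x`. A variable generated from `C` independently of `x`
is thus still generated by the same kernel when the updated context is known as well. -/
lemma factorsVia_updateLaw {ν : Measure N} {Q : Measure E} [IsProbabilityMeasure ν]
    [IsProbabilityMeasure Q] {x : E → α} (hx : Measurable x) {φ : N → α → N}
    (hφ : Measurable (Function.uncurry φ)) {B : E → β} {C : E → γ} (hB : Measurable B)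
    (hC : Measurable C) {κ : Kernel γ β} [IsSFiniteKernel κ] (h : FactorsVia Q x B C κ) :
    FactorsVia (updateLaw ν Q x φ) (fun q => (q.1, x q.2)) (fun q => B q.2) (fun q => C q.2) κ := by
  have hφ' : Measurable fun q : N × E => φ q.1 (x q.2) :=
    hφ.comp (show Measurable fun q : N × E => (q.1, x q.2) by fun_prop)
  refine FactorsVia.of_map_eq (hφ'.prodMk measurable_snd) (by fun_prop) (by fun_prop)
    (by fun_prop) ?_
  have h1 := (h.prod_left (ν := ν) hx hB hC)
  have hφ2 : Measurable fun r : γ × N × α => φ r.2.1 r.2.2 :=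
    hφ.comp (show Measurable fun r : γ × N × α => (r.2.1, r.2.2) by fun_prop)
  exact h1.comp (by fun_prop) (by fun_prop) (by fun_prop)
    (g := fun r : γ × N × α => (φ r.2.1 r.2.2, r.2.2)) (by fun_prop)

lemma prod_prod_eq_map {Ω₁ Ω₂ Ω₃ : Type} [MeasurableSpace Ω₁] [MeasurableSpace Ω₂]
    [MeasurableSpace Ω₃] (μ : Measure Ω₁) (ν : Measure Ω₂) (τ : Measure Ω₃) [SFinite μ]
    [SFinite ν] [SFinite τ] :
    (μ.prod ν).prod τ = (μ.prod (ν.prod τ)).map (fun q => ((q.1, q.2.1), q.2.2)) := by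
  rw [← Measure.prodAssoc_prod, Measure.map_map (by fun_prop) (by fun_prop)]
  exact Measure.map_id.symm

lemma factorsVia_self {μ : Measure E} [IsFiniteMeasure μ] [StandardBorelSpace β] [Nonempty β]
    {B : E → β} {C : E → γ} (hB : Measurable B) (hC : Measurable C) :
    FactorsVia μ C B C (condDistrib B C μ) := by
  unfold FactorsVia
  refine Measure.ext_of_lintegral _ fun f hf => ?_
  rw [lintegral_map hf (by fun_prop), Measure.lintegral_compProd hf,
    lintegral_map (Measurable.lintegral_kernel_prod_right' hf) (by fun_prop)]
  exact lintegral_eq_of_map_eq_compProd (f := fun q => f ((q.1, q.1), q.2)) hC hB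
    (compProd_map_condDistrib hB.aemeasurable).symm (by fun_prop)

lemma updateLaw_index (p : ι → ℝ≥0) (ν : Measure N) [IsProbabilityMeasure ν] (Q : Measure E)
    [IsProbabilityMeasure Q] {x : E → α} (hx : Measurable x) {φ : ι → N → α → N}
    (hφ : ∀ t, Measurable (Function.uncurry (φ t))) :
    updateLaw ((indexLaw p).prod ν) Q x (fun q a => (q.1, φ q.1 q.2 a))
      = (mixture p fun t => updateLaw ν Q x (φ t)).map (fun q => ((q.1, q.2.1), q.2.2)) := by
  have hs : SFinite (indexLaw p) := by unfold indexLaw; infer_instance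
  have hφt : ∀ t, Measurable fun q : N × E => (φ t q.1 (x q.2), q.2) := fun t =>
    ((hφ t).comp (show Measurable fun q : N × E => (q.1, x q.2) by fun_prop)).prodMk measurable_snd
  have e : ((indexLaw p).prod ν).prod Q
      = (mixture p fun _ => ν.prod Q).map (fun q => ((q.1, q.2.1), q.2.2)) := by
    rw [← indexLaw_prod, prod_prod_eq_map]
  have hm : Measurable fun q : (ι × N) × E => ((q.1.1, φ q.1.1 q.1.2 (x q.2)), q.2) := by
    have h0 : Measurable fun r : ι × (N × E) => φ r.1 r.2.1 (x r.2.2) :=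
      measurable_of_slices fun t => measurable_fst.comp (hφt t)
    have := h0.comp (show Measurable fun q : (ι × N) × E => (q.1.1, (q.1.2, q.2)) by fun_prop)
    exact (measurable_fst.fst.prodMk this).prodMk measurable_snd
  unfold updateLaw
  rw [e, ← mixture_map p (fun _ => ν.prod Q) hφt, Measure.map_map hm (by fun_prop),
    Measure.map_map (by fun_prop) (measurable_fst.prodMk (measurable_of_slices hφt))]
  rfl

/-- Averages the single-index divergences: the index is part of the observation and is never changed
by the update. -/
lemma obsDiv_updateLaw_index {χ : Type} [MeasurableSpace χ] (p : ι → ℝ≥0) (ν : Measure N)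
    [IsProbabilityMeasure ν] (Q : Measure E)
    [IsProbabilityMeasure Q] {x : E → α} (hx : Measurable x) {φ : ι → N → α → N}
    (hφ : ∀ t, Measurable (Function.uncurry (φ t)))
    (hac : ∀ t, updateLaw ν Q x (φ t) ≪ ν.prod Q) {Z : ι → N × E → χ}
    (hZ : ∀ t, Measurable (Z t)) :
    obsDiv (updateLaw ((indexLaw p).prod ν) Q x (fun q a => (q.1, φ q.1 q.2 a)))
        (((indexLaw p).prod ν).prod Q) (fun q => (q.1.1, Z q.1.1 (q.1.2, q.2)))
      = ∑ t, (p t : ℝ≥0∞) * obsDiv (updateLaw ν Q x (φ t)) (ν.prod Q) (Z t) := by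
  have hs : SFinite (indexLaw p) := by unfold indexLaw; infer_instance
  have e : ((indexLaw p).prod ν).prod Q
      = (mixture p fun _ => ν.prod Q).map (fun q => ((q.1, q.2.1), q.2.2)) := by
    rw [← indexLaw_prod, prod_prod_eq_map]
  have hprob : ∀ t, IsProbabilityMeasure (updateLaw ν Q x (φ t)) := fun t =>
    isProbabilityMeasure_updateLaw ν Q hx (hφ t)
  have h0 : Measurable fun r : ι × (N × E) => Z r.1 r.2 := measurable_of_slices hZ
  have hm : Measurable fun q : (ι × N) × E => (q.1.1, Z q.1.1 (q.1.2, q.2)) := by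
    have := h0.comp (show Measurable fun q : (ι × N) × E => (q.1.1, (q.1.2, q.2)) by fun_prop)
    exact measurable_fst.fst.prodMk this
  rw [updateLaw_index p ν Q hx hφ, e, obsDiv_map _ _ (by fun_prop) hm]
  exact obsDiv_mixture p _ _ hac hZ

/-- Single-letterization of the rate: the sum of the two conditional mutual informations is bounded
by an average over the index of differences of divergences. -/
theorem rate_le_of_index [StandardBorelSpace α] [Nonempty α] [StandardBorelSpace βa]
    [Nonempty βa] [StandardBorelSpace δ₁] [Nonempty δ₁] [StandardBorelSpace δ₂] [Nonempty δ₂]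
    {p : ι → ℝ≥0} (hp : ∑ t, p t = 1)
    (ν : Measure N) [IsProbabilityMeasure ν] (Q : Measure E) [IsProbabilityMeasure Q]
    {x : E → α} {y : E → β} {ya : E → βa} {yb : E → βb} (hx : Measurable x) (hy : Measurable y)
    (hya : Measurable ya) (hyb : Measurable yb)
    {κ : Kernel β (βa × βb)} [IsMarkovKernel κ] (hκ : FactorsVia Q x (fun e => (ya e, yb e)) y κ)
    {φ : ι → N → α → N} (hφ : ∀ t, Measurable (Function.uncurry (φ t)))
    (hac : ∀ t, updateLaw ν Q x (φ t) ≪ ν.prod Q)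
    (hfin : ∀ t, klDiv (updateLaw ν Q x (φ t)) (ν.prod Q) ≠ ∞)
    {G : ι → N → ζ} (hG : ∀ t, Measurable (G t)) {V : ι → N → ξ} (hV : ∀ t, Measurable (V t))
    {w : ι × ζ → δ₁} (hw : Measurable w) {w' : δ₁ → ι × ζ} (hw' : Measurable w')
    (hww : ∀ z, w' (w z) = z)
    {v : ξ → δ₂} (hv : Measurable v) {v' : δ₂ → ξ} (hv' : Measurable v') (hvv : ∀ z, v' (v z) = z)
    {c : (ι × ζ) × β → γ} (hc : Measurable c) {c' : γ → (ι × ζ) × β} (hc' : Measurable c')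
    (hcc : ∀ z, c' (c z) = z)
    {P : Measure ((ι × N) × E)}
    (hP : P = updateLaw ((indexLaw p).prod ν) Q x (fun q a => (q.1, φ q.1 q.2 a))) 
    [IsProbabilityMeasure P] :
    condMutualInfo P (fun q => x q.2) (fun q => w (q.1.1, G q.1.1 q.1.2)) (fun q => ya q.2)
      + condMutualInfo P (fun q => x q.2) (fun q => v (V q.1.1 q.1.2))
          (fun q => c ((q.1.1, G q.1.1 q.1.2), y q.2))
      + ∑ t, (p t : ℝ≥0∞) * (obsDiv (updateLaw ν Q x (φ t)) (ν.prod Q)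
            (fun r => (G t r.1, ya r.2))
          + obsDiv (updateLaw ν Q x (φ t)) (ν.prod Q)
            (fun r => (G t r.1, V t r.1, y r.2, ya r.2, yb r.2)))
      ≤ ∑ t, (p t : ℝ≥0∞) * (obsDiv (updateLaw ν Q x (φ t)) (ν.prod Q)
            (fun r => (G t r.1, V t r.1, y r.2, x r.2))
          + obsDiv (updateLaw ν Q x (φ t)) (ν.prod Q) (fun r => (G t r.1, y r.2))) := by
  have hip := isProbabilityMeasure_indexLaw hp
  have hprob : ∀ t, IsProbabilityMeasure (updateLaw ν Q x (φ t)) := fun t =>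
    isProbabilityMeasure_updateLaw ν Q hx (hφ t)
  set m := ((indexLaw p).prod ν).prod Q with hm
  have hGm : Measurable fun q : ι × N => G q.1 q.2 := measurable_of_slices hG
  have hVm : Measurable fun q : ι × N => V q.1 q.2 := measurable_of_slices hV
  have hφm : Measurable (Function.uncurry fun (q : ι × N) (a : α) => (q.1, φ q.1 q.2 a)) := by
    have h0 : Measurable fun r : ι × (N × α) => φ r.1 r.2.1 r.2.2 := measurable_of_slices hφ
    have := h0.comp (show Measurable fun q : (ι × N) × α => (q.1.1, (q.1.2, q.2)) by fun_prop)
    exact measurable_fst.fst.prodMk this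
  set tg : (ι × N) × E → ι × ζ := fun q => (q.1.1, G q.1.1 q.1.2) with htg
  have htgm : Measurable tg := measurable_fst.fst.prodMk (hGm.comp measurable_fst)
  set Vq : (ι × N) × E → ξ := fun q => V q.1.1 q.1.2 with hVq
  have hVqm : Measurable Vq := hVm.comp measurable_fst
  set X : (ι × N) × E → α := fun q => x q.2 with hXdef
  set Y : (ι × N) × E → β := fun q => y q.2 with hYdef
  set Ya : (ι × N) × E → βa := fun q => ya q.2 with hYadef
  set Yb : (ι × N) × E → βb := fun q => yb q.2 with hYbdef
  have hX : Measurable X := by fun_prop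
  have hY : Measurable Y := by fun_prop
  have hYa : Measurable Ya := by fun_prop
  have hYb : Measurable Yb := by fun_prop
  change condMutualInfo P X (fun q => w (tg q)) Ya
    + condMutualInfo P X (fun q => v (Vq q)) (fun q => c (tg q, Y q)) + _ ≤ _
  -- Under the reference law the context is independent of the letter, so `w` has a constant
  -- conditional law given `(Ya, X)`.
  have f1 : ∃ κ₁ : Kernel βa δ₁, IsMarkovKernel κ₁ ∧
      FactorsVia m X (fun q => w (tg q)) Ya κ₁ := by
    have h := factorsVia_prod (ν := (indexLaw p).prod ν) (μ := Q) (G := fun _ => ())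
      (V := fun q : ι × N => w (q.1, G q.1 q.2)) (A := x) (C := ya) (by fun_prop) (by fun_prop)
      hx hya
    exact ⟨_, inferInstance, h.cond_comp (g := Prod.snd) (g' := fun b => ((), b)) (by fun_prop)
      (by fun_prop) (by fun_prop) (by fun_prop) (by fun_prop) (fun _ => rfl)⟩
  -- By the same independence, given `tg`, `Y` and `X` the law of `Vq` depends on `tg` alone.
  have f2 : ∃ κ₂ : Kernel γ δ₂, IsMarkovKernel κ₂ ∧
      FactorsVia m X (fun q => v (Vq q)) (fun q => c (tg q, Y q)) κ₂ := by
    have h := factorsVia_prod (ν := (indexLaw p).prod ν) (μ := Q) 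
      (G := fun q : ι × N => (q.1, G q.1 q.2))
      (V := fun q : ι × N => v (V q.1 q.2)) (A := x) (C := y) (by fun_prop) (by fun_prop)
      hx hy
    exact ⟨_, inferInstance, h.cond_comp (g := c) (g' := c') (by fun_prop)
      (by fun_prop) (by fun_prop) hc hc' hcc⟩
  obtain ⟨κ₁, hκ₁, f1⟩ := f1
  obtain ⟨κ₂, hκ₂, f2⟩ := f2
  have I1 := condMutualInfo_add_obsDiv (P := P) hX (by fun_prop) hYa f1
  have I2 := condMutualInfo_add_obsDiv (P := P) hX (by fun_prop) (by fun_prop) f2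
  have hsum : ∀ {χ : Type} [MeasurableSpace χ] {Z : ι → N × E → χ}, (∀ t, Measurable (Z t)) →
      obsDiv P m (fun q => (q.1.1, Z q.1.1 (q.1.2, q.2)))
        = ∑ t, (p t : ℝ≥0∞) * obsDiv (updateLaw ν Q x (φ t)) (ν.prod Q) (Z t) := by
    intro χ _ Z hZ
    rw [hP]; exact obsDiv_updateLaw_index p ν Q hx hφ hac hZ
  -- Finiteness is what later allows common terms to be cancelled in `ℝ≥0∞`.
  have hfinite : ∀ {χ : Type} [MeasurableSpace χ] {Z : (ι × N) × E → χ}, Measurable Z →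
      obsDiv P m Z ≠ ∞ := by
    intro χ _ Z hZ
    have h1 : obsDiv P m (fun q : (ι × N) × E => (q.1.1, (q.1.2, q.2))) ≠ ∞ := by
      rw [hsum (Z := fun _ r => r) (fun t => measurable_id)]
      refine (ENNReal.sum_lt_top.2 fun t _ => ENNReal.mul_lt_top (by simp) ?_).ne
      exact (obsDiv_le_klDiv measurable_id).trans_lt (hfin t).lt_top
    refine ne_top_of_le_ne_top h1 (obsDiv_le_of_comp (fun r => Z ((r.1, r.2.1), r.2.2))
      (by fun_prop) (by fun_prop) (fun _ => rfl))
  -- `Ya` is produced from `X` by one kernel under both laws, so observing it next to `(X, tg)` is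
  -- free; observing `Y` can then only increase the divergence.
  have s1 : obsDiv P m (fun q => ((Ya q, X q), w (tg q)))
      ≤ obsDiv P m (fun q => (c (tg q, Y q), X q)) := by
    have g0 : FactorsVia Q x ya x (condDistrib ya x Q) := factorsVia_self hya hx
    have g1 := factorsVia_updateLaw (ν := (indexLaw p).prod ν) hx hφm hya hx g0
    have g2 : ∀ {M' : Measure ((ι × N) × E)} [IsFiniteMeasure M'],
        FactorsVia M' (fun q => (q.1, x q.2)) (fun q => ya q.2) (fun q => x q.2)
          (condDistrib ya x Q) → FactorsVia M' tg Ya X (condDistrib ya x Q) := by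
      intro M' _ h
      exact h.comp (by fun_prop) (by fun_prop) (by fun_prop)
        (g := fun r : α × (ι × N) × α => (r.2.1.1, G r.2.1.1 r.2.1.2)) (by fun_prop)
    have g3 := obsDiv_prod_eq_of_factorsVia (P := P) (m := m) (g2 (hP ▸ g1))
      (g2 (g0.prod_left hx hya hx))
    calc _ ≤ obsDiv P m (fun q => ((X q, tg q), Ya q)) :=
          obsDiv_le_of_comp (fun r => ((r.2, r.1.1), w r.1.2)) (by fun_prop) (by fun_prop)
            (fun _ => rfl)
      _ = _ := g3
      _ ≤ _ := obsDiv_le_of_comp (fun r => (r.2, (c' r.1).1)) (by fun_prop) (by fun_prop)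
            (fun q => by simp [hcc])
  -- Here the chain X ↔ Y ↔ (Ya, Yb) enters: next to `Y` the pair `(Ya, Yb)` is free, even together
  -- with `tg` and `Vq`.
  have s2 : obsDiv P m (fun q => (q.1.1, (G q.1.1 q.1.2, V q.1.1 q.1.2, y q.2, ya q.2, yb q.2)))
      ≤ obsDiv P m (fun q => (c (tg q, Y q), v (Vq q))) := by
    have g1 := factorsVia_updateLaw (ν := (indexLaw p).prod ν) hx hφm (hya.prodMk hyb) hy hκ
    have g2 : ∀ {M' : Measure ((ι × N) × E)} [IsFiniteMeasure M'],
        FactorsVia M' (fun q => (q.1, x q.2)) (fun q => (ya q.2, yb q.2)) (fun q => y q.2)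
          κ → FactorsVia M' (fun q => (tg q, Vq q)) (fun q => (Ya q, Yb q)) Y κ := by
      intro M' _ h
      exact h.comp (by fun_prop) (by fun_prop) (by fun_prop)
        (g := fun r : β × (ι × N) × α => ((r.2.1.1, G r.2.1.1 r.2.1.2), V r.2.1.1 r.2.1.2))
        (by fun_prop)
    have g3 := obsDiv_prod_eq_of_factorsVia (P := P) (m := m) (g2 (hP ▸ g1))
      (g2 (hκ.prod_left hx (hya.prodMk hyb) hy))
    calc _ ≤ obsDiv P m (fun q => ((Y q, (tg q, Vq q)), (Ya q, Yb q))) :=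
          obsDiv_le_of_comp (fun r => (r.1.2.1.1, (r.1.2.1.2, r.1.2.2, r.1.1, r.2.1, r.2.2)))
            (by fun_prop) (by fun_prop) (fun _ => rfl)
      _ = _ := g3
      _ ≤ _ := obsDiv_le_of_comp (fun r => ((c' r.1).2, ((c' r.1).1, v' r.2))) (by fun_prop)
            (by fun_prop) (fun q => by simp [hcc, hvv])
  have s3 : obsDiv P m (fun q => (q.1.1, (G q.1.1 q.1.2, ya q.2)))
      ≤ obsDiv P m (fun q => (Ya q, w (tg q))) :=
    obsDiv_le_of_comp (fun r => ((w' r.2).1, (w' r.2).2, r.1)) (by fun_prop) (by fun_prop)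
      (fun q => by simp [hww, htg, hYadef])
  have s4 : obsDiv P m (fun q => ((c (tg q, Y q), X q), v (Vq q)))
      ≤ obsDiv P m (fun q => (q.1.1, (G q.1.1 q.1.2, V q.1.1 q.1.2, y q.2, x q.2))) :=
    obsDiv_le_of_comp (fun r => ((c ((r.1, r.2.1), r.2.2.2.1), r.2.2.2.2), v r.2.2.1))
      (by fun_prop) (by fun_prop) (fun q => rfl)
  have s5 : obsDiv P m (fun q => c (tg q, Y q))
      ≤ obsDiv P m (fun q => (q.1.1, (G q.1.1 q.1.2, y q.2))) :=
    obsDiv_le_of_comp (fun r => c ((r.1, r.2.1), r.2.2)) (by fun_prop) (by fun_prop) (fun q => rfl)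
  have s6 : obsDiv P m Ya ≤ obsDiv P m (fun q => (Ya q, X q)) :=
    obsDiv_le_of_comp Prod.fst (by fun_prop) (by fun_prop) (fun q => rfl)
  simp_rw [mul_add, Finset.sum_add_distrib]
  rw [← hsum (Z := fun t r => (G t r.1, ya r.2)) (fun t => by fun_prop),
    ← hsum (Z := fun t r => (G t r.1, V t r.1, y r.2, ya r.2, yb r.2)) (fun t => by fun_prop),
    ← hsum (Z := fun t r => (G t r.1, V t r.1, y r.2, x r.2)) (fun t => by fun_prop),
    ← hsum (Z := fun t r => (G t r.1, y r.2)) (fun t => by fun_prop)]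
  have F1 : obsDiv P m (fun q => (Ya q, X q)) ≠ ∞ := hfinite (by fun_prop)
  have F2 : obsDiv P m (fun q => (c (tg q, Y q), X q)) ≠ ∞ := hfinite (by fun_prop)
  have J1 : condMutualInfo P X (fun q => w (tg q)) Ya + obsDiv P m (fun q => (Ya q, w (tg q)))
      ≤ obsDiv P m (fun q => (c (tg q, Y q), X q)) := by
    refine (ENNReal.add_le_add_iff_left F1).1 ?_
    calc _ = condMutualInfo P X (fun q => w (tg q)) Ya + (obsDiv P m (fun q => (Ya q, X q))
          + obsDiv P m (fun q => (Ya q, w (tg q)))) := by ring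
      _ = _ := I1
      _ ≤ _ := by rw [add_comm]; exact add_le_add s6 s1
  -- The term D(W,Y,X) bounds the first information from above and is subtracted in the second, so
  -- it cancels when the two are added.
  refine (ENNReal.add_le_add_iff_left F2).1 ?_
  calc _ ≤ obsDiv P m (fun q => (c (tg q, Y q), X q))
        + (condMutualInfo P X (fun q => w (tg q)) Ya
          + condMutualInfo P X (fun q => v (Vq q)) (fun q => c (tg q, Y q))
          + (obsDiv P m (fun q => (Ya q, w (tg q)))
            + obsDiv P m (fun q => (c (tg q, Y q), v (Vq q))))) := by gcongr
    _ = (condMutualInfo P X (fun q => w (tg q)) Ya + obsDiv P m (fun q => (Ya q, w (tg q))))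
        + (condMutualInfo P X (fun q => v (Vq q)) (fun q => c (tg q, Y q))
          + (obsDiv P m (fun q => (c (tg q, Y q), X q))
            + obsDiv P m (fun q => (c (tg q, Y q), v (Vq q))))) := by ring
    _ ≤ _ := by rw [I2]; gcongr

end Rate

/-! ### Telescoping of divergences along a block. -/

section Telescoping

lemma measurable_update_pair {n : ℕ} {α : Type} [MeasurableSpace α] (t : Fin n) :
    Measurable fun q : (Fin n → α) × α => Function.update q.1 t q.2 := by
  refine measurable_pi_lambda _ fun i => ?_
  by_cases h : i = t
  · subst h; simpa using measurable_snd
  · simp only [Function.update_of_ne h]; fun_prop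

/-- Resampling one letter of an i.i.d. block leaves its law unchanged. The contexts carry a stale
letter at the current index, and this lemma lets the true letter take its place. -/
lemma map_update_pi {n : ℕ} {E : Type} [MeasurableSpace E] (Q : Measure E)
    [IsProbabilityMeasure Q] (t : Fin n) :
    ((Measure.pi fun _ : Fin n => Q).prod Q).map (fun q => Function.update q.1 t q.2)
      = Measure.pi fun _ : Fin n => Q := by
  have hm := measurable_update_pair (α := E) t
  symm
  refine Measure.pi_eq fun s hs => ?_
  rw [Measure.map_apply hm (MeasurableSet.univ_pi hs)]
  have : (fun q : (Fin n → E) × E => Function.update q.1 t q.2) ⁻¹' (Set.univ.pi s)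
      = (Set.univ.pi (Function.update s t Set.univ)) ×ˢ (s t) := by
    ext q
    simp only [Set.mem_preimage, Set.mem_univ_pi, Set.mem_prod]
    constructor
    · intro h
      refine ⟨fun i => ?_, by simpa using h t⟩
      by_cases hi : i = t
      · subst hi; simp
      · simpa [Function.update_of_ne hi] using h i
    · rintro ⟨h1, h2⟩ i
      by_cases hi : i = t
      · subst hi; simpa using h2
      · simpa [Function.update_of_ne hi] using h1 i
  rw [this, Measure.prod_prod, Measure.pi_pi, ← Finset.mul_prod_erase _ _ (Finset.mem_univ t),
    ← Finset.mul_prod_erase (s := Finset.univ) (fun i => Q (s i)) (Finset.mem_univ t)]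
  simp only [Function.update_self, measure_univ, one_mul]
  rw [mul_comm]
  congr 1
  refine Finset.prod_congr rfl fun i hi => ?_
  rw [Function.update_of_ne (Finset.ne_of_mem_erase hi)]

variable {N E α β βa βb ζ ξ : Type} [MeasurableSpace N] [MeasurableSpace E] [MeasurableSpace α]
  [MeasurableSpace β] [MeasurableSpace βa] [MeasurableSpace βb] [MeasurableSpace ζ]
  [MeasurableSpace ξ]

/-- A union bound over the finitely many maps `ψ j` that the update may apply. The letter chooses
which map is applied, and summing over all of them removes this dependence. -/
lemma updateLaw_le {J : Type} [Fintype J] {ν : Measure N} [IsProbabilityMeasure ν] {Q : Measure E}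
    [IsProbabilityMeasure Q] {x : E → α} (hx : Measurable x) {φ : N → α → N}
    (hφ : Measurable (Function.uncurry φ)) {ψ : J → N → N} (hψ : ∀ j, Measurable (ψ j))
    (hcov : ∀ n a, ∃ j, φ n a = ψ j n) {c : ℝ≥0∞} (hsum : ∑ j, ν.map (ψ j) ≤ c • ν) :
    updateLaw ν Q x φ ≤ c • ν.prod Q := by
  have hm : Measurable fun q : N × E => (φ q.1 (x q.2), q.2) :=
    (hφ.comp (show Measurable fun q : N × E => (q.1, x q.2) by fun_prop)).prodMk measurable_snd
  refine Measure.le_iff.2 fun s hs => ?_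
  unfold updateLaw
  rw [Measure.map_apply hm hs]
  have hi : ∀ j, Measurable fun q : N × E => (ψ j q.1, q.2) := fun j => by fun_prop
  calc (ν.prod Q) ((fun q : N × E => (φ q.1 (x q.2), q.2)) ⁻¹' s)
      ≤ (ν.prod Q) (⋃ j, (fun q : N × E => (ψ j q.1, q.2)) ⁻¹' s) := by
        refine measure_mono fun q hq => ?_
        obtain ⟨j, hj⟩ := hcov q.1 (x q.2)
        refine Set.mem_iUnion.2 ⟨j, ?_⟩
        simpa [← hj] using hq
    _ ≤ ∑ j, (ν.prod Q) ((fun q : N × E => (ψ j q.1, q.2)) ⁻¹' s) := by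
        refine (measure_iUnion_le _).trans ?_
        rw [tsum_fintype]
    _ = ((∑ j, ν.map (ψ j)).prod Q) s := by
        have : ∀ j, (ν.prod Q) ((fun q : N × E => (ψ j q.1, q.2)) ⁻¹' s)
            = ∫⁻ n, Q (Prod.mk n ⁻¹' s) ∂(ν.map (ψ j)) := by
          intro j
          rw [Measure.prod_apply ((hi j) hs), lintegral_map (measurable_measure_prodMk_left hs)
            (hψ j)]
          rfl
        simp_rw [this]
        rw [Measure.prod_apply hs, lintegral_finsetSum_measure]
    _ ≤ (c • ν.prod Q) s := by
        rw [Measure.prod_apply hs, Measure.smul_apply, Measure.prod_apply hs, smul_eq_mul]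
        exact (lintegral_mono' hsum le_rfl).trans (by rw [lintegral_smul_measure]; rfl)

/-- The bound for one index in terms of the total divergence. -/
lemma obsDiv_index_le {P m : Measure (N × E)} [IsFiniteMeasure P] [IsFiniteMeasure m] {x : E → α}
    {y : E → β} {ya : E → βa} {yb : E → βb} (hx : Measurable x) (hy : Measurable y)
    (hya : Measurable ya) (hyb : Measurable yb) {G : N → ζ} (hG : Measurable G) {V : N → ξ}
    (hV : Measurable V) :
    obsDiv P m (fun r => (G r.1, V r.1, y r.2, x r.2)) + obsDiv P m (fun r => (G r.1, y r.2))
      ≤ (obsDiv P m (fun r => (G r.1, ya r.2))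
          + obsDiv P m (fun r => (G r.1, V r.1, y r.2, ya r.2, yb r.2))) + klDiv P m := by
  have h1 : obsDiv P m (fun r => (G r.1, y r.2))
      ≤ obsDiv P m (fun r => (G r.1, V r.1, y r.2, ya r.2, yb r.2)) :=
    obsDiv_le_of_comp (fun r => (r.1, r.2.2.1)) (by fun_prop) (by fun_prop) (fun _ => rfl)
  have h2 : obsDiv P m (fun r => (G r.1, V r.1, y r.2, x r.2)) ≤ klDiv P m :=
    obsDiv_le_klDiv (by fun_prop)
  calc _ ≤ klDiv P m + obsDiv P m (fun r => (G r.1, V r.1, y r.2, ya r.2, yb r.2)) :=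
        add_le_add h2 h1
    _ ≤ _ := by rw [add_comm]; gcongr; exact le_add_self

/-! Observations along a block of length `n`. The coordinates in `J` carry the message. -/

variable {J : Type} [MeasurableSpace J] {n : ℕ}

/-- Sequence shown off the index `t`. -/
def hideAt (t : Fin n) (b : β) (s : Fin n → β) : Fin n → β := fun i => if i = t then b else s i

/-- Sequence shown before the index `l`. -/
def showBefore (l : ℕ) (b : β) (s : Fin n → β) : Fin n → β := fun i => if i.1 < l then s i else b

@[fun_prop]
lemma measurable_hideAt (t : Fin n) (b : β) : Measurable (hideAt t b : (Fin n → β) → _) := by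
  refine measurable_pi_lambda _ fun i => ?_
  unfold hideAt
  split_ifs <;> fun_prop

@[fun_prop]
lemma measurable_showBefore (l : ℕ) (b : β) :
    Measurable (showBefore l b : (Fin n → β) → _) := by
  refine measurable_pi_lambda _ fun i => ?_
  unfold showBefore
  split_ifs <;> fun_prop

/-- What both tests see of the block off the index `t`. -/
def blockG (y : E → β) (ya : E → βa) (y₀ : β) (ya₀ : βa) (t : Fin n) (q : (Fin n → E) × J) :
    J × (Fin n → βa) × (Fin n → β) :=
  (q.2, hideAt t ya₀ (fun i => ya (q.1 i)), showBefore t.1 y₀ (fun i => y (q.1 i)))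

/-- What the refined test sees in addition of the block off the index `t`. -/
def blockV (x : E → α) (y : E → β) (yb : E → βb) (x₀ : α) (y₀ : β) (yb₀ : βb) (t : Fin n)
    (q : (Fin n → E) × J) : (Fin n → βb) × (Fin n → β) × (Fin n → α) :=
  (hideAt t yb₀ (fun i => yb (q.1 i)), hideAt t y₀ (fun i => y (q.1 i)),
    showBefore t.1 x₀ (fun i => x (q.1 i)))

lemma measurable_blockG {y : E → β} {ya : E → βa} (hy : Measurable y) (hya : Measurable ya)
    (y₀ : β) (ya₀ : βa) (t : Fin n) :
    Measurable (blockG y ya y₀ ya₀ t : (Fin n → E) × J → _) := by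
  unfold blockG
  fun_prop

lemma measurable_blockV {x : E → α} {y : E → β} {yb : E → βb} (hx : Measurable x)
    (hy : Measurable y) (hyb : Measurable yb) (x₀ : α) (y₀ : β) (yb₀ : βb) (t : Fin n) :
    Measurable (blockV x y yb x₀ y₀ yb₀ t : (Fin n → E) × J → _) := by
  unfold blockV
  fun_prop

/-- The message is recomputed from the block with letter `a` at the index `t`. -/
def blockUpdate (x : E → α) (F : (Fin n → α) → J → J) (t : Fin n) (q : (Fin n → E) × J) (a : α) :
    (Fin n → E) × J :=
  (q.1, F (Function.update (fun i => x (q.1 i)) t a) q.2)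

lemma measurable_blockUpdate {x : E → α} (hx : Measurable x) {F : (Fin n → α) → J → J}
    (hF : Measurable (Function.uncurry F)) (t : Fin n) :
    Measurable (Function.uncurry (blockUpdate x F t)) := by
  unfold blockUpdate Function.uncurry
  have h1 : Measurable fun p : ((Fin n → E) × J) × α =>
      Function.update (fun i => x (p.1.1 i)) t p.2 :=
    (measurable_update_pair t).comp
      (show Measurable fun p : ((Fin n → E) × J) × α => ((fun i => x (p.1.1 i)), p.2) by fun_prop)
  exact measurable_fst.fst.prodMk (hF.comp (h1.prodMk measurable_fst.snd))

/-- The telescoping sum over a block. -/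
lemma sum_obsDiv_block_le [Nonempty J] {U : Measure J} [IsProbabilityMeasure U] {Q : Measure E}
    [IsProbabilityMeasure Q] {x : E → α} {y : E → β} {ya : E → βa} {yb : E → βb}
    (hx : Measurable x) (hy : Measurable y) (hya : Measurable ya) (hyb : Measurable yb)
    (x₀ : α) (y₀ : β) (ya₀ : βa) (yb₀ : βb)
    {F : (Fin n → α) → J → J} (hF : Measurable (Function.uncurry F))
    (c : ℝ≥0∞) (hc : c ≠ ∞) 
    (hle : ∀ t, klDiv (updateLaw ((Measure.pi fun _ : Fin n => Q).prod U) Q x (blockUpdate x F t))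
      ((((Measure.pi fun _ : Fin n => Q).prod U)).prod Q) ≤ c) {ν : Measure ((Fin n → E) × J)}
    (hν : ν = (Measure.pi fun _ : Fin n => Q).prod U) (hn : 0 < n) :
    ∑ t : Fin n, (obsDiv (updateLaw ν Q x (blockUpdate x F t)) (ν.prod Q)
          (fun r => (blockG y ya y₀ ya₀ t r.1, blockV x y yb x₀ y₀ yb₀ t r.1, y r.2, x r.2))
        + obsDiv (updateLaw ν Q x (blockUpdate x F t)) (ν.prod Q)
          (fun r => (blockG y ya y₀ ya₀ t r.1, y r.2)))
      ≤ ∑ t : Fin n, (obsDiv (updateLaw ν Q x (blockUpdate x F t)) (ν.prod Q)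
          (fun r => (blockG y ya y₀ ya₀ t r.1, ya r.2))
        + obsDiv (updateLaw ν Q x (blockUpdate x F t)) (ν.prod Q)
          (fun r => (blockG y ya y₀ ya₀ t r.1, blockV x y yb x₀ y₀ yb₀ t r.1, y r.2, ya r.2,
            yb r.2))) + c := by
  have hνp : IsProbabilityMeasure ν := by rw [hν]; infer_instance
  -- The law of a block with its own message. Through `htr`, tests at different indices become
  -- observations under the single pair `(P', ν)`, so their divergences can be compared.
  set P' : Measure ((Fin n → E) × J) := ν.map (fun q => (q.1, F (fun i => x (q.1 i)) q.2)) with hP'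
  have hG := fun t : Fin n => measurable_blockG (J := J) hy hya y₀ ya₀ t
  have hV := fun t : Fin n => measurable_blockV (J := J) hx hy hyb x₀ y₀ yb₀ t
  have hφ := fun t : Fin n => measurable_blockUpdate hx hF t
  have hpr : ∀ t, IsProbabilityMeasure (updateLaw ν Q x (blockUpdate x F t)) := fun t =>
    isProbabilityMeasure_updateLaw ν Q hx (hφ t)
  have hΦ : Measurable fun q : (Fin n → E) × J => (q.1, F (fun i => x (q.1 i)) q.2) := by
    have : Measurable fun q : (Fin n → E) × J => F (fun i => x (q.1 i)) q.2 :=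
      hF.comp (show Measurable fun q : (Fin n → E) × J => ((fun i => x (q.1 i)), q.2) by fun_prop)
    fun_prop
  have hP'p : IsProbabilityMeasure P' := Measure.isProbabilityMeasure_map hΦ.aemeasurable
  have hΨ : ∀ t : Fin n, Measurable fun r : ((Fin n → E) × J) × E =>
      (Function.update r.1.1 t r.2, r.1.2) := fun t =>
    ((measurable_update_pair t).comp (show Measurable fun r : ((Fin n → E) × J) × E =>
      (r.1.1, r.2) by fun_prop)).prodMk (by fun_prop)
  have hm' : ∀ t : Fin n, (ν.prod Q).map (fun r => (Function.update r.1.1 t r.2, r.1.2)) = ν := by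
    intro t
    have hu := map_update_pi Q t
    refine Measure.ext_of_lintegral _ fun f hf => ?_
    rw [lintegral_map hf (hΨ t), lintegral_prod (fun r : ((Fin n → E) × J) × E =>
        f (Function.update r.1.1 t r.2, r.1.2)) (hf.comp (hΨ t)).aemeasurable, hν,
      lintegral_prod_symm _ hf.aemeasurable, lintegral_prod_symm]
    · refine lintegral_congr fun j => ?_
      have h3 : ∫⁻ s, f (s, j) ∂(Measure.pi fun _ : Fin n => Q)
          = ∫⁻ s, ∫⁻ e, f (Function.update s t e, j) ∂Q ∂(Measure.pi fun _ : Fin n => Q) := by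
        conv_lhs => rw [← hu]
        rw [lintegral_map (by fun_prop) (measurable_update_pair t), lintegral_prod]
        exact (hf.comp (show Measurable fun q : (Fin n → E) × E =>
          (Function.update q.1 t q.2, j) from
          (measurable_update_pair t).prodMk measurable_const)).aemeasurable
      exact h3.symm
    · exact (Measurable.lintegral_prod_right' (f := fun r : ((Fin n → E) × J) × E => 
        f (Function.update r.1.1 t r.2, r.1.2)) (hf.comp (hΨ t))).aemeasurable
  -- The message was recomputed with the current letter inserted at `t`. Inserting that letter into
  -- the block itself makes block and message consistent, whatever `t` is.
  have hPt : ∀ t : Fin n, (updateLaw ν Q x (blockUpdate x F t)).map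
      (fun r => (Function.update r.1.1 t r.2, r.1.2)) = P' := by
    intro t
    have h1 : P' = (ν.prod Q).map ((fun q => (q.1, F (fun i => x (q.1 i)) q.2)) ∘
        fun r => (Function.update r.1.1 t r.2, r.1.2)) := by
      rw [hP', ← Measure.map_map hΦ (hΨ t), hm' t]
    have h2 : Measurable fun q : ((Fin n → E) × J) × E =>
        (blockUpdate x F t q.1 (x q.2), q.2) := ((hφ t).comp
      (show Measurable fun q : ((Fin n → E) × J) × E => (q.1, x q.2) by fun_prop)).prodMk
        measurable_snd
    unfold updateLaw
    rw [h1, Measure.map_map (hΨ t) h2]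
    congr 1
    funext r
    simp only [Function.comp, blockUpdate]
    congr 2
    funext i
    by_cases hi : i = t
    · subst hi; simp
    · simp [Function.update_of_ne hi]
  have htr : ∀ (t : Fin n) {χ : Type} [MeasurableSpace χ] {Z : (Fin n → E) × J → χ},
      Measurable Z → obsDiv P' ν Z = obsDiv (updateLaw ν Q x (blockUpdate x F t)) (ν.prod Q)
        (fun r => Z (Function.update r.1.1 t r.2, r.1.2)) := by
    intro t χ _ Z hZ
    rw [← obsDiv_map _ _ (hΨ t) hZ, hPt t, hm' t]
  -- `A l` shows `y` strictly before `l`, and `B l` shows `x` strictly before `l`. At index `t` the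
  -- current letter thus moves `l` from `t` to `t + 1`.
  set A : ℕ → (Fin n → E) × J → J × (Fin n → βa) × (Fin n → β) := fun l q =>
    (q.2, (fun i => ya (q.1 i)), showBefore l y₀ (fun i => y (q.1 i))) with hA
  set B : ℕ → (Fin n → E) × J → J × (Fin n → β × βa × βb) × (Fin n → α) := fun l q =>
    (q.2, (fun i => (y (q.1 i), ya (q.1 i), yb (q.1 i))), showBefore l x₀ (fun i => x (q.1 i)))
    with hB
  have hAm : ∀ l, Measurable (A l) := fun l => by fun_prop
  have hBm : ∀ l, Measurable (B l) := fun l => by fun_prop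
  have i1 : ∀ t : Fin n, obsDiv P' ν (A t) ≤ obsDiv (updateLaw ν Q x (blockUpdate x F t))
      (ν.prod Q) (fun r => (blockG y ya y₀ ya₀ t r.1, ya r.2)) := by
    intro t
    rw [htr t (hAm t)]
    refine obsDiv_le_of_comp (fun r => (r.1.1, Function.update r.1.2.1 t r.2, r.1.2.2)) ?_
      (by fun_prop) ?_
    · have := (measurable_update_pair (α := βa) t).comp
        (show Measurable fun r : (J × (Fin n → βa) × (Fin n → β)) × βa => (r.1.2.1, r.2) by fun_prop)
      exact measurable_fst.fst.prodMk (this.prodMk (by fun_prop))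
    · intro r
      refine Prod.ext rfl (Prod.ext ?_ ?_) <;> funext i
      · by_cases hi : i = t
        · subst hi; simp [hA]
        · simp [hA, blockG, hideAt, hi]
      · by_cases hi : i = t
        · subst hi; simp [hA, blockG, showBefore]
        · simp [hA, blockG, showBefore, Function.update_of_ne hi]
  -- Passing from `A (t + 1)` to the test forgets `ya` at `t`; hence an inequality, in the useful
  -- direction.
  have i2 : ∀ t : Fin n, obsDiv (updateLaw ν Q x (blockUpdate x F t))
      (ν.prod Q) (fun r => (blockG y ya y₀ ya₀ t r.1, y r.2)) ≤ obsDiv P' ν (A (t + 1)) := by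
    intro t
    rw [htr t (hAm _)]
    refine obsDiv_le_of_comp (fun r => ((r.1, hideAt t ya₀ r.2.1, showBefore t y₀ r.2.2), r.2.2 t))
      (by fun_prop) ((hAm _).comp (hΨ t)) ?_
    intro r
    refine Prod.ext (Prod.ext rfl (Prod.ext ?_ ?_)) ?_
    · funext i
      by_cases hi : i = t
      · subst hi; simp [blockG, hideAt]
      · simp [hA, blockG, hideAt, hi]
    · funext i
      by_cases hi : i = t
      · subst hi; simp [blockG, showBefore]
      · have : i.1 ≠ t.1 := fun h => hi (Fin.ext h)
        simp only [hA, blockG, showBefore, Function.update_of_ne hi]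
        split_ifs <;> first | rfl | omega
    · simp [hA, showBefore]
  have i3 : ∀ t : Fin n, obsDiv (updateLaw ν Q x (blockUpdate x F t)) (ν.prod Q)
      (fun r => (blockG y ya y₀ ya₀ t r.1, blockV x y yb x₀ y₀ yb₀ t r.1, y r.2, x r.2))
        ≤ obsDiv P' ν (B (t + 1)) := by
    intro t
    rw [htr t (hBm _)]
    refine obsDiv_le_of_comp (fun r => ((r.1, hideAt t ya₀ (fun i => (r.2.1 i).2.1),
      showBefore t y₀ (fun i => (r.2.1 i).1)), (hideAt t yb₀ (fun i => (r.2.1 i).2.2),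
      hideAt t y₀ (fun i => (r.2.1 i).1), showBefore t x₀ r.2.2), (r.2.1 t).1, r.2.2 t))
      (by fun_prop) ((hBm _).comp (hΨ t)) ?_
    intro r
    refine Prod.ext (Prod.ext rfl (Prod.ext ?_ ?_)) (Prod.ext (Prod.ext ?_ (Prod.ext ?_ ?_))
      (Prod.ext ?_ ?_))
    · funext i
      by_cases hi : i = t
      · subst hi; simp [blockG, hideAt]
      · simp [hB, blockG, hideAt, hi]
    · funext i
      by_cases hi : i = t
      · subst hi; simp [blockG, showBefore]
      · simp [hB, blockG, showBefore, Function.update_of_ne hi]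
    · funext i
      by_cases hi : i = t
      · subst hi; simp [blockV, hideAt]
      · simp [hB, blockV, hideAt, hi]
    · funext i
      by_cases hi : i = t
      · subst hi; simp [blockV, hideAt]
      · simp [hB, blockV, hideAt, hi]
    · funext i
      by_cases hi : i = t
      · subst hi; simp [blockV, showBefore]
      · have : i.1 ≠ t.1 := fun h => hi (Fin.ext h)
        simp only [hB, blockV, showBefore, Function.update_of_ne hi]
        split_ifs <;> first | rfl | omega
    · simp [hB]
    · simp [hB, showBefore]
  have i4 : ∀ t : Fin n, obsDiv P' ν (B t) ≤ obsDiv (updateLaw ν Q x (blockUpdate x F t))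
      (ν.prod Q) (fun r => (blockG y ya y₀ ya₀ t r.1, blockV x y yb x₀ y₀ yb₀ t r.1, y r.2,
        ya r.2, yb r.2)) := by
    intro t
    rw [htr t (hBm _)]
    refine obsDiv_le_of_comp (fun r => (r.1.1,
      Function.update (fun i => (r.2.1.2.1 i, r.1.2.1 i, r.2.1.1 i)) t r.2.2, r.2.1.2.2)) ?_
      (by fun_prop) ?_
    · have := (measurable_update_pair (α := β × βa × βb) t).comp
        (show Measurable fun r : (J × (Fin n → βa) × (Fin n → β)) ×
            ((Fin n → βb) × (Fin n → β) × (Fin n → α)) × β × βa × βb =>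
          ((fun i => (r.2.1.2.1 i, r.1.2.1 i, r.2.1.1 i)), r.2.2) by fun_prop)
      exact measurable_fst.fst.prodMk (this.prodMk (by fun_prop))
    · intro r
      refine Prod.ext rfl (Prod.ext ?_ ?_) <;> funext i
      · by_cases hi : i = t
        · subst hi; simp [hB]
        · simp [hB, blockG, blockV, hideAt, hi]
      · by_cases hi : i = t
        · subst hi; simp [hB, blockV, showBefore]
        · simp [hB, blockV, showBefore, Function.update_of_ne hi]
  have hlast : obsDiv P' ν (B n) ≤ c := by
    have t : Fin n := ⟨0, hn⟩
    rw [htr t (hBm _)]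
    exact (obsDiv_le_klDiv ((hBm _).comp (hΨ t))).trans (hν ▸ hle t)
  -- The two telescoping sums are joined here: `A n` contains the whole of `y` but no `yb`, while `B
  -- 0` contains all three side informations and no `x`.
  have hAB : obsDiv P' ν (A n) ≤ obsDiv P' ν (B 0) := by
    refine obsDiv_le_of_comp (fun r => (r.1, (fun i => (r.2.1 i).2.1),
      showBefore n y₀ (fun i => (r.2.1 i).1))) (by fun_prop) (hBm 0) (fun r => rfl)
  have hB0 : obsDiv P' ν (B 0) ≠ ∞ := by
    have : obsDiv P' ν (B 0) ≤ c := by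
      have t : Fin n := ⟨0, hn⟩
      rw [htr t (hBm _)]
      exact (obsDiv_le_klDiv ((hBm _).comp (hΨ t))).trans (hν ▸ hle t)
    exact ne_top_of_le_ne_top hc this
  set a : ℕ → ℝ≥0∞ := fun l => obsDiv P' ν (B l) + obsDiv P' ν (A l) with ha
  have htel : ∑ t : Fin n, a (t + 1) + a 0 = ∑ t : Fin n, a t + a n := by
    rw [Fin.sum_univ_eq_sum_range (fun l => a (l + 1)), Fin.sum_univ_eq_sum_range a,
      ← Finset.sum_range_succ', Finset.sum_range_succ]
  have hkey : ∑ t : Fin n, a (t + 1) ≤ ∑ t : Fin n, a t + c := by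
    refine (ENNReal.add_le_add_iff_right hB0).1 ?_
    calc _ ≤ ∑ t : Fin n, a (t + 1) + a 0 := by gcongr; exact le_self_add
      _ = _ := htel
      _ ≤ ∑ t : Fin n, a t + (c + obsDiv P' ν (B 0)) := by gcongr; exact add_le_add hlast hAB
      _ = _ := by ring
  calc _ ≤ ∑ t : Fin n, a (t + 1) := Finset.sum_le_sum fun t _ => add_le_add (i3 t) (i2 t)
    _ ≤ _ := hkey
    _ ≤ _ := by
      gcongr with t
      exact (add_comm _ _).le.trans (add_le_add (i1 t) (i4 t))

end Telescoping

/-! ### Positive semidefinite matrices -/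

section Loewner

variable {k : ℕ} {A B C : Matrix (Fin k) (Fin k) ℝ}

lemma posSemidef_of_quad (hA : Aᵀ = A) (h : ∀ v : Vec k, 0 ≤ v ⬝ᵥ (A *ᵥ v)) : A.PosSemidef :=
  Matrix.PosSemidef.of_dotProduct_mulVec_nonneg
    (by rw [Matrix.IsHermitian, Matrix.conjTranspose_eq_transpose_of_trivial, hA])
    (fun v => by simpa using h v)

lemma quad_nonneg (h : A.PosSemidef) (v : Vec k) : 0 ≤ v ⬝ᵥ (A *ᵥ v) := by
  simpa using h.dotProduct_mulVec_nonneg v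

lemma transpose_eq_of_posSemidef (h : A.PosSemidef) : Aᵀ = A := by
  have := h.isHermitian
  rwa [Matrix.IsHermitian, Matrix.conjTranspose_eq_transpose_of_trivial] at this

lemma posSemidef_sub_trans (h₁ : (B - A).PosSemidef) (h₂ : (C - B).PosSemidef) :
    (C - A).PosSemidef := by
  have := h₂.add h₁
  rwa [sub_add_sub_cancel] at this

lemma posDef_of_sub_posSemidef (hA : A.PosDef) (h : (B - A).PosSemidef) : B.PosDef := by
  have := hA.add_posSemidef h
  rwa [add_sub_cancel] at this

lemma posDef_of_isUnit (h : A.PosSemidef) (hu : IsUnit A) : A.PosDef := by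
  refine Matrix.PosDef.of_dotProduct_mulVec_pos h.isHermitian fun v hv => ?_
  refine lt_of_le_of_ne (h.dotProduct_mulVec_nonneg v) fun h0 => hv ?_
  have h1 := (h.dotProduct_mulVec_zero_iff v).1 h0.symm
  have : A⁻¹ *ᵥ (A *ᵥ v) = v := by
    rw [Matrix.mulVec_mulVec, Matrix.nonsing_inv_mul _ ((Matrix.isUnit_iff_isUnit_det _).1 hu),
      Matrix.one_mulVec]
  rw [← this, h1, Matrix.mulVec_zero]

/-- Inversion is antitone on positive definite matrices. -/
lemma inv_sub_inv_posSemidef (hA : A.PosDef) (h : (B - A).PosSemidef) :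
    (A⁻¹ - B⁻¹).PosSemidef := by
  have hB := posDef_of_sub_posSemidef hA h
  have hAi : A⁻¹.PosDef := hA.inv
  -- Both orders are Schur complement conditions for the block matrix with rows (B, 1) and (1, A⁻¹),
  -- taken with respect to one diagonal block or the other.
  let _ : Invertible B := hB.isUnit.invertible
  let _ : Invertible A⁻¹ := hAi.isUnit.invertible
  have h1 := Matrix.PosDef.fromBlocks₁₁ (1 : Matrix (Fin k) (Fin k) ℝ) A⁻¹ hB
  have h2 := Matrix.PosDef.fromBlocks₂₂ B (1 : Matrix (Fin k) (Fin k) ℝ) hAi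
  have hdet : IsUnit A.det := (Matrix.isUnit_iff_isUnit_det _).1 hA.isUnit
  rw [Matrix.conjTranspose_one, Matrix.nonsing_inv_nonsing_inv _ hdet] at h2
  rw [Matrix.conjTranspose_one] at h1
  simp only [one_mul, mul_one] at h1 h2
  exact h1.1 (h2.2 h)

end Loewner

/-! ### Second moments and conditional covariances -/

section SecondMoment

variable {Ω β : Type} [m₀ : MeasurableSpace Ω] [MeasurableSpace β] {k k₀ : ℕ}

/-- The second moment matrix `E[e eᵀ]`. -/
def secondMoment (μ : Measure Ω) (e : Ω → Vec k) : Matrix (Fin k) (Fin k) ℝ :=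
  Matrix.of fun i j => ∫ ω, e ω i * e ω j ∂μ

lemma secondMoment_transpose (μ : Measure Ω) (e : Ω → Vec k) :
    (secondMoment μ e)ᵀ = secondMoment μ e := by
  ext i j
  simp [secondMoment, mul_comm]

lemma memLp_dotProduct {μ : Measure Ω} {e : Ω → Vec k} (he : ∀ i, MemLp (fun ω => e ω i) 2 μ)
    (v : Vec k) : MemLp (fun ω => v ⬝ᵥ e ω) 2 μ := by
  unfold dotProduct
  exact memLp_finsetSum _ fun i _ => (he i).const_mul (v i)

lemma quad_secondMoment {μ : Measure Ω} {e : Ω → Vec k} (he : ∀ i, MemLp (fun ω => e ω i) 2 μ)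
    (v : Vec k) : v ⬝ᵥ (secondMoment μ e *ᵥ v) = ∫ ω, (v ⬝ᵥ e ω) ^ 2 ∂μ := by
  have h : ∀ i j, Integrable (fun ω => v i * (v j * (e ω i * e ω j))) μ := fun i j =>
    (((he i).integrable_mul (he j)).const_mul _).const_mul _
  have e1 : ∀ ω, (v ⬝ᵥ e ω) ^ 2 = ∑ i, ∑ j, v i * (v j * (e ω i * e ω j)) := by
    intro ω
    rw [sq, dotProduct, Finset.sum_mul_sum]
    exact Finset.sum_congr rfl fun i _ => Finset.sum_congr rfl fun j _ => by ring
  simp_rw [e1]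
  rw [integral_finsetSum _ fun i _ => integrable_finsetSum _ fun j _ => h i j]
  simp_rw [dotProduct, Matrix.mulVec, dotProduct, Finset.mul_sum]
  refine Finset.sum_congr rfl fun i _ => ?_
  rw [integral_finsetSum _ fun j _ => h i j]
  refine Finset.sum_congr rfl fun j _ => ?_
  rw [integral_const_mul, integral_const_mul]
  simp only [secondMoment, Matrix.of_apply]; ring

lemma secondMoment_posSemidef {μ : Measure Ω} {e : Ω → Vec k}
    (he : ∀ i, MemLp (fun ω => e ω i) 2 μ) : (secondMoment μ e).PosSemidef :=
  posSemidef_of_quad (secondMoment_transpose μ e) fun v => by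
    rw [quad_secondMoment he]; exact integral_nonneg fun ω => sq_nonneg _

/-- The error of the conditional expectation of `X` given `Z`. -/
def condErr (μ : Measure Ω) (X : Ω → Vec k) (Z : Ω → β) (ω : Ω) : Vec k := fun i =>
  X ω i - (μ[(fun ω' => X ω' i) | MeasurableSpace.comap Z inferInstance]) ω

lemma condCov_eq (μ : Measure Ω) (X : Ω → Vec k) (Z : Ω → β) :
    condCov μ X Z = secondMoment μ (condErr μ X Z) := rfl

variable {μ : Measure Ω} [IsProbabilityMeasure μ]

/-- Orthogonality of the prediction error to square-integrable functions of the observation. -/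
lemma integral_sub_condExp_mul {m : MeasurableSpace Ω} (hm : m ≤ m₀) {f h : Ω → ℝ}
    (hf : MemLp f 2 μ) (hh : MemLp h 2 μ) (hhm : StronglyMeasurable[m] h) :
    ∫ ω, (f ω - (μ[f | m]) ω) * h ω ∂μ = 0 := by
  have hfc : MemLp (μ[f | m]) 2 μ := hf.condExp (by norm_num)
  have h1 : Integrable (f * h) μ := hf.integrable_mul hh
  have h2 : Integrable (μ[f | m] * h) μ := hfc.integrable_mul hh
  have e1 : ∫ ω, (μ[f * h | m]) ω ∂μ = ∫ ω, (f * h) ω ∂μ := integral_condExp hm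
  have e2 := condExp_mul_of_stronglyMeasurable_right hhm h1 (hf.integrable (by norm_num))
  rw [integral_congr_ae e2] at e1
  have h3 : ∫ ω, ((f * h) ω - (μ[f | m] * h) ω) ∂μ = 0 := by
    rw [integral_sub h1 h2, e1, sub_self]
  simpa [sub_mul] using h3

variable {X : Ω → Vec k} {Z : Ω → β}

lemma memLp_condErr (hX : ∀ i, MemLp (fun ω => X ω i) 2 μ) (Z : Ω → β) (i : Fin k) :
    MemLp (fun ω => condErr μ X Z ω i) 2 μ :=
  (hX i).sub ((hX i).condExp (by norm_num))

lemma condCov_posSemidef (hX : ∀ i, MemLp (fun ω => X ω i) 2 μ) (Z : Ω → β) :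
    (condCov μ X Z).PosSemidef :=
  secondMoment_posSemidef (memLp_condErr hX Z)

lemma integral_condErr_mul (hX : ∀ i, MemLp (fun ω => X ω i) 2 μ) (hZ : Measurable Z) (i : Fin k)
    {h : Ω → ℝ} (hh : MemLp h 2 μ)
    (hhm : StronglyMeasurable[MeasurableSpace.comap Z inferInstance] h) :
    ∫ ω, condErr μ X Z ω i * h ω ∂μ = 0 :=
  integral_sub_condExp_mul hZ.comap_le (hX i) hh hhm

/-- The conditional expectation minimizes the error covariance in the Loewner order. -/
lemma secondMoment_sub_condCov_posSemidef (hX : ∀ i, MemLp (fun ω => X ω i) 2 μ)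
    (hZ : Measurable Z) {g : Ω → Vec k} (hg : ∀ i, MemLp (fun ω => g ω i) 2 μ)
    (hgm : ∀ i, StronglyMeasurable[MeasurableSpace.comap Z inferInstance] fun ω => g ω i) :
    (secondMoment μ (fun ω => X ω - g ω) - condCov μ X Z).PosSemidef := by
  rw [condCov_eq]
  have hXg : ∀ i, MemLp (fun ω => (X ω - g ω) i) 2 μ := fun i => (hX i).sub (hg i)
  refine posSemidef_of_quad (by rw [Matrix.transpose_sub, secondMoment_transpose,
    secondMoment_transpose]) fun v => ?_
  rw [Matrix.sub_mulVec, dotProduct_sub, quad_secondMoment hXg,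
    quad_secondMoment (memLp_condErr hX Z), sub_nonneg]
  -- The difference of the two estimators is a function of the observation, hence orthogonal to the
  -- error. The excess in the quadratic form is the second moment of `v ⬝ᵥ d`.
  set d : Ω → Vec k := fun ω i =>
    (μ[(fun ω' => X ω' i) | MeasurableSpace.comap Z inferInstance]) ω - g ω i with hd
  have hdL : ∀ i, MemLp (fun ω => d ω i) 2 μ := fun i =>
    ((hX i).condExp (by norm_num)).sub (hg i)
  have hdm : ∀ i, StronglyMeasurable[MeasurableSpace.comap Z inferInstance] fun ω => d ω i :=
    fun i => stronglyMeasurable_condExp.sub (hgm i)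
  have hc := memLp_dotProduct (memLp_condErr hX Z) v
  have hdv := memLp_dotProduct hdL v
  have e : ∀ ω, (v ⬝ᵥ (X ω - g ω)) ^ 2 = (v ⬝ᵥ condErr μ X Z ω) ^ 2
      + 2 * ((v ⬝ᵥ condErr μ X Z ω) * (v ⬝ᵥ d ω)) + (v ⬝ᵥ d ω) ^ 2 := by
    intro ω
    have : X ω - g ω = condErr μ X Z ω + d ω := by
      ext i; simp [condErr, hd]
    rw [this, dotProduct_add]; ring
  have cross : ∫ ω, (v ⬝ᵥ condErr μ X Z ω) * (v ⬝ᵥ d ω) ∂μ = 0 := by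
    have hs : ∀ ω, (v ⬝ᵥ condErr μ X Z ω) * (v ⬝ᵥ d ω)
        = ∑ i, v i * (condErr μ X Z ω i * (v ⬝ᵥ d ω)) := by
      intro ω
      rw [dotProduct, Finset.sum_mul]
      exact Finset.sum_congr rfl fun i _ => by ring
    simp_rw [hs]
    have hi : ∀ i, Integrable (fun ω => v i * (condErr μ X Z ω i * (v ⬝ᵥ d ω))) μ := fun i =>
      ((memLp_condErr hX Z i).integrable_mul hdv).const_mul _
    rw [integral_finsetSum _ fun i _ => hi i]
    refine Finset.sum_eq_zero fun i _ => ?_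
    rw [integral_const_mul, integral_condErr_mul hX hZ i hdv, mul_zero]
    unfold dotProduct
    exact Finset.stronglyMeasurable_fun_sum _ fun i _ => (hdm i).const_mul _
  have j1 : Integrable (fun ω => 2 * ((v ⬝ᵥ condErr μ X Z ω) * (v ⬝ᵥ d ω))) μ :=
    (hc.integrable_mul hdv).const_mul 2
  have j2 : Integrable (fun ω => (v ⬝ᵥ condErr μ X Z ω) ^ 2
      + 2 * ((v ⬝ᵥ condErr μ X Z ω) * (v ⬝ᵥ d ω))) μ := hc.integrable_sq.add j1
  simp_rw [e]
  rw [integral_add j2 hdv.integrable_sq, integral_add hc.integrable_sq j1, integral_const_mul,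
    cross]
  have : 0 ≤ ∫ ω, (v ⬝ᵥ d ω) ^ 2 ∂μ := integral_nonneg fun ω => sq_nonneg _
  linarith

/-- Conditional expectations of a pulled-back function. -/
lemma condExp_map_comp {Ω' : Type} [MeasurableSpace Ω'] {f : Ω → Ω'} (hf : Measurable f)
    {h : Ω' → ℝ} (hh : Integrable h (μ.map f)) {Z : Ω' → β} (hZ : Measurable Z) :
    (fun ω => ((μ.map f)[h | MeasurableSpace.comap Z inferInstance]) (f ω))
      =ᵐ[μ] μ[(fun ω => h (f ω)) | MeasurableSpace.comap (fun ω => Z (f ω)) inferInstance] := by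
  have : IsProbabilityMeasure (μ.map f) := Measure.isProbabilityMeasure_map hf.aemeasurable
  have hm : MeasurableSpace.comap (fun ω => Z (f ω)) inferInstance ≤ m₀ := (hZ.comp hf).comap_le
  have hint : Integrable ((μ.map f)[h | MeasurableSpace.comap Z inferInstance]) (μ.map f) :=
    integrable_condExp
  have hsm : StronglyMeasurable[MeasurableSpace.comap Z inferInstance]
    ((μ.map f)[h | MeasurableSpace.comap Z inferInstance]) := stronglyMeasurable_condExp
  refine ae_eq_condExp_of_forall_setIntegral_eq hm (hh.comp_measurable hf)
    (fun s _ _ => (hint.comp_measurable hf).integrableOn) ?_ ?_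
  · rintro s ⟨t, ht, rfl⟩ -
    have h1 := setIntegral_condExp (μ := μ.map f) hZ.comap_le hh (s := Z ⁻¹' t) ⟨t, ht, rfl⟩
    rw [setIntegral_map (hZ ht) hint.aestronglyMeasurable hf.aemeasurable,
      setIntegral_map (hZ ht) hh.aestronglyMeasurable hf.aemeasurable] at h1
    exact h1
  · refine StronglyMeasurable.aestronglyMeasurable ?_
    have : MeasurableSpace.comap (fun ω => Z (f ω)) inferInstance
        = MeasurableSpace.comap f (MeasurableSpace.comap Z inferInstance) := by
      rw [MeasurableSpace.comap_comp]; rfl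
    rw [this]
    exact hsm.comp_measurable (comap_measurable f)

lemma condCov_map {Ω' : Type} [MeasurableSpace Ω'] {f : Ω → Ω'} (hf : Measurable f)
    {X : Ω' → Vec k} (hX : ∀ i, MemLp (fun ω => X ω i) 2 (μ.map f)) {Z : Ω' → β}
    (hZ : Measurable Z) :
    condCov (μ.map f) X Z = condCov μ (fun ω => X (f ω)) (fun ω => Z (f ω)) := by
  have : IsProbabilityMeasure (μ.map f) := Measure.isProbabilityMeasure_map hf.aemeasurable
  ext i j
  have hL := fun i => memLp_condErr hX Z i
  change ∫ ω, condErr (μ.map f) X Z ω i * condErr (μ.map f) X Z ω j ∂(μ.map f) = _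
  have hs : AEStronglyMeasurable
      (fun ω => condErr (μ.map f) X Z ω i * condErr (μ.map f) X Z ω j) (μ.map f) :=
    (hL i).1.mul (hL j).1
  rw [integral_map hf.aemeasurable hs]
  refine integral_congr_ae ?_
  filter_upwards [condExp_map_comp hf ((hX i).integrable (by norm_num)) hZ,
    condExp_map_comp hf ((hX j).integrable (by norm_num)) hZ] with ω h1 h2
  simp only [condErr, h1, h2]

/-! ### Distortion of an estimator -/

lemma toLin_posSemidef (Γ : DistortionMap k k₀) {A : Matrix (Fin k) (Fin k) ℝ}
    (hA : A.PosSemidef) : (Γ.toLin A).PosSemidef := by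
  have := Γ.mono 0 A Matrix.PosSemidef.zero hA (by simpa using hA)
  simpa using this

lemma errorDistortion_posSemidef (Γ : DistortionMap k k₀) (e : Vec k) :
    (errorDistortion Γ e).PosSemidef :=
  toLin_posSemidef Γ (by simpa using Matrix.posSemidef_vecMulVec_self_star e)

lemma toLin_apply (Γ : DistortionMap k k₀) (A : Matrix (Fin k) (Fin k) ℝ) (a b : Fin k₀) :
    Γ.toLin A a b = ∑ i, ∑ j, A i j * Γ.toLin (Matrix.single i j 1) a b := by
  conv_lhs => rw [Matrix.matrix_eq_sum_single A]
  simp only [map_sum, Matrix.sum_apply]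
  refine Finset.sum_congr rfl fun i _ => Finset.sum_congr rfl fun j _ => ?_
  have : Matrix.single i j (A i j) = A i j • Matrix.single i j (1 : ℝ) := by
    rw [Matrix.smul_single, smul_eq_mul, mul_one]
  rw [this, map_smul, Matrix.smul_apply, smul_eq_mul]

lemma errorDistortion_apply (Γ : DistortionMap k k₀) (e : Vec k) (a b : Fin k₀) :
    errorDistortion Γ e a b
      = ∑ i, ∑ j, e i * e j * Γ.toLin (Matrix.single i j 1) a b := by
  rw [errorDistortion, toLin_apply]
  rfl

/-- The mean distortion matrix `E[Γ(e eᵀ)]`. -/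
def meanDistortion (μ : Measure Ω) (Γ : DistortionMap k k₀) (e : Ω → Vec k) :
    Matrix (Fin k₀) (Fin k₀) ℝ :=
  Matrix.of fun a b => ∫ ω, errorDistortion Γ (e ω) a b ∂μ

lemma integrable_errorDistortion (Γ : DistortionMap k k₀) {μ : Measure Ω} {e : Ω → Vec k}
    (he : ∀ i, MemLp (fun ω => e ω i) 2 μ) (a b : Fin k₀) :
    Integrable (fun ω => errorDistortion Γ (e ω) a b) μ := by
  simp_rw [errorDistortion_apply]
  exact integrable_finsetSum _ fun i _ => integrable_finsetSum _ fun j _ =>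
    ((he i).integrable_mul (he j)).mul_const _

lemma meanDistortion_eq (Γ : DistortionMap k k₀) {μ : Measure Ω} {e : Ω → Vec k}
    (he : ∀ i, MemLp (fun ω => e ω i) 2 μ) :
    meanDistortion μ Γ e = Γ.toLin (secondMoment μ e) := by
  ext a b
  rw [toLin_apply]
  have hi : ∀ i j, Integrable
      (fun ω => e ω i * e ω j * Γ.toLin (Matrix.single i j 1) a b) μ := fun i j =>
    ((he i).integrable_mul (he j)).mul_const _
  unfold meanDistortion
  simp_rw [Matrix.of_apply, errorDistortion_apply]
  rw [integral_finsetSum _ fun i _ => integrable_finsetSum _ fun j _ => hi i j]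
  refine Finset.sum_congr rfl fun i _ => ?_
  rw [integral_finsetSum _ fun j _ => hi i j]
  exact Finset.sum_congr rfl fun j _ => integral_mul_const _ _

lemma quad_meanDistortion (Γ : DistortionMap k k₀) {μ : Measure Ω} {e : Ω → Vec k}
    (he : ∀ a b, Integrable (fun ω => errorDistortion Γ (e ω) a b) μ) (v : Vec k₀) :
    v ⬝ᵥ (meanDistortion μ Γ e *ᵥ v) = ∫ ω, v ⬝ᵥ (errorDistortion Γ (e ω) *ᵥ v) ∂μ := by
  simp_rw [dotProduct, Matrix.mulVec, dotProduct]
  rw [integral_finsetSum _ fun a _ => (integrable_finsetSum _ fun b _ =>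
    (he a b).mul_const _).const_mul _]
  refine Finset.sum_congr rfl fun a _ => ?_
  rw [integral_const_mul, integral_finsetSum _ fun b _ => (he a b).mul_const _]
  congr 1
  exact Finset.sum_congr rfl fun b _ => by rw [integral_mul_const]; rfl

lemma integrable_quad_errorDistortion (Γ : DistortionMap k k₀) {μ : Measure Ω} {e : Ω → Vec k}
    (he : ∀ a b, Integrable (fun ω => errorDistortion Γ (e ω) a b) μ) (v : Vec k₀) :
    Integrable (fun ω => v ⬝ᵥ (errorDistortion Γ (e ω) *ᵥ v)) μ := by
  simp_rw [dotProduct, Matrix.mulVec, dotProduct]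
  exact integrable_finsetSum _ fun a _ => (integrable_finsetSum _ fun b _ =>
    (he a b).mul_const _).const_mul _

lemma meanDistortion_transpose (μ : Measure Ω) (Γ : DistortionMap k k₀) (e : Ω → Vec k) :
    (meanDistortion μ Γ e)ᵀ = meanDistortion μ Γ e := by
  ext a b
  have : ∀ ω, errorDistortion Γ (e ω) b a = errorDistortion Γ (e ω) a b := fun ω => by
    have := congrFun (congrFun (transpose_eq_of_posSemidef (errorDistortion_posSemidef Γ (e ω))) a) b
    simpa using this
  simp [meanDistortion, this]

/-- Any estimator with finite mean distortion does at best as well as the conditional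
expectation. -/
theorem meanDistortion_sub_condCov_posSemidef (Γ : DistortionMap k k₀)
    (hX : ∀ i, MemLp (fun ω => X ω i) 2 μ) (hZ : Measurable Z) {g : β → Vec k}
    (hg : Measurable g)
    (hint : ∀ a b, Integrable (fun ω => errorDistortion Γ (X ω - g (Z ω)) a b) μ) :
    (meanDistortion μ Γ (fun ω => X ω - g (Z ω)) - Γ.toLin (condCov μ X Z)).PosSemidef := by
  classical
  have hcp := condCov_posSemidef hX Z
  refine posSemidef_of_quad (by rw [Matrix.transpose_sub, meanDistortion_transpose,
    transpose_eq_of_posSemidef (toLin_posSemidef Γ hcp)]) fun v => ?_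
  rw [Matrix.sub_mulVec, dotProduct_sub, sub_nonneg, quad_meanDistortion Γ hint]
  set q : Vec k → ℝ := fun e => v ⬝ᵥ (errorDistortion Γ e *ᵥ v) with hq
  -- Finite distortion does not make `g (Z ·)` square integrable, since Γ may be degenerate. The
  -- estimator is kept where its norm is at most `l` and replaced by the conditional expectation
  -- elsewhere; dominated convergence then removes the truncation.
  set B : ℕ → Set Ω := fun l => {ω | ‖g (Z ω)‖ ≤ l} with hB
  have hBm : ∀ l, MeasurableSet[MeasurableSpace.comap Z inferInstance] (B l) := fun l =>
    ⟨{z | ‖g z‖ ≤ l}, measurableSet_le hg.norm measurable_const, rfl⟩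
  set G : ℕ → Ω → Vec k := fun l ω => if ω ∈ B l then g (Z ω) else fun i =>
    (μ[(fun ω' => X ω' i) | MeasurableSpace.comap Z inferInstance]) ω with hG
  have hGe : ∀ l i, (fun ω => G l ω i) = (B l).piecewise (fun ω => g (Z ω) i)
      (μ[(fun ω' => X ω' i) | MeasurableSpace.comap Z inferInstance]) := by
    intro l i; funext ω
    by_cases h : ω ∈ B l <;> simp [hG, h]
  have hgZ : ∀ i, StronglyMeasurable[MeasurableSpace.comap Z inferInstance]
      fun ω => g (Z ω) i := fun i =>
    Measurable.stronglyMeasurable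
      (((measurable_pi_apply i).comp hg).comp (comap_measurable Z))
  have hGm : ∀ l i, StronglyMeasurable[MeasurableSpace.comap Z inferInstance]
      fun ω => G l ω i := by
    intro l i
    rw [hGe]
    exact StronglyMeasurable.piecewise (hBm l) (hgZ i) stronglyMeasurable_condExp
  have hGL : ∀ l i, MemLp (fun ω => G l ω i) 2 μ := by
    intro l i
    rw [hGe]
    refine MemLp.piecewise (hZ.comap_le _ (hBm l)) ?_ (((hX i).condExp (by norm_num)).restrict _)
    refine MemLp.of_bound ((hgZ i).mono hZ.comap_le).aestronglyMeasurable l ?_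
    refine (ae_restrict_iff' (hZ.comap_le _ (hBm l))).2 (ae_of_all _ fun ω hω => ?_)
    exact (norm_le_pi_norm (g (Z ω)) i).trans hω
  have hle : ∀ l, v ⬝ᵥ (Γ.toLin (condCov μ X Z) *ᵥ v) ≤ ∫ ω, q (X ω - G l ω) ∂μ := by
    intro l
    have hXG : ∀ i, MemLp (fun ω => (X ω - G l ω) i) 2 μ := fun i => (hX i).sub (hGL l i)
    have h1 := secondMoment_sub_condCov_posSemidef hX hZ (hGL l) (hGm l)
    have h2 := quad_nonneg (Γ.mono _ _ hcp (secondMoment_posSemidef hXG) h1) v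
    rw [Matrix.sub_mulVec, dotProduct_sub, sub_nonneg, ← meanDistortion_eq Γ hXG,
      quad_meanDistortion Γ (integrable_errorDistortion Γ hXG)] at h2
    exact h2
  have i1 := integrable_quad_errorDistortion Γ hint v
  have i2 := integrable_quad_errorDistortion Γ
    (integrable_errorDistortion Γ (memLp_condErr hX Z)) v
  have hqX : ∀ l ω, q (X ω - G l ω) = if ω ∈ B l then q (X ω - g (Z ω))
      else q (condErr μ X Z ω) := by
    intro l ω
    by_cases h : ω ∈ B l
    · simp [hG, h]
    · simp only [hG, h, if_false]; rfl
  have hlim : Filter.Tendsto (fun l => ∫ ω, q (X ω - G l ω) ∂μ) Filter.atTop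
      (nhds (∫ ω, q (X ω - g (Z ω)) ∂μ)) := by
    refine tendsto_integral_of_dominated_convergence
      (fun ω => ‖q (X ω - g (Z ω))‖ + ‖q (condErr μ X Z ω)‖) (fun l => ?_)
      (i1.norm.add i2.norm) (fun l => ?_) ?_
    · have hXG : ∀ i, MemLp (fun ω => (X ω - G l ω) i) 2 μ := fun i => (hX i).sub (hGL l i)
      exact (integrable_quad_errorDistortion Γ (integrable_errorDistortion Γ hXG) v).1
    · refine ae_of_all _ fun ω => ?_
      rw [hqX]
      split_ifs
      · exact le_add_of_nonneg_right (norm_nonneg _)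
      · exact le_add_of_nonneg_left (norm_nonneg _)
    · refine ae_of_all _ fun ω => ?_
      obtain ⟨L, hL⟩ := exists_nat_ge ‖g (Z ω)‖
      refine tendsto_const_nhds.congr' ?_
      filter_upwards [Filter.eventually_ge_atTop L] with l hl
      have : ω ∈ B l := hL.trans (by exact_mod_cast hl)
      rw [hqX, if_pos this]
  exact ge_of_tendsto' hlim hle

end SecondMoment

/-! ### Conditional independence and factorizations -/

section CondIndep

variable {Ω α β γ δ : Type} [m₀ : MeasurableSpace Ω] [MeasurableSpace α] [MeasurableSpace β]
  [MeasurableSpace γ] [MeasurableSpace δ]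
  {μ : Measure Ω} [IsFiniteMeasure μ] {A : Ω → α} {B : Ω → β} {C : Ω → γ}

/-- Together with `factorsVia_of_condIndepFun`, translates between the kernel form used for
divergences and the conditional independence used in the definitions of the constraint sets. -/
lemma FactorsVia.condIndepFun [StandardBorelSpace Ω] [StandardBorelSpace α] [Nonempty α]
    [StandardBorelSpace β] [Nonempty β] {κ : Kernel γ β} [IsMarkovKernel κ]
    (h : FactorsVia μ A B C κ) (hA : Measurable A) (hB : Measurable B) (hC : Measurable C) :
    CondIndepFun (MeasurableSpace.comap C inferInstance) hC.comap_le A B μ := by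
  rw [condIndepFun_iff_condDistrib_prod_ae_eq_prodMkRight hB hA hC]
  have h1 : condDistrib B (fun ω => (C ω, A ω)) μ =ᵐ[μ.map fun ω => (C ω, A ω)]
      κ.prodMkRight α := by
    rw [condDistrib_ae_eq_iff_measure_eq_compProd _ hB.aemeasurable]
    exact h
  have h2 : condDistrib B C μ =ᵐ[μ.map C] κ := by
    rw [condDistrib_ae_eq_iff_measure_eq_compProd _ hB.aemeasurable]
    exact h.map_prod hA hB hC
  have e : μ.map C = (μ.map fun ω => (C ω, A ω)).map Prod.fst := by
    rw [Measure.map_map (by fun_prop) (by fun_prop)]; rfl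
  rw [e] at h2
  filter_upwards [h1, ae_of_ae_map (by fun_prop) h2] with q h3 h4
  rw [h3, Kernel.prodMkRight_apply, Kernel.prodMkRight_apply, h4]

lemma factorsVia_of_condIndepFun [StandardBorelSpace Ω] [StandardBorelSpace α] [Nonempty α]
    [StandardBorelSpace β] [Nonempty β] (hA : Measurable A) (hB : Measurable B)
    (hC : Measurable C)
    (h : CondIndepFun (MeasurableSpace.comap C inferInstance) hC.comap_le A B μ) :
    FactorsVia μ A B C (condDistrib B C μ) := by
  rw [condIndepFun_iff_condDistrib_prod_ae_eq_prodMkRight hB hA hC,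
    condDistrib_ae_eq_iff_measure_eq_compProd _ hB.aemeasurable] at h
  exact h

/-- Moving a coordinate from the independent variable into the conditioning. -/
lemma FactorsVia.assoc {D : Ω → δ} {κ : Kernel γ β} [IsSFiniteKernel κ]
    (h : FactorsVia μ (fun ω => (D ω, A ω)) B C κ) (hA : Measurable A) (hB : Measurable B)
    (hC : Measurable C) (hD : Measurable D) :
    FactorsVia μ A B (fun ω => (C ω, D ω)) (κ.prodMkRight δ) := by
  unfold FactorsVia at *
  have hk : Measurable (fun p : γ × δ × α => ((p.1, p.2.1), p.2.2)) := by fun_prop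
  have := map_compProd_comap (μ := μ.map fun ω => (C ω, D ω, A ω)) hk
    ((κ.prodMkRight δ).prodMkRight α)
  rw [Measure.map_map hk (by fun_prop)] at this
  have e : ((κ.prodMkRight δ).prodMkRight α).comap
      (fun p : γ × δ × α => ((p.1, p.2.1), p.2.2)) hk = κ.prodMkRight (δ × α) := by
    ext1 p; rfl
  rw [e, ← h, Measure.map_map (by fun_prop) (by fun_prop)] at this
  exact this

lemma condExp_prod_of_condIndepFun [StandardBorelSpace Ω] [StandardBorelSpace α] [Nonempty α]
    [StandardBorelSpace β] [Nonempty β] (hA : Measurable A) (hB : Measurable B)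
    (hC : Measurable C)
    (h : CondIndepFun (MeasurableSpace.comap C inferInstance) hC.comap_le A B μ)
    {f : β → ℝ} (hf : Measurable f) (hint : Integrable (fun ω => f (B ω)) μ) :
    μ[(fun ω => f (B ω)) | MeasurableSpace.comap (fun ω => (C ω, A ω)) inferInstance]
      =ᵐ[μ] μ[(fun ω => f (B ω)) | MeasurableSpace.comap C inferInstance] := by
  rw [condIndepFun_iff_condDistrib_prod_ae_eq_prodMkRight hB hA hC] at h
  have h1 := condExp_ae_eq_integral_condDistrib (hC.prodMk hA) hB.aemeasurable
    hf.stronglyMeasurable hint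
  have h2 := condExp_ae_eq_integral_condDistrib hC hB.aemeasurable hf.stronglyMeasurable hint
  filter_upwards [h1, h2, ae_of_ae_map (by fun_prop) h] with ω e1 e2 e3
  rw [e1, e2, e3, Kernel.prodMkRight_apply]

/-- An observation that is conditionally independent of `X` given `C` changes no conditional
expectation of `X`, hence not the error covariance. -/
lemma condCov_prod_of_condIndepFun [StandardBorelSpace Ω] [StandardBorelSpace α] [Nonempty α]
    {k : ℕ} {X : Ω → Vec k} (hA : Measurable A) (hX : Measurable X) (hC : Measurable C)
    (hXi : ∀ i, Integrable (fun ω => X ω i) μ)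
    (h : CondIndepFun (MeasurableSpace.comap C inferInstance) hC.comap_le A X μ) :
    condCov μ X (fun ω => (C ω, A ω)) = condCov μ X C := by
  ext i j
  refine integral_congr_ae ?_
  filter_upwards [condExp_prod_of_condIndepFun hA hX hC h (measurable_pi_apply i) (hXi i),
    condExp_prod_of_condIndepFun hA hX hC h (measurable_pi_apply j) (hXi j)] with ω h1 h2
  rw [h1, h2]

end CondIndep

/-! ### Cross moments -/

section CrossMoment

variable {Ω : Type} [MeasurableSpace Ω] {k l p : ℕ} {μ : Measure Ω}

/-- The cross moment matrix `E[e fᵀ]`. -/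
def crossMoment (μ : Measure Ω) (e : Ω → Vec k) (f : Ω → Vec l) : Matrix (Fin k) (Fin l) ℝ :=
  Matrix.of fun i j => ∫ ω, e ω i * f ω j ∂μ

lemma crossMoment_self (e : Ω → Vec k) : crossMoment μ e e = secondMoment μ e := rfl

lemma crossMoment_transpose (e : Ω → Vec k) (f : Ω → Vec l) :
    (crossMoment μ e f)ᵀ = crossMoment μ f e := by
  ext i j
  simp [crossMoment, mul_comm]

lemma memLp_mulVec (M : Matrix (Fin l) (Fin k) ℝ) {e : Ω → Vec k}
    (he : ∀ i, MemLp (fun ω => e ω i) 2 μ) : ∀ i, MemLp (fun ω => (M *ᵥ e ω) i) 2 μ := fun i =>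
  memLp_dotProduct he (M i)

lemma crossMoment_add_left {e e' : Ω → Vec k} {f : Ω → Vec l}
    (he : ∀ i, MemLp (fun ω => e ω i) 2 μ) (he' : ∀ i, MemLp (fun ω => e' ω i) 2 μ)
    (hf : ∀ i, MemLp (fun ω => f ω i) 2 μ) :
    crossMoment μ (fun ω => e ω + e' ω) f = crossMoment μ e f + crossMoment μ e' f := by
  ext i j
  simp only [crossMoment, Matrix.of_apply, Matrix.add_apply, Pi.add_apply, add_mul]
  exact integral_add ((he i).integrable_mul (hf j)) ((he' i).integrable_mul (hf j))

lemma crossMoment_mulVec_left (M : Matrix (Fin p) (Fin k) ℝ) {e : Ω → Vec k} {f : Ω → Vec l}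
    (he : ∀ i, MemLp (fun ω => e ω i) 2 μ) (hf : ∀ i, MemLp (fun ω => f ω i) 2 μ) :
    crossMoment μ (fun ω => M *ᵥ e ω) f = M * crossMoment μ e f := by
  ext i j
  have hi : ∀ r, Integrable (fun ω => M i r * (e ω r * f ω j)) μ := fun r =>
    ((he r).integrable_mul (hf j)).const_mul _
  simp only [crossMoment, Matrix.of_apply, Matrix.mul_apply, Matrix.mulVec, dotProduct,
    Finset.sum_mul, mul_assoc]
  rw [integral_finsetSum _ fun r _ => hi r]
  exact Finset.sum_congr rfl fun r _ => integral_const_mul _ _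

lemma crossMoment_sub_left {e e' : Ω → Vec k} {f : Ω → Vec l}
    (he : ∀ i, MemLp (fun ω => e ω i) 2 μ) (he' : ∀ i, MemLp (fun ω => e' ω i) 2 μ)
    (hf : ∀ i, MemLp (fun ω => f ω i) 2 μ) :
    crossMoment μ (fun ω => e ω - e' ω) f = crossMoment μ e f - crossMoment μ e' f := by
  ext i j
  simp only [crossMoment, Matrix.of_apply, Matrix.sub_apply, Pi.sub_apply, sub_mul]
  exact integral_sub ((he i).integrable_mul (hf j)) ((he' i).integrable_mul (hf j))

lemma crossMoment_sub_right {e : Ω → Vec k} {f f' : Ω → Vec l}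
    (he : ∀ i, MemLp (fun ω => e ω i) 2 μ) (hf : ∀ i, MemLp (fun ω => f ω i) 2 μ)
    (hf' : ∀ i, MemLp (fun ω => f' ω i) 2 μ) :
    crossMoment μ e (fun ω => f ω - f' ω) = crossMoment μ e f - crossMoment μ e f' := by
  rw [← crossMoment_transpose, crossMoment_sub_left hf hf' he, Matrix.transpose_sub,
    crossMoment_transpose, crossMoment_transpose]

lemma crossMoment_add_right {e : Ω → Vec k} {f f' : Ω → Vec l}
    (he : ∀ i, MemLp (fun ω => e ω i) 2 μ) (hf : ∀ i, MemLp (fun ω => f ω i) 2 μ)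
    (hf' : ∀ i, MemLp (fun ω => f' ω i) 2 μ) :
    crossMoment μ e (fun ω => f ω + f' ω) = crossMoment μ e f + crossMoment μ e f' := by
  rw [← crossMoment_transpose, crossMoment_add_left hf hf' he, Matrix.transpose_add,
    crossMoment_transpose, crossMoment_transpose]

lemma crossMoment_mulVec_right (M : Matrix (Fin p) (Fin l) ℝ) {e : Ω → Vec k} {f : Ω → Vec l}
    (he : ∀ i, MemLp (fun ω => e ω i) 2 μ) (hf : ∀ i, MemLp (fun ω => f ω i) 2 μ) :
    crossMoment μ e (fun ω => M *ᵥ f ω) = crossMoment μ e f * Mᵀ := by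
  rw [← crossMoment_transpose, crossMoment_mulVec_left M hf he, Matrix.transpose_mul,
    crossMoment_transpose]

lemma secondMoment_add_of_crossMoment_eq_zero {e e' : Ω → Vec k}
    (he : ∀ i, MemLp (fun ω => e ω i) 2 μ) (he' : ∀ i, MemLp (fun ω => e' ω i) 2 μ)
    (h : crossMoment μ e' e = 0) :
    secondMoment μ (fun ω => e ω + e' ω) = secondMoment μ e + secondMoment μ e' := by
  have hs : ∀ i, MemLp (fun ω => (e ω + e' ω) i) 2 μ := fun i => (he i).add (he' i)
  have h' : crossMoment μ e e' = 0 := by rw [← crossMoment_transpose, h, Matrix.transpose_zero]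
  rw [← crossMoment_self, crossMoment_add_left he he' hs, crossMoment_add_right he he he',
    crossMoment_add_right he' he he', h, h', add_zero, zero_add, crossMoment_self,
    crossMoment_self]

lemma secondMoment_mulVec (M : Matrix (Fin l) (Fin k) ℝ) {e : Ω → Vec k}
    (he : ∀ i, MemLp (fun ω => e ω i) 2 μ) :
    secondMoment μ (fun ω => M *ᵥ e ω) = M * secondMoment μ e * Mᵀ := by
  rw [← crossMoment_self, crossMoment_mulVec_left M he (memLp_mulVec M he),
    crossMoment_mulVec_right M he he, crossMoment_self, Matrix.mul_assoc]

end CrossMoment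

/-! ### The effect of an enhanced observation -/

section Enhancement

variable {Ω σ τ : Type} [m₀ : MeasurableSpace Ω] [MeasurableSpace σ] [MeasurableSpace τ] {k : ℕ}
  {μ : Measure Ω} [IsProbabilityMeasure μ]

lemma stronglyMeasurable_mulVec {m : MeasurableSpace Ω} {l : ℕ} (M : Matrix (Fin l) (Fin k) ℝ)
    {e : Ω → Vec k} (he : ∀ i, StronglyMeasurable[m] fun ω => e ω i) (i : Fin l) :
    StronglyMeasurable[m] fun ω => (M *ᵥ e ω) i := by
  unfold Matrix.mulVec dotProduct
  exact Finset.stronglyMeasurable_fun_sum _ fun j _ => (he j).const_mul _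

/-- Observing `T`, which refines `S` and reveals a noisy copy `K̃ X - n` of `X` whose noise has
covariance `K̃` and is uncorrelated with the error of estimating `X` from `S`, increases the
inverse error covariance by at least `K̃`. -/
theorem enhanced_condCov {X n : Ω → Vec k} {T : Ω → τ} {g : τ → σ} (hg : Measurable g)
    (hT : Measurable T) (hX : ∀ i, MemLp (fun ω => X ω i) 2 μ)
    (hn : ∀ i, MemLp (fun ω => n ω i) 2 μ)
    (hcross : crossMoment μ n (condErr μ X fun ω => g (T ω)) = 0)
    {z : τ → Vec k} (hz : Measurable z)
    (hzT : ∀ ω, z (T ω) = secondMoment μ n *ᵥ X ω - n ω)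
    (hpos : (condCov μ X T).PosDef) :
    ((condCov μ X T)⁻¹ - secondMoment μ n).PosDef ∧
      (condCov μ X (fun ω => g (T ω)) - ((condCov μ X T)⁻¹ - secondMoment μ n)⁻¹).PosSemidef := by
  set N := secondMoment μ n with hN
  set S : Ω → σ := fun ω => g (T ω) with hS
  have hSm : Measurable S := hg.comp hT
  have hSle : MeasurableSpace.comap S inferInstance ≤ MeasurableSpace.comap T inferInstance := by
    rw [hS, ← measurable_iff_comap_le]
    exact hg.comp (comap_measurable T)
  set Xh : Ω → Vec k := fun ω i =>
    (μ[(fun ω' => X ω' i) | MeasurableSpace.comap S inferInstance]) ω with hXh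
  have hXhL : ∀ i, MemLp (fun ω => Xh ω i) 2 μ := fun i => (hX i).condExp (by norm_num)
  have hXhm : ∀ i, StronglyMeasurable[MeasurableSpace.comap T inferInstance]
      fun ω => Xh ω i := fun i => stronglyMeasurable_condExp.mono hSle
  have herr : ∀ ω, X ω - Xh ω = condErr μ X S ω := fun ω => rfl
  set K' := condCov μ X S with hK'
  have hK'pos : K'.PosDef := by
    refine posDef_of_sub_posSemidef hpos ?_
    exact secondMoment_sub_condCov_posSemidef hX hT hXhL hXhm
  have hNpos : N.PosSemidef := secondMoment_posSemidef hn
  set A := K'⁻¹ + N with hA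
  have hApos : A.PosDef := hK'pos.inv.add_posSemidef hNpos
  have hAdet : IsUnit A.det := (Matrix.isUnit_iff_isUnit_det _).1 hApos.isUnit
  have hKdet : IsUnit K'.det := (Matrix.isUnit_iff_isUnit_det _).1 hK'pos.isUnit
  have hKt : (K'⁻¹)ᵀ = K'⁻¹ := transpose_eq_of_posSemidef hK'pos.inv.posSemidef
  have hAt : (A⁻¹)ᵀ = A⁻¹ := transpose_eq_of_posSemidef hApos.inv.posSemidef
  -- The precision-weighted combination of the prediction from `S` and the noisy look `z`. Its error
  -- is A⁻¹ (K'⁻¹ e + n) with e and n uncorrelated, of covariance A⁻¹ (K'⁻¹ + N) A⁻¹ = A⁻¹.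
  set X' : Ω → Vec k := fun ω => A⁻¹ *ᵥ (K'⁻¹ *ᵥ Xh ω + z (T ω)) with hX'
  have hzL : ∀ i, MemLp (fun ω => z (T ω) i) 2 μ := fun i => by
    simp_rw [hzT]
    exact (memLp_mulVec N hX i).sub (hn i)
  have hzm : ∀ i, StronglyMeasurable[MeasurableSpace.comap T inferInstance]
      fun ω => z (T ω) i := fun i =>
    Measurable.stronglyMeasurable
      (((measurable_pi_apply i).comp hz).comp (comap_measurable T))
  have hX'L : ∀ i, MemLp (fun ω => X' ω i) 2 μ := memLp_mulVec A⁻¹ fun i =>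
    (memLp_mulVec K'⁻¹ hXhL i).add (hzL i)
  have hX'm : ∀ i, StronglyMeasurable[MeasurableSpace.comap T inferInstance]
      fun ω => X' ω i := stronglyMeasurable_mulVec A⁻¹ fun i =>
    (stronglyMeasurable_mulVec K'⁻¹ hXhm i).add (hzm i)
  have hdiff : ∀ ω, X ω - X' ω = A⁻¹ *ᵥ (K'⁻¹ *ᵥ condErr μ X S ω + n ω) := by
    intro ω
    have e1 : X ω = A⁻¹ *ᵥ (A *ᵥ X ω) := by
      rw [Matrix.mulVec_mulVec, Matrix.nonsing_inv_mul _ hAdet, Matrix.one_mulVec]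
    have e2 : X' ω = A⁻¹ *ᵥ (K'⁻¹ *ᵥ Xh ω + z (T ω)) := rfl
    rw [e2]
    nth_rewrite 1 [e1]
    rw [← Matrix.mulVec_sub]
    congr 1
    rw [← herr, hzT, hA, Matrix.add_mulVec, Matrix.mulVec_sub]
    abel
  have hL1 := memLp_mulVec K'⁻¹ (memLp_condErr hX S)
  have hcov : secondMoment μ (fun ω => X ω - X' ω) = A⁻¹ := by
    have hL2 : ∀ i, MemLp (fun ω => (K'⁻¹ *ᵥ condErr μ X S ω + n ω) i) 2 μ := fun i =>
      (hL1 i).add (hn i)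
    simp_rw [hdiff]
    rw [secondMoment_mulVec A⁻¹ hL2,
      secondMoment_add_of_crossMoment_eq_zero hL1 hn, secondMoment_mulVec _ (memLp_condErr hX S),
      ← condCov_eq, hKt, hAt, Matrix.nonsing_inv_mul _ hKdet, one_mul, ← hA,
      Matrix.nonsing_inv_mul _ hAdet, one_mul]
    rw [crossMoment_mulVec_right _ hn (memLp_condErr hX S), hcross, zero_mul]
  have h1 := secondMoment_sub_condCov_posSemidef hX hT hX'L hX'm
  rw [hcov] at h1
  have h2 := inv_sub_inv_posSemidef hpos h1
  rw [Matrix.nonsing_inv_nonsing_inv _ hAdet] at h2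
  have h3 : ((condCov μ X T)⁻¹ - N - K'⁻¹).PosSemidef := by
    have : (condCov μ X T)⁻¹ - N - K'⁻¹ = (condCov μ X T)⁻¹ - A := by rw [hA]; abel
    rwa [this]
  have h4 := posDef_of_sub_posSemidef hK'pos.inv h3
  -- Since K_{X|T}⁻¹ - N dominates the positive definite K'⁻¹, it is itself positive definite, and
  -- inverting reverses the order.
  refine ⟨h4, ?_⟩
  have h5 := inv_sub_inv_posSemidef hK'pos.inv h3
  rwa [Matrix.nonsing_inv_nonsing_inv _ hKdet] at h5

end Enhancement

/-! ### Linear regression and Gaussian conditional expectations -/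

/-- The coefficients of the orthogonal projection of `f` on the span of the `y j` in L². No
covariance has to be inverted, so `y` may be degenerate. -/
lemma exists_normal_equation {Ω : Type} [MeasurableSpace Ω] {μ : Measure Ω} {m : ℕ} {f : Ω → ℝ}
    (hf : MemLp f 2 μ) {y : Ω → Vec m} (hy : ∀ j, MemLp (fun ω => y ω j) 2 μ) :
    ∃ a : Vec m, ∀ j, ∫ ω, (f ω - a ⬝ᵥ y ω) * y ω j ∂μ = 0 := by
  set F : Lp ℝ 2 μ := hf.toLp f
  set Yl : Fin m → Lp ℝ 2 μ := fun j => (hy j).toLp _ with hYl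
  set p : Submodule ℝ (Lp ℝ 2 μ) := Submodule.span ℝ (Set.range Yl)
  have : FiniteDimensional ℝ p := FiniteDimensional.span_of_finite ℝ (Set.finite_range Yl)
  obtain ⟨a, ha⟩ := (Submodule.mem_span_range_iff_exists_fun ℝ).1
    (p.starProjection_apply_mem F)
  refine ⟨a, fun j => ?_⟩
  have h0 : inner ℝ (F - p.starProjection F) (Yl j) = 0 :=
    p.starProjection_inner_eq_zero F (Yl j) (Submodule.subset_span ⟨j, rfl⟩)
  rw [← ha, L2.inner_def] at h0
  rw [← h0]
  refine integral_congr_ae ?_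
  have h1 : ∀ᵐ ω ∂μ, ∀ i, Yl i ω = y ω i := ae_all_iff.2 fun i => (hy i).coeFn_toLp
  have h2 : ∀ᵐ ω ∂μ, ∀ i ∈ Finset.univ, (a i • Yl i : Lp ℝ 2 μ) ω = a i • Yl i ω :=
    ae_all_iff.2 fun i => by
      filter_upwards [Lp.coeFn_smul (a i) (Yl i)] with ω h _ using h
  filter_upwards [h1, h2, hf.coeFn_toLp, Lp.coeFn_sub F (∑ i, a i • Yl i),
    Lp.coeFn_fun_finsetSum Finset.univ fun i => a i • Yl i] with ω e1 e2 e3 e4 e5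
  rw [e4, Pi.sub_apply, e5, e1, Finset.sum_congr rfl e2]
  simp only [e1, smul_eq_mul]
  rw [show F ω = f ω from e3]
  simp [dotProduct, mul_comm]

section Gaussian

variable {E : Type} [NormedAddCommGroup E] [NormedSpace ℝ E] [CompleteSpace E]
  [SecondCountableTopology E] [MeasurableSpace E] [BorelSpace E] {Q : Measure E} [IsGaussian Q]
  {k l m : ℕ}

lemma integral_strongDual_of_centered (hQ : ∫ s, s ∂Q = 0) (f : StrongDual ℝ E) :
    ∫ e, f e ∂Q = 0 := by
  have := IsGaussian.integral_dual (μ := Q) f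
  rwa [hQ, map_zero] at this

lemma memLp_clm (X : E →L[ℝ] Vec k) (i : Fin k) : MemLp (fun e => X e i) 2 Q :=
  IsGaussian.memLp_dual Q ((ContinuousLinearMap.proj i).comp X) 2 (by norm_num)

lemma integral_clm_of_centered (hQ : ∫ s, s ∂Q = 0) (X : E →L[ℝ] Vec k) (i : Fin k) :
    ∫ e, X e i ∂Q = 0 :=
  integral_strongDual_of_centered hQ ((ContinuousLinearMap.proj i).comp X)

lemma indepFun_of_crossMoment_eq_zero (hQ : ∫ s, s ∂Q = 0) (n : E →L[ℝ] Vec k)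
    (r : E →L[ℝ] Vec l) (h : crossMoment Q n r = 0) : IndepFun n r Q := by
  have hg : HasGaussianLaw (fun e => (fun i => n e i, fun j => r e j)) Q :=
    (IsGaussian.hasGaussianLaw_id (μ := Q)).map_fun (n.prod r)
  refine hg.indepFun_of_covariance_eval fun i j => ?_
  rw [covariance_eq_sub (memLp_clm n i) (memLp_clm r j), integral_clm_of_centered hQ n i, zero_mul,
    sub_zero]
  exact congrFun (congrFun h i) j

/-- The residual of linear regression is uncorrelated with `Y`, hence by joint Gaussianity
independent of it. Its conditional expectation is then its mean, which is zero. -/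
lemma exists_dotProduct_condExp (hQ : ∫ s, s ∂Q = 0) (f : StrongDual ℝ E) (Y : E →L[ℝ] Vec m) :
    ∃ a : Vec m, Q[(fun e => f e) | MeasurableSpace.comap Y inferInstance]
      =ᵐ[Q] fun e => a ⬝ᵥ Y e := by
  have hfL : MemLp (fun e => f e) 2 Q := IsGaussian.memLp_dual Q f 2 (by norm_num)
  obtain ⟨a, ha⟩ := exists_normal_equation hfL (memLp_clm Y)
  refine ⟨a, ?_⟩
  set aY : StrongDual ℝ E := ∑ j, a j • ((ContinuousLinearMap.proj j).comp Y) with haY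
  have haYe : ∀ e, aY e = a ⬝ᵥ Y e := fun e => by
    simp [haY, dotProduct]
  set r : E →L[ℝ] Vec 1 := ContinuousLinearMap.pi fun _ => f - aY with hr
  have hind : IndepFun r Y Q := by
    refine indepFun_of_crossMoment_eq_zero hQ r Y ?_
    ext i j
    simp only [crossMoment, Matrix.of_apply, Matrix.zero_apply]
    rw [← ha j]
    simp [hr, haYe]
  have hY : Measurable Y := Y.continuous.measurable
  have h0 : Q[(fun e => r e 0) | MeasurableSpace.comap Y inferInstance] =ᵐ[Q] fun _ => 0 := by
    have := condExp_indep_eq (μ := Q) (f := fun e => r e 0) r.continuous.measurable.comap_le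
      hY.comap_le
      (((measurable_pi_apply 0).comp (comap_measurable r)).stronglyMeasurable) hind
    rwa [integral_clm_of_centered hQ r 0] at this
  have haYm : StronglyMeasurable[MeasurableSpace.comap Y inferInstance] fun e => a ⬝ᵥ Y e := by
    unfold dotProduct
    exact Finset.stronglyMeasurable_fun_sum _ fun j _ =>
      (((measurable_pi_apply j).comp (comap_measurable Y)).stronglyMeasurable).const_mul _
  have haYi : Integrable (fun e => a ⬝ᵥ Y e) Q :=
    (memLp_dotProduct (memLp_clm Y) a).integrable (by norm_num)
  have hsum : (fun e => f e) = (fun e => r e 0) + fun e => a ⬝ᵥ Y e := by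
    funext e; simp [hr, haYe]
  rw [hsum]
  have h1 := condExp_add (m := MeasurableSpace.comap Y inferInstance)
    ((memLp_clm (Q := Q) r 0).integrable (by norm_num)) haYi
  rw [condExp_of_stronglyMeasurable hY.comap_le haYm haYi] at h1
  filter_upwards [h0, h1] with e h2 h3
  rw [h3, Pi.add_apply, h2, zero_add]

/-- For centered jointly Gaussian vectors the conditional expectation is linear. -/
lemma exists_mulVec_condExp (hQ : ∫ s, s ∂Q = 0) (X : E →L[ℝ] Vec k) (Y : E →L[ℝ] Vec m) :
    ∃ M : Matrix (Fin k) (Fin m) ℝ, ∀ i,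
      Q[(fun e => X e i) | MeasurableSpace.comap Y inferInstance] =ᵐ[Q] fun e => (M *ᵥ Y e) i := by
  choose M hM using fun i =>
    exists_dotProduct_condExp hQ ((ContinuousLinearMap.proj (R := ℝ) i).comp X) Y
  exact ⟨Matrix.of M, hM⟩

/-- The linear map of a matrix, as a continuous linear map. -/
def mulVecCLM (M : Matrix (Fin k) (Fin m) ℝ) : Vec m →L[ℝ] Vec k :=
  LinearMap.toContinuousLinearMap (Matrix.mulVecLin M)

lemma crossMoment_condExp_eq_zero {τ : Type} [MeasurableSpace τ] {X : E →L[ℝ] Vec k}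
    {T : E → τ} (hT : Measurable T) {g : E → Vec k}
    (hg : ∀ i, Q[(fun e => X e i) | MeasurableSpace.comap T inferInstance] =ᵐ[Q] fun e => g e i)
    (Y : E →L[ℝ] Vec m)
    (hY : ∀ j, StronglyMeasurable[MeasurableSpace.comap T inferInstance] fun e => Y e j) :
    crossMoment Q (fun e => X e - g e) Y = 0 := by
  ext i j
  simp only [crossMoment, Matrix.of_apply, Matrix.zero_apply]
  rw [← integral_sub_condExp_mul hT.comap_le (memLp_clm (Q := Q) X i)
    (memLp_clm (Q := Q) Y j) (hY j)]
  refine integral_congr_ae ?_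
  filter_upwards [hg i] with e he
  rw [he, Pi.sub_apply]

lemma secondMoment_of_condExp {τ : Type} [MeasurableSpace τ] {X : E →L[ℝ] Vec k}
    {T : E → τ} {g : E → Vec k}
    (hg : ∀ i, Q[(fun e => X e i) | MeasurableSpace.comap T inferInstance] =ᵐ[Q] fun e => g e i) :
    secondMoment Q (fun e => X e - g e) = condCov Q X T := by
  ext i j
  refine integral_congr_ae ?_
  filter_upwards [hg i, hg j] with e hi hj
  simp only [Pi.sub_apply, hi, hj]

/-- For centered jointly Gaussian `X, Y, Yb` with `X ↔ Y ↔ Yb`, the pair `(Y, Yb)` reveals a copy of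
`K̃ X` observed in a noise `n` of covariance `K̃ = K_{X|Y}⁻¹ - K_{X|Yb}⁻¹` that is independent of
`(X, Yb)`. -/
theorem exists_enhancement_noise (hQ : ∫ s, s ∂Q = 0) (X : E →L[ℝ] Vec k) (Y : E →L[ℝ] Vec m)
    (Yb : E →L[ℝ] Vec l) (hKY : (condCov Q X Y).PosDef) (hKb : (condCov Q X Yb).PosDef)
    (hmk : ∀ i, Q[(fun e => X e i) | MeasurableSpace.comap (fun e => (Y e, Yb e)) inferInstance]
      =ᵐ[Q] Q[(fun e => X e i) | MeasurableSpace.comap Y inferInstance]) :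
    ∃ (n : E →L[ℝ] Vec k) (z : Vec m × Vec l → Vec k), Measurable z ∧
      secondMoment Q n = (condCov Q X Y)⁻¹ - (condCov Q X Yb)⁻¹ ∧
      (∀ e, z (Y e, Yb e) = secondMoment Q n *ᵥ X e - n e) ∧
      IndepFun n (fun e => (X e, Yb e)) Q := by
  set KY := condCov Q X Y with hKYdef
  set Kb := condCov Q X Yb with hKbdef
  have hYdet : IsUnit KY.det := (Matrix.isUnit_iff_isUnit_det _).1 hKY.isUnit
  have hbdet : IsUnit Kb.det := (Matrix.isUnit_iff_isUnit_det _).1 hKb.isUnit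
  have hYt : (KY⁻¹)ᵀ = KY⁻¹ := transpose_eq_of_posSemidef hKY.inv.posSemidef
  have hbt : (Kb⁻¹)ᵀ = Kb⁻¹ := transpose_eq_of_posSemidef hKb.inv.posSemidef
  have hYt' : KYᵀ = KY := transpose_eq_of_posSemidef hKY.posSemidef
  have hYm : Measurable Y := Y.continuous.measurable
  have hYbm : Measurable Yb := Yb.continuous.measurable
  obtain ⟨M, hM⟩ := exists_mulVec_condExp hQ X Y
  obtain ⟨Mb, hMb⟩ := exists_mulVec_condExp hQ X Yb
  set η : E →L[ℝ] Vec k := X - (mulVecCLM M).comp Y with hη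
  set ηb : E →L[ℝ] Vec k := X - (mulVecCLM Mb).comp Yb with hηb
  have hηe : ∀ e, η e = X e - M *ᵥ Y e := fun e => rfl
  have hηbe : ∀ e, ηb e = X e - Mb *ᵥ Yb e := fun e => rfl
  have hMT : ∀ i, Q[(fun e => X e i) | MeasurableSpace.comap (fun e => (Y e, Yb e)) inferInstance]
      =ᵐ[Q] fun e => (M *ᵥ Y e) i := fun i => (hmk i).trans (hM i)
  have cηY : crossMoment Q η Y = 0 := crossMoment_condExp_eq_zero hYm hM Y fun j =>
    ((measurable_pi_apply j).comp (comap_measurable Y)).stronglyMeasurable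
  -- The only use of the Markov chain: the prediction from `Y` is also the prediction from `(Y,
  -- Yb)`, so its error is orthogonal to `Yb` too.
  have cηYb : crossMoment Q η Yb = 0 :=
    crossMoment_condExp_eq_zero (hYm.prodMk hYbm) hMT Yb fun j =>
      ((measurable_pi_apply j).comp (measurable_snd.comp
        (comap_measurable fun e => (Y e, Yb e)))).stronglyMeasurable
  have cηbYb : crossMoment Q ηb Yb = 0 := crossMoment_condExp_eq_zero hYbm hMb Yb fun j =>
    ((measurable_pi_apply j).comp (comap_measurable Yb)).stronglyMeasurable
  have sη : secondMoment Q η = KY := secondMoment_of_condExp hM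
  have sηb : secondMoment Q ηb = Kb := secondMoment_of_condExp hMb
  have LX := memLp_clm (Q := Q) X
  have LY := memLp_clm (Q := Q) Y
  have LYb := memLp_clm (Q := Q) Yb
  have Lη := memLp_clm (Q := Q) η
  have Lηb := memLp_clm (Q := Q) ηb
  have cηX : crossMoment Q η X = KY := by
    have h1 : crossMoment Q η η = crossMoment Q η X - crossMoment Q η Y * Mᵀ := by
      rw [← crossMoment_mulVec_right M Lη LY,
        ← crossMoment_sub_right Lη LX (memLp_mulVec M LY)]
      rfl
    rw [cηY, Matrix.zero_mul, sub_zero, crossMoment_self, sη] at h1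
    exact h1.symm
  have cηbX : crossMoment Q ηb X = Kb := by
    have h1 : crossMoment Q ηb ηb = crossMoment Q ηb X - crossMoment Q ηb Yb * Mbᵀ := by
      rw [← crossMoment_mulVec_right Mb Lηb LYb,
        ← crossMoment_sub_right Lηb LX (memLp_mulVec Mb LYb)]
      rfl
    rw [cηbYb, Matrix.zero_mul, sub_zero, crossMoment_self, sηb] at h1
    exact h1.symm
  have cηηb : crossMoment Q η ηb = KY := by
    have h1 : crossMoment Q η ηb = crossMoment Q η X - crossMoment Q η Yb * Mbᵀ := by
      rw [← crossMoment_mulVec_right Mb Lη LYb,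
        ← crossMoment_sub_right Lη LX (memLp_mulVec Mb LYb)]
      rfl
    rw [h1, cηYb, Matrix.zero_mul, sub_zero, cηX]
  -- Both normalized errors have cross moment 1 with `X`, so their difference is uncorrelated with
  -- `X`; it is uncorrelated with `Yb` because each error is. The coefficient of `X` in `n` is K̃,
  -- so K̃ X - n involves only `Y` and `Yb`.
  set n : E →L[ℝ] Vec k := (mulVecCLM KY⁻¹).comp η - (mulVecCLM Kb⁻¹).comp ηb with hn
  have hne : ∀ e, n e = KY⁻¹ *ᵥ η e - Kb⁻¹ *ᵥ ηb e := fun e => rfl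
  have Ln := memLp_clm (Q := Q) n
  have cn : ∀ {p : ℕ} (f : E →L[ℝ] Vec p),
      crossMoment Q n f = KY⁻¹ * crossMoment Q η f - Kb⁻¹ * crossMoment Q ηb f := by
    intro p f
    have Lf := memLp_clm (Q := Q) f
    rw [← crossMoment_mulVec_left _ Lη Lf, ← crossMoment_mulVec_left _ Lηb Lf,
      ← crossMoment_sub_left (memLp_mulVec _ Lη) (memLp_mulVec _ Lηb) Lf]
    rfl
  have cnX : crossMoment Q n X = 0 := by
    rw [cn, cηX, cηbX, Matrix.nonsing_inv_mul _ hYdet, Matrix.nonsing_inv_mul _ hbdet, sub_self]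
  have cnYb : crossMoment Q n Yb = 0 := by
    rw [cn, cηYb, cηbYb, Matrix.mul_zero, Matrix.mul_zero, sub_zero]
  have cnη : crossMoment Q n η = 1 - Kb⁻¹ * KY := by
    rw [cn, crossMoment_self, sη, Matrix.nonsing_inv_mul _ hYdet, ← crossMoment_transpose, cηηb,
      hYt']
  have cnηb : crossMoment Q n ηb = 0 := by
    rw [cn, cηηb, crossMoment_self, sηb, Matrix.nonsing_inv_mul _ hYdet,
      Matrix.nonsing_inv_mul _ hbdet, sub_self]
  have sn : secondMoment Q n = KY⁻¹ - Kb⁻¹ := by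
    have h1 : crossMoment Q n n = crossMoment Q n η * (KY⁻¹)ᵀ - crossMoment Q n ηb * (Kb⁻¹)ᵀ := by
      rw [← crossMoment_mulVec_right _ Ln Lη, ← crossMoment_mulVec_right _ Ln Lηb,
        ← crossMoment_sub_right Ln (memLp_mulVec _ Lη) (memLp_mulVec _ Lηb)]
      rfl
    rw [← crossMoment_self, h1, cnη, cnηb, zero_mul, sub_zero, hYt, sub_mul, one_mul,
      Matrix.mul_assoc, Matrix.mul_nonsing_inv _ hYdet, mul_one]
  refine ⟨n, fun q => KY⁻¹ *ᵥ (M *ᵥ q.1) - Kb⁻¹ *ᵥ (Mb *ᵥ q.2), ?_, sn, fun e => ?_, ?_⟩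
  · exact (((mulVecCLM KY⁻¹).comp (mulVecCLM M)).continuous.measurable.comp measurable_fst).sub
      (((mulVecCLM Kb⁻¹).comp (mulVecCLM Mb)).continuous.measurable.comp measurable_snd)
  · rw [sn, hne, hηe, hηbe, Matrix.sub_mulVec, Matrix.mulVec_sub KY⁻¹,
      Matrix.mulVec_sub Kb⁻¹]
    change KY⁻¹ *ᵥ M *ᵥ Y e - Kb⁻¹ *ᵥ Mb *ᵥ Yb e = _
    abel
  · set r : E →L[ℝ] Vec (k + l) := ContinuousLinearMap.pi fun j =>
      Fin.addCases (fun i => (ContinuousLinearMap.proj i).comp X)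
        (fun i => (ContinuousLinearMap.proj i).comp Yb) j with hr
    have hind : IndepFun n r Q := by
      refine indepFun_of_crossMoment_eq_zero hQ n r ?_
      ext i j
      refine Fin.addCases (fun j => ?_) (fun j => ?_) j
      · have := congrFun (congrFun cnX i) j
        simpa [crossMoment, hr] using this
      · have := congrFun (congrFun cnYb i) j
        simpa [crossMoment, hr] using this
    have h2 := hind.comp (φ := id) (ψ := fun v : Vec (k + l) =>
      ((fun i => v (Fin.castAdd l i), fun i => v (Fin.natAdd k i)) : Vec k × Vec l))
      measurable_id (by fun_prop)
    have e2 : (fun e => (X e, Yb e)) = (fun v : Vec (k + l) =>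
        ((fun i => v (Fin.castAdd l i), fun i => v (Fin.natAdd k i)) : Vec k × Vec l)) ∘ r := by
      funext e
      refine Prod.ext ?_ ?_ <;> funext i <;> simp [hr]
    rw [e2]
    exact h2

end Gaussian

/-! ### Channels fed by a Gaussian source -/

section Channel

variable {N E α β : Type} [MeasurableSpace N] [MeasurableSpace E] [MeasurableSpace α]
  [MeasurableSpace β]

/-- Makes the noise independent also of the channel's private randomness, and so of every channel
output. -/
lemma indepFun_prod_snd (ν : Measure N) [IsProbabilityMeasure ν] {Q : Measure E}
    [IsProbabilityMeasure Q] {n : E → α} {r : E → β} (hn : Measurable n) (hr : Measurable r)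
    (h : IndepFun n r Q) :
    IndepFun (fun q : N × E => n q.2) (fun q => (q.1, r q.2)) (ν.prod Q) := by
  have hm1 : Measurable fun q : N × E => n q.2 := by fun_prop
  have hm2 : Measurable fun q : N × E => (q.1, r q.2) := by fun_prop
  rw [indepFun_iff_map_prod_eq_prod_map_map hn.aemeasurable hr.aemeasurable] at h
  rw [indepFun_iff_map_prod_eq_prod_map_map hm1.aemeasurable hm2.aemeasurable]
  have := Measure.isProbabilityMeasure_map (μ := Q) hr.aemeasurable
  have := Measure.isProbabilityMeasure_map (μ := Q) hn.aemeasurable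
  have e1 : (ν.prod Q).map (fun q => n q.2) = Q.map n := by
    rw [show (fun q : N × E => n q.2) = n ∘ Prod.snd from rfl, ← Measure.map_map hn measurable_snd,
      Measure.map_snd_prod, measure_univ, one_smul]
  have e2 : (ν.prod Q).map (fun q => (q.1, r q.2)) = ν.prod (Q.map r) := by
    have := Measure.map_prod_map ν Q measurable_id hr
    rw [Measure.map_id] at this
    exact this.symm
  rw [e1, e2]
  refine Measure.ext_of_lintegral _ fun f hf => ?_
  have e3 : ∀ ω, ∫⁻ e, f (n e, ω, r e) ∂Q = ∫⁻ a, ∫⁻ b, f (a, ω, b) ∂(Q.map r) ∂(Q.map n) := by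
    intro ω
    have h1 : Measurable fun p : α × β => f (p.1, ω, p.2) := by fun_prop
    rw [← lintegral_map (f := fun p : α × β => f (p.1, ω, p.2)) (g := fun e => (n e, r e)) h1
      (hn.prodMk hr), h, lintegral_prod _ h1.aemeasurable]
  rw [lintegral_map hf (by fun_prop), lintegral_prod _ (by fun_prop), lintegral_prod _ (by fun_prop)]
  simp_rw [e3]
  rw [lintegral_lintegral_swap]
  · refine lintegral_congr fun a => ?_
    rw [lintegral_prod _ (by fun_prop)]
  · refine Measurable.aemeasurable ?_
    exact Measurable.lintegral_prod_right' (f := fun p : (N × α) × β => f (p.1.2, p.1.1, p.2))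
      (by fun_prop)

end Channel

lemma secondMoment_map {Ω Ω' : Type} [MeasurableSpace Ω] [MeasurableSpace Ω'] {μ : Measure Ω}
    {k : ℕ} {f : Ω → Ω'} (hf : Measurable f) {e : Ω' → Vec k} (he : Measurable e) :
    secondMoment (μ.map f) e = secondMoment μ (fun ω => e (f ω)) := by
  ext i j
  have : AEStronglyMeasurable (fun ω => e ω i * e ω j) (μ.map f) := by
    have : Measurable fun ω => e ω i * e ω j := by fun_prop
    exact this.aestronglyMeasurable
  exact integral_map hf.aemeasurable this

lemma map_snd_prod_eq {N E : Type} [MeasurableSpace N] [MeasurableSpace E] (ν : Measure N)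
    [IsProbabilityMeasure ν] (Q : Measure E) [IsProbabilityMeasure Q] :
    (ν.prod Q).map Prod.snd = Q := by
  rw [Measure.map_snd_prod, measure_univ, one_smul]

/-! ### The enhanced covariance bound for the outputs of a channel. -/

section ChannelEnhancement

variable {N E σ : Type} [MeasurableSpace N] [StandardBorelSpace N] [NormedAddCommGroup E]
  [NormedSpace ℝ E] [CompleteSpace E] [SecondCountableTopology E] [MeasurableSpace E]
  [BorelSpace E] [StandardBorelSpace E] {Q : Measure E} [IsGaussian Q]
  [MeasurableSpace σ] [StandardBorelSpace σ] [Nonempty σ] {k l m : ℕ}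

/-- Adding `Yb` to the observation `(Y, S)`, where `S` is the output of a channel fed by `X`, does
not help if `X ↔ Y ↔ Yb`. -/
lemma condIndepFun_channel (ν : Measure N) [IsProbabilityMeasure ν] (X : E →L[ℝ] Vec k)
    (Y : E →L[ℝ] Vec m) (Yb : E →L[ℝ] Vec l) {κ : Kernel (Vec m) (Vec l)} [IsMarkovKernel κ]
    (hκ : FactorsVia Q X Yb Y κ) {s : N × Vec k → σ} (hs : Measurable s)
    (hC : Measurable fun q : N × E => (Y q.2, s (q.1, X q.2))) :
    CondIndepFun (MeasurableSpace.comap (fun q : N × E => (Y q.2, s (q.1, X q.2))) inferInstance)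
      hC.comap_le (fun q => Yb q.2) (fun q => X q.2) (ν.prod Q) := by
  have hX : Measurable X := X.continuous.measurable
  have hY : Measurable Y := Y.continuous.measurable
  have hYb : Measurable Yb := Yb.continuous.measurable
  have hS : Measurable fun q : N × E => s (q.1, X q.2) := by fun_prop
  have h1 := (hκ.prod_left (ν := ν) hX hYb hY).comp (by fun_prop) (by fun_prop) (by fun_prop)
    (g := fun q : Vec m × N × Vec k => (s q.2, q.2.2)) (by fun_prop)
  have h2 := h1.assoc (A := fun q : N × E => X q.2) (D := fun q : N × E => s (q.1, X q.2))
    (by fun_prop) (by fun_prop) (by fun_prop) hS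
  exact (h2.condIndepFun (by fun_prop) (by fun_prop) hC).symm

/-- Turns the constraint of decoder b, who sees `(s, Yb)`, into the enhanced constraint in terms of
`(Y, s)`: `enhanced_condCov` is applied to the observation `((Y, s), Yb)`, in which `Yb` is
redundant by the Markov chain. -/
theorem channel_enhancement (hQ : ∫ e, e ∂Q = 0) (ν : Measure N) [IsProbabilityMeasure ν]
    (X : E →L[ℝ] Vec k) (Y : E →L[ℝ] Vec m) (Yb : E →L[ℝ] Vec l)
    (hmk : CondIndepFun (MeasurableSpace.comap Y inferInstance) Y.continuous.measurable.comap_le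
      X Yb Q)
    (hKY : (condCov Q X Y).PosDef) (hKb : (condCov Q X Yb).PosDef)
    {s : N × Vec k → σ} (hs : Measurable s)
    (hpos : (condCov (ν.prod Q) (fun q => X q.2) fun q => (Y q.2, s (q.1, X q.2))).PosDef) :
    let K := (condCov (ν.prod Q) (fun q => X q.2) fun q => (Y q.2, s (q.1, X q.2)))⁻¹
      - ((condCov Q X Y)⁻¹ - (condCov Q X Yb)⁻¹)
    K.PosDef ∧
      (condCov (ν.prod Q) (fun q => X q.2) (fun q => (s (q.1, X q.2), Yb q.2)) - K⁻¹).PosSemidef := by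
  intro K
  have hX : Measurable X := X.continuous.measurable
  have hY : Measurable Y := Y.continuous.measurable
  have hYb : Measurable Yb := Yb.continuous.measurable
  have hS : Measurable fun q : N × E => s (q.1, X q.2) := by fun_prop
  have hC : Measurable fun q : N × E => (Y q.2, s (q.1, X q.2)) := by fun_prop
  have hT : Measurable fun q : N × E => ((Y q.2, s (q.1, X q.2)), Yb q.2) := by fun_prop
  have hmp : MeasurePreserving (Prod.snd : N × E → E) (ν.prod Q) Q :=
    ⟨measurable_snd, map_snd_prod_eq ν Q⟩
  have hLX : ∀ i, MemLp (fun q : N × E => X q.2 i) 2 (ν.prod Q) := fun i =>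
    (memLp_clm (Q := Q) X i).comp_measurePreserving hmp
  have hT' := condCov_prod_of_condIndepFun (A := fun q : N × E => Yb q.2)
    (X := fun q : N × E => X q.2) (by fun_prop) (by fun_prop) hC
    (fun i => (hLX i).integrable (by norm_num))
    (condIndepFun_channel ν X Y Yb (factorsVia_of_condIndepFun hX hYb hY hmk) hs hC)
  obtain ⟨n, z, hz, hn, hzn, hind⟩ := exists_enhancement_noise hQ X Y Yb hKY hKb fun i =>
    condExp_prod_of_condIndepFun hYb hX hY hmk.symm (measurable_pi_apply i)
      ((memLp_clm (Q := Q) X i).integrable (by norm_num))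
  have hnm : Measurable n := n.continuous.measurable
  have hLn : ∀ i, MemLp (fun q : N × E => n q.2 i) 2 (ν.prod Q) := fun i =>
    (memLp_clm (Q := Q) n i).comp_measurePreserving hmp
  have hnn : secondMoment (ν.prod Q) (fun q => n q.2) = secondMoment Q n := by
    rw [← secondMoment_map measurable_snd hnm, map_snd_prod_eq]
  -- The error of predicting `X` from `(s, Yb)` is a function of the channel randomness, `X` and
  -- `Yb`, all independent of the centered noise.
  have hcross : crossMoment (ν.prod Q) (fun q => n q.2)
      (condErr (ν.prod Q) (fun q => X q.2) fun q => (s (q.1, X q.2), Yb q.2)) = 0 := by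
    have hi := indepFun_prod_snd ν hnm (hX.prodMk hYb) hind
    ext i j
    have hSb : MeasurableSpace.comap (fun q : N × E => (s (q.1, X q.2), Yb q.2)) inferInstance
        ≤ MeasurableSpace.comap (fun q : N × E => (q.1, X q.2, Yb q.2)) inferInstance := by
      rw [← measurable_iff_comap_le]
      have hg : Measurable fun p : N × Vec k × Vec l => (s (p.1, p.2.1), p.2.2) := by fun_prop
      exact hg.comp (comap_measurable fun q : N × E => (q.1, X q.2, Yb q.2))
    have hxm : Measurable[MeasurableSpace.comap
        (fun q : N × E => (q.1, X q.2, Yb q.2)) inferInstance] fun q : N × E => X q.2 j := by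
      have hg : Measurable fun p : N × Vec k × Vec l => p.2.1 j := by fun_prop
      exact hg.comp (comap_measurable fun q : N × E => (q.1, X q.2, Yb q.2))
    have hcm : Measurable[MeasurableSpace.comap
        (fun q : N × E => (q.1, X q.2, Yb q.2)) inferInstance] fun q : N × E =>
        condErr (ν.prod Q) (fun q => X q.2) (fun q => (s (q.1, X q.2), Yb q.2)) q j :=
      hxm.sub (stronglyMeasurable_condExp.mono hSb).measurable
    have h1 : IndepFun (fun q : N × E => n q.2 i) (fun q : N × E =>
        condErr (ν.prod Q) (fun q => X q.2) (fun q => (s (q.1, X q.2), Yb q.2)) q j)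
        (ν.prod Q) := by
      refine indep_of_indep_of_le_left (indep_of_indep_of_le_right hi ?_) ?_
      · exact measurable_iff_comap_le.1 hcm
      · exact measurable_iff_comap_le.1
          ((measurable_pi_apply i).comp (comap_measurable fun q : N × E => n q.2))
    simp only [crossMoment, Matrix.of_apply, Matrix.zero_apply]
    rw [h1.integral_fun_mul_eq_mul_integral (hLn i).1 (memLp_condErr hLX _ j).1]
    have h0 : ∫ q : N × E, n q.2 i ∂(ν.prod Q) = 0 := by
      have := integral_map (μ := ν.prod Q) (f := fun e => n e i) measurable_snd.aemeasurable
        (by rw [map_snd_prod_eq]; exact (memLp_clm n i).1)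
      rw [← this, map_snd_prod_eq, integral_clm_of_centered hQ]
    rw [h0, zero_mul]
  have key := enhanced_condCov (μ := ν.prod Q) (X := fun q => X q.2) (n := fun q => n q.2)
    (T := fun q : N × E => ((Y q.2, s (q.1, X q.2)), Yb q.2))
    (g := fun p : (Vec m × σ) × Vec l => (p.1.2, p.2)) (by fun_prop) hT hLX hLn hcross
    (z := fun p => z (p.1.1, p.2)) (by fun_prop) (fun q => by rw [hnn]; exact hzn q.2)
    (by rw [hT']; exact hpos)
  rw [hT', hnn, hn] at key
  exact key

end ChannelEnhancement

/-! ### Nondegeneracy of the error covariance -/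

section Blank

variable {N E σ : Type} [MeasurableSpace N] [MeasurableSpace E] [MeasurableSpace σ] {k m : ℕ}

/-- If the channel output `S` carries, with positive probability, no information on `X`, then the
error covariance of `X` given `(Y, S)` is nondegenerate as soon as the one given `Y` is. -/
theorem condCov_posDef_of_blank {ν : Measure N} [IsProbabilityMeasure ν] {Q : Measure E}
    [IsProbabilityMeasure Q] {X : E → Vec k} (hXm : Measurable X)
    (hX : ∀ i, MemLp (fun e => X e i) 2 Q)
    {Y : E → Vec m} (hY : Measurable Y) (hKY : (condCov Q X Y).PosDef)
    {s : N × Vec k → σ} (hs : Measurable s) {B : Set N} (hBpos : ν B ≠ 0)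
    (hconst : ∀ ω ∈ B, ∀ x x', s (ω, x) = s (ω, x')) :
    (condCov (ν.prod Q) (fun q => X q.2) fun q => (Y q.2, s (q.1, X q.2))).PosDef := by
  have hmp : MeasurePreserving (Prod.snd : N × E → E) (ν.prod Q) Q :=
    ⟨measurable_snd, map_snd_prod_eq ν Q⟩
  have hLX : ∀ i, MemLp (fun q : N × E => X q.2 i) 2 (ν.prod Q) := fun i =>
    (hX i).comp_measurePreserving hmp
  set Z : N × E → Vec m × σ := fun q => (Y q.2, s (q.1, X q.2)) with hZ
  have hZm : Measurable Z := by
    have : Measurable fun q : N × E => s (q.1, X q.2) := by fun_prop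
    fun_prop
  have hps := condCov_posSemidef hLX Z
  refine Matrix.PosDef.of_dotProduct_mulVec_pos hps.isHermitian fun v hv => ?_
  refine lt_of_le_of_ne (hps.dotProduct_mulVec_nonneg v) fun h0 => ?_
  simp only [star_trivial] at h0
  have hLe := memLp_condErr hLX Z
  rw [condCov_eq, quad_secondMoment hLe] at h0
  have hae : ∀ᵐ q ∂(ν.prod Q), v ⬝ᵥ condErr (ν.prod Q) (fun q => X q.2) Z q = 0 := by
    have := (integral_eq_zero_iff_of_nonneg (fun q => sq_nonneg _)
      (memLp_dotProduct hLe v).integrable_sq).1 h0.symm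
    filter_upwards [this] with q hq
    exact pow_eq_zero_iff (two_ne_zero) |>.1 hq
  have hch : ∀ i, ∃ h : Vec m × σ → ℝ, Measurable h ∧ ∀ q,
      ((ν.prod Q)[(fun q => X q.2 i) | MeasurableSpace.comap Z inferInstance]) q = h (Z q) := by
    intro i
    obtain ⟨h, hh, he⟩ := (stronglyMeasurable_condExp (μ := ν.prod Q)
      (m := MeasurableSpace.comap Z inferInstance)
      (f := fun q : N × E => X q.2 i)).measurable.exists_eq_measurable_comp
    exact ⟨h, hh, fun q => congrFun he q⟩
  choose h hh hhe using hch
  have hae2 := Measure.ae_ae_of_ae_prod hae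
  -- The exceptional channel states form a null set, which cannot cover `B`. Freezing such a state,
  -- where the output is constant, makes `v ⬝ᵥ X` almost surely a function of `Y` alone,
  -- contradicting the nondegeneracy of K_{X|Y}.
  have hex : ∃ ω ∈ B, ∀ᵐ e ∂Q, v ⬝ᵥ condErr (ν.prod Q) (fun q => X q.2) Z (ω, e) = 0 := by
    by_contra hcon
    refine hBpos (measure_mono_null (fun ω hω => ?_) (ae_iff.1 hae2))
    exact fun h => hcon ⟨ω, hω, h⟩
  obtain ⟨ω, hω, hωe⟩ := hex
  set g : Vec m → Vec k := fun y i => h i (y, s (ω, 0)) with hg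
  have hgm : ∀ i, Measurable fun y => g y i := fun i => by
    have := hh i
    fun_prop
  have hgae : ∀ᵐ e ∂Q, v ⬝ᵥ X e = v ⬝ᵥ g (Y e) := by
    filter_upwards [hωe] with e he
    have e1 : condErr (ν.prod Q) (fun q => X q.2) Z (ω, e) = X e - g (Y e) := by
      funext i
      have e2 := hhe i (ω, e)
      have e3 : Z (ω, e) = (Y e, s (ω, 0)) := by simp only [hZ, hconst ω hω (X e) 0]
      rw [e3] at e2
      simp only [condErr, Pi.sub_apply, e2, hg]
    rw [e1, dotProduct_sub, sub_eq_zero] at he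
    exact he
  have hLvX := memLp_dotProduct hX v
  have hgL : MemLp (fun e => v ⬝ᵥ g (Y e)) 2 Q := hLvX.ae_eq hgae
  have hgmY : StronglyMeasurable[MeasurableSpace.comap Y inferInstance]
      fun e => v ⬝ᵥ g (Y e) := by
    unfold dotProduct
    exact Finset.stronglyMeasurable_fun_sum _ fun i _ =>
      (((hgm i).comp (comap_measurable Y)).stronglyMeasurable).const_mul _
  have hq := (hKY.dotProduct_mulVec_pos hv).ne'
  simp only [star_trivial] at hq
  rw [condCov_eq, quad_secondMoment (memLp_condErr hX Y)] at hq
  apply hq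
  refine integral_eq_zero_of_ae ?_
  have hsum : ∀ᵐ e ∂Q, v ⬝ᵥ condErr Q X Y e
      = v ⬝ᵥ X e - (Q[(fun e => v ⬝ᵥ X e) | MeasurableSpace.comap Y inferInstance]) e := by
    have h1 := condExp_finsetSum (μ := Q) (s := Finset.univ)
      (f := fun i => fun e => v i * X e i) (fun i _ =>
        ((hX i).integrable (by norm_num)).const_mul (v i)) (MeasurableSpace.comap Y inferInstance)
    have h2 : ∀ᵐ e ∂Q, ∀ i,
        (Q[(fun e => v i * X e i) | MeasurableSpace.comap Y inferInstance]) e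
          = v i * (Q[(fun e => X e i) | MeasurableSpace.comap Y inferInstance]) e :=
      ae_all_iff.2 fun i => condExp_mul_of_stronglyMeasurable_left
        (f := fun _ => v i) (g := fun e => X e i) stronglyMeasurable_const
        (((hX i).integrable (by norm_num)).const_mul (v i)) ((hX i).integrable (by norm_num))
    have h3 : (∑ i, fun e => v i * X e i) = fun e => v ⬝ᵥ X e := by
      funext e; simp [dotProduct]
    rw [h3] at h1
    filter_upwards [h1, h2] with e e1 e2
    rw [e1, Finset.sum_apply]
    simp only [e2]
    unfold condErr dotProduct
    simp only [mul_sub, Finset.sum_sub_distrib]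
  have h4 := condExp_congr_ae (μ := Q) (m := MeasurableSpace.comap Y inferInstance) hgae
  rw [condExp_of_stronglyMeasurable hY.comap_le hgmY (hgL.integrable (by norm_num))] at h4
  filter_upwards [hsum, h4, hgae] with e e1 e2 e3
  rw [e1, e2, e3, sub_self]
  simp

end Blank

/-! ### Uniform messages -/

section Uniform

variable {J I A : Type} [Fintype J] [Nonempty J] [MeasurableSpace J] [DiscreteMeasurableSpace J]
  [Fintype I] [MeasurableSpace A]

/-- The uniform law on a finite type. -/
def uniformLaw (J : Type) [Fintype J] [MeasurableSpace J] : Measure J :=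
  (Fintype.card J : ℝ≥0∞)⁻¹ • ∑ j : J, Measure.dirac j

lemma lintegral_uniformLaw (f : J → ℝ≥0∞) :
    ∫⁻ j, f j ∂(uniformLaw J) = (Fintype.card J : ℝ≥0∞)⁻¹ * ∑ j, f j := by
  unfold uniformLaw
  rw [lintegral_smul_measure, lintegral_finsetSum_measure, smul_eq_mul]
  simp_rw [lintegral_dirac]

instance : IsProbabilityMeasure (uniformLaw J) := by
  constructor
  rw [← lintegral_one, lintegral_uniformLaw]
  simp only [Finset.sum_const, Finset.card_univ, nsmul_eq_mul, mul_one]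
  exact ENNReal.inv_mul_cancel (by simp) (by simp)

/-- Replacing part of a uniform message by each of its possible values covers the uniform law
evenly. -/
lemma sum_map_uniformLaw {α : Measure A} [SFinite α] {ψ : I → J → J} {c : ℝ≥0∞}
    (h : ∀ g : J → ℝ≥0∞, ∑ i, ∑ j, g (ψ i j) = c * ∑ j, g j) :
    ∑ i, (α.prod (uniformLaw J)).map (fun q => (q.1, ψ i q.2)) ≤ c • α.prod (uniformLaw J) := by
  refine le_of_eq (Measure.ext_of_lintegral _ fun f hf => ?_)
  have hm : ∀ i, Measurable (ψ i) := fun i => measurable_of_countable _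
  have hψ : ∀ i, Measurable fun q : A × J => (q.1, ψ i q.2) := fun i => by
    have := hm i
    fun_prop
  rw [lintegral_finsetSum_measure, lintegral_smul_measure, smul_eq_mul,
    lintegral_prod _ hf.aemeasurable]
  have e : ∀ i, ∫⁻ q, f q ∂((α.prod (uniformLaw J)).map (fun q => (q.1, ψ i q.2)))
      = ∫⁻ a, ∫⁻ j, f (a, ψ i j) ∂(uniformLaw J) ∂α := fun i => by
    rw [lintegral_map hf (hψ i), lintegral_prod (fun q : A × J => f (q.1, ψ i q.2))
      (hf.comp (hψ i)).aemeasurable]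
  simp_rw [e]
  rw [← lintegral_finsetSum, ← lintegral_const_mul]
  · refine lintegral_congr fun a => ?_
    simp_rw [lintegral_uniformLaw]
    rw [← Finset.mul_sum, h fun j => f (a, j)]
    ring
  · exact hf.lintegral_prod_right'
  · intro i _
    exact (hf.comp (hψ i)).lintegral_prod_right'

/-- The update replaces one part of a uniform message by one of `card I` values. Summing over all
values gives exactly `card I` times the reference, so the divergence is at most log `card I`. -/
lemma klDiv_updateLaw_le [Nonempty I] {E B : Type} [MeasurableSpace E] [MeasurableSpace B]
    {α : Measure A} [IsProbabilityMeasure α] {Q : Measure E} [IsProbabilityMeasure Q] {x : E → B}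
    (hx : Measurable x) {φ : A × J → B → A × J} (hφ : Measurable (Function.uncurry φ))
    {ψ : I → J → J} (hcov : ∀ n a, ∃ i, φ n a = (n.1, ψ i n.2))
    (h : ∀ g : J → ℝ≥0∞, ∑ i, ∑ j, g (ψ i j) = Fintype.card I * ∑ j, g j) :
    updateLaw (α.prod (uniformLaw J)) Q x φ ≪ (α.prod (uniformLaw J)).prod Q ∧
    klDiv (updateLaw (α.prod (uniformLaw J)) Q x φ) ((α.prod (uniformLaw J)).prod Q)
      ≤ ENNReal.ofReal (Real.log (Fintype.card I)) := by
  have hm : ∀ i, Measurable (ψ i) := fun i => measurable_of_countable _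
  have := isProbabilityMeasure_updateLaw (α.prod (uniformLaw J)) Q hx hφ
  have hle := updateLaw_le hx hφ (ψ := fun i (q : A × J) => (q.1, ψ i q.2))
    (fun i => by have := hm i; fun_prop) hcov (sum_map_uniformLaw (α := α) h) (Q := Q)
  refine ⟨(Measure.absolutelyContinuous_of_le hle).trans Measure.smul_absolutelyContinuous,
    klDiv_le_log ?_ ?_⟩
  · exact_mod_cast Fintype.card_pos
  · rwa [ENNReal.ofReal_natCast]

end Uniform

/-! ### The test channel of a code -/

section Test

variable {E : Type} [MeasurableSpace E] {k m la lb n M M₀ : ℕ}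

/-- The message, padded by the message of the auxiliary quantizer. -/
abbrev Message (M M₀ : ℕ) : Type := Fin M × Fin M₀

/-- The block seen off the current index, with the message. -/
abbrev Context (E : Type) (n M M₀ : ℕ) : Type := (Fin n → E) × Message M M₀

/-- Time indices of the code, together with the indices of the quantizer and the blank test. -/
abbrev TestIndex (n : ℕ) : Type := Fin n ⊕ Bool

instance : DiscreteMeasurableSpace (TestIndex n) where
  forall_measurableSet _ :=
    measurableSet_sum_iff.2 ⟨MeasurableSet.of_discrete, MeasurableSet.of_discrete⟩

/-- How the message depends on the current letter. -/
def testUpdate (x : E → Vec k) (f : (Fin n → Vec k) → Fin M) (r : Vec k → Fin M₀) :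
    TestIndex n → Context E n M M₀ → Vec k → Context E n M M₀
  | Sum.inl t => blockUpdate x (fun s j => (f s, j.2)) t
  | Sum.inr true => fun q a => (q.1, (q.2.1, r a))
  | Sum.inr false => fun q _ => q

/-- What both tests observe. -/
def testG (y : E → Vec m) (ya : E → Vec la) :
    TestIndex n → Context E n M M₀ → Message M M₀ × (Fin n → Vec la) × (Fin n → Vec m)
  | Sum.inl t => blockG y ya 0 0 t
  | Sum.inr _ => fun q => (q.2, 0, 0)

/-- What the refined test observes in addition. -/
def testV (x : E → Vec k) (y : E → Vec m) (yb : E → Vec lb) :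
    TestIndex n → Context E n M M₀ → (Fin n → Vec lb) × (Fin n → Vec m) × (Fin n → Vec k)
  | Sum.inl t => blockV x y yb 0 0 0 t
  | Sum.inr _ => fun _ => 0

/-- The weights of the test indices. -/
def testWeight (c l₁ l₂ : ℝ≥0) : TestIndex n → ℝ≥0
  | Sum.inl _ => c
  | Sum.inr true => l₁
  | Sum.inr false => l₂

lemma sum_testWeight {c l₁ l₂ : ℝ≥0} (h : n * c + l₁ + l₂ = 1) :
    ∑ t : TestIndex n, testWeight c l₁ l₂ t = 1 := by
  rw [Fintype.sum_sum_type, Fintype.sum_bool]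
  simp only [testWeight, Finset.sum_const, Finset.card_univ, Fintype.card_fin, nsmul_eq_mul]
  rw [← h, add_assoc]

/-- The law of the context. -/
def contextLaw (Q : Measure E) (n M M₀ : ℕ) : Measure (Context E n M M₀) :=
  (Measure.pi fun _ : Fin n => Q).prod (uniformLaw (Message M M₀))

instance [NeZero M] [NeZero M₀] (Q : Measure E) [IsProbabilityMeasure Q] :
    IsProbabilityMeasure (contextLaw Q n M M₀) := by
  unfold contextLaw; infer_instance

variable {x : E → Vec k} {y : E → Vec m} {ya : E → Vec la} {yb : E → Vec lb}
  {f : (Fin n → Vec k) → Fin M} {r : Vec k → Fin M₀}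

lemma measurable_encoder (hf : Measurable f) : Measurable (Function.uncurry
    fun (s : Fin n → Vec k) (j : Message M M₀) => ((f s, j.2) : Message M M₀)) := by
  unfold Function.uncurry
  fun_prop

lemma measurable_testUpdate (hx : Measurable x) (hf : Measurable f) (hr : Measurable r)
    (t : TestIndex n) : Measurable (Function.uncurry (testUpdate x f r t)) := by
  match t with
  | Sum.inl t => exact measurable_blockUpdate hx (measurable_encoder hf) t
  | Sum.inr true =>
    change Measurable fun p : Context E n M M₀ × Vec k => (p.1.1, (p.1.2.1, r p.2))
    fun_prop
  | Sum.inr false => exact measurable_fst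

lemma measurable_testG (hy : Measurable y) (hya : Measurable ya) (t : TestIndex n) :
    Measurable (testG (M := M) (M₀ := M₀) y ya t) := by
  match t with
  | Sum.inl t => exact measurable_blockG hy hya 0 0 t
  | Sum.inr _ =>
    change Measurable fun q : Context E n M M₀ => (q.2, (0 : Fin n → Vec la), (0 : Fin n → Vec m))
    fun_prop

lemma measurable_testV (hx : Measurable x) (hy : Measurable y) (hyb : Measurable yb)
    (t : TestIndex n) : Measurable (testV (M := M) (M₀ := M₀) x y yb t) := by
  match t with
  | Sum.inl t => exact measurable_blockV hx hy hyb 0 0 0 t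
  | Sum.inr _ => exact measurable_const

/-- The divergence budget of each test. -/
def testBudget (M M₀ : ℕ) : TestIndex n → ℝ≥0∞
  | Sum.inl _ => ENNReal.ofReal (Real.log M)
  | Sum.inr true => ENNReal.ofReal (Real.log M₀)
  | Sum.inr false => 0

lemma testBudget_ne_top (t : TestIndex n) : testBudget M M₀ t ≠ ∞ := by
  match t with
  | Sum.inl _ => exact ENNReal.ofReal_ne_top
  | Sum.inr true => exact ENNReal.ofReal_ne_top
  | Sum.inr false => exact ENNReal.zero_ne_top

/-- Each test rewrites only its own part of the message and leaves the other part uniform, so it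
pays only for the part that it rewrites. -/
lemma klDiv_testUpdate_le [NeZero M] [NeZero M₀] {Q : Measure E} [IsProbabilityMeasure Q]
    (hx : Measurable x) (hf : Measurable f) (hr : Measurable r) (t : TestIndex n) :
    updateLaw (contextLaw Q n M M₀) Q x (testUpdate x f r t) ≪ (contextLaw Q n M M₀).prod Q ∧
    klDiv (updateLaw (contextLaw Q n M M₀) Q x (testUpdate x f r t))
      ((contextLaw Q n M M₀).prod Q) ≤ testBudget M M₀ t := by
  have hφ := measurable_testUpdate hx hf hr t
  match t with
  | Sum.inl t =>
    have := klDiv_updateLaw_le (I := Fin M) (Q := Q) (α := Measure.pi fun _ : Fin n => Q) hx hφ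
      (ψ := fun i j => (i, j.2)) (fun q a => ⟨_, rfl⟩) fun g => by
        simp_rw [Fintype.sum_prod_type]
        rw [Finset.sum_comm]
        simp [Finset.mul_sum]
    rw [Fintype.card_fin] at this
    exact this
  | Sum.inr true =>
    have := klDiv_updateLaw_le (I := Fin M₀) (Q := Q) (α := Measure.pi fun _ : Fin n => Q) hx hφ
      (ψ := fun i j => (j.1, i)) (fun q a => ⟨r a, rfl⟩) fun g => by
        simp_rw [Fintype.sum_prod_type]
        rw [Finset.sum_comm]
        simp [Finset.mul_sum]
    rw [Fintype.card_fin] at this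
    exact this
  | Sum.inr false =>
    have := klDiv_updateLaw_le (I := Unit) (Q := Q) (α := Measure.pi fun _ : Fin n => Q) hx hφ
      (ψ := fun _ j => j) (fun q a => ⟨(), rfl⟩) fun g => by simp
    simp only [Fintype.card_unit, Nat.cast_one, Real.log_one, ENNReal.ofReal_zero] at this
    exact this

/-- The rate of the test channel. -/
theorem test_rate_le [NeZero M] [NeZero M₀] (hn : 0 < n) {Q : Measure E} [IsProbabilityMeasure Q]
    (hx : Measurable x) (hy : Measurable y) (hya : Measurable ya) (hyb : Measurable yb)
    {κ : Kernel (Vec m) (Vec la × Vec lb)} [IsMarkovKernel κ]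
    (hκ : FactorsVia Q x (fun e => (ya e, yb e)) y κ)
    (hf : Measurable f) (hr : Measurable r) {c l₁ l₂ : ℝ≥0} (hp : n * c + l₁ + l₂ = 1)
    {δ₁ δ₂ γ : Type} [MeasurableSpace δ₁] [StandardBorelSpace δ₁] [Nonempty δ₁]
    [MeasurableSpace δ₂] [StandardBorelSpace δ₂] [Nonempty δ₂] [MeasurableSpace γ]
    {w : TestIndex n × Message M M₀ × (Fin n → Vec la) × (Fin n → Vec m) → δ₁} (hw : Measurable w)
    {w' : δ₁ → TestIndex n × Message M M₀ × (Fin n → Vec la) × (Fin n → Vec m)}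
    (hw' : Measurable w') (hww : ∀ z, w' (w z) = z)
    {v : (Fin n → Vec lb) × (Fin n → Vec m) × (Fin n → Vec k) → δ₂} (hv : Measurable v)
    {v' : δ₂ → (Fin n → Vec lb) × (Fin n → Vec m) × (Fin n → Vec k)}
    (hv' : Measurable v') (hvv : ∀ z, v' (v z) = z)
    {e : (TestIndex n × Message M M₀ × (Fin n → Vec la) × (Fin n → Vec m)) × Vec m → γ}
    (he : Measurable e)
    {e' : γ → (TestIndex n × Message M M₀ × (Fin n → Vec la) × (Fin n → Vec m)) × Vec m}
    (he' : Measurable e') (hee : ∀ z, e' (e z) = z)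
    {P : Measure ((TestIndex n × Context E n M M₀) × E)}
    (hP : P = updateLaw ((indexLaw (testWeight c l₁ l₂)).prod (contextLaw Q n M M₀)) Q x
      (fun q a => (q.1, testUpdate x f r q.1 q.2 a))) [IsProbabilityMeasure P] :
    condMutualInfo P (fun q => x q.2) (fun q => w (q.1.1, testG y ya q.1.1 q.1.2))
        (fun q => ya q.2)
      + condMutualInfo P (fun q => x q.2) (fun q => v (testV x y yb q.1.1 q.1.2))
          (fun q => e ((q.1.1, testG y ya q.1.1 q.1.2), y q.2))
      ≤ c * ENNReal.ofReal (Real.log M) + l₁ * ENNReal.ofReal (Real.log M₀) := by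
  set ν := contextLaw Q n M M₀ with hν
  have hφ := measurable_testUpdate (M := M) (M₀ := M₀) hx hf hr
  have hG := measurable_testG (n := n) (M := M) (M₀ := M₀) hy hya
  have hV := measurable_testV (n := n) (M := M) (M₀ := M₀) hx hy hyb
  have hkl := klDiv_testUpdate_le (Q := Q) hx hf hr
  have hpr : ∀ t, IsProbabilityMeasure (updateLaw ν Q x (testUpdate x f r t)) := fun t =>
    isProbabilityMeasure_updateLaw ν Q hx (hφ t)
  have h1 := rate_le_of_index (sum_testWeight hp) ν Q hx hy hya hyb hκ hφ (fun t => (hkl t).1)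
    (fun t => ne_top_of_le_ne_top (testBudget_ne_top t) (hkl t).2) hG hV hw hw' hww hv hv' hvv
    he he' hee hP
  set L : TestIndex n → ℝ≥0∞ := fun t =>
    obsDiv (updateLaw ν Q x (testUpdate x f r t)) (ν.prod Q)
        (fun q => (testG y ya t q.1, testV x y yb t q.1, y q.2, x q.2))
      + obsDiv (updateLaw ν Q x (testUpdate x f r t)) (ν.prod Q)
        (fun q => (testG y ya t q.1, y q.2)) with hL
  set R : TestIndex n → ℝ≥0∞ := fun t =>
    obsDiv (updateLaw ν Q x (testUpdate x f r t)) (ν.prod Q)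
        (fun q => (testG y ya t q.1, ya q.2))
      + obsDiv (updateLaw ν Q x (testUpdate x f r t)) (ν.prod Q)
        (fun q => (testG y ya t q.1, testV x y yb t q.1, y q.2, ya q.2, yb q.2)) with hR
  have hRfin : ∀ t, R t ≠ ∞ := fun t => by
    have hb := ne_top_of_le_ne_top (testBudget_ne_top t) (hkl t).2
    have := hG t
    have := hV t
    refine ENNReal.add_ne_top.2 ⟨ne_top_of_le_ne_top hb (obsDiv_le_klDiv (by fun_prop)),
      ne_top_of_le_ne_top hb (obsDiv_le_klDiv (by fun_prop))⟩
  -- The n time indices share a single budget log M through telescoping; bounding each one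
  -- separately would cost n log M.
  have hcode : ∑ t : Fin n, L (Sum.inl t)
      ≤ ∑ t : Fin n, R (Sum.inl t) + ENNReal.ofReal (Real.log M) :=
    sum_obsDiv_block_le hx hy hya hyb 0 0 0 0 (measurable_encoder hf) _ ENNReal.ofReal_ne_top
      (fun t => (hkl (Sum.inl t)).2) hν hn
  have hother : ∀ b : Bool, L (Sum.inr b) ≤ R (Sum.inr b) + testBudget M M₀ (n := n) (Sum.inr b) :=
    fun b => (obsDiv_index_le hx hy hya hyb (hG _) (hV _)).trans (by gcongr; exact (hkl _).2)
  have hsplit : ∀ S : TestIndex n → ℝ≥0∞, ∑ t, (testWeight c l₁ l₂ t : ℝ≥0∞) * S t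
      = c * ∑ t : Fin n, S (Sum.inl t) + (l₁ * S (Sum.inr true) + l₂ * S (Sum.inr false)) := by
    intro S
    rw [Fintype.sum_sum_type, Fintype.sum_bool, Finset.mul_sum]
    rfl
  have hfin : ∑ t, (testWeight c l₁ l₂ t : ℝ≥0∞) * R t ≠ ∞ :=
    (ENNReal.sum_lt_top.2 fun t _ => ENNReal.mul_lt_top (by simp) (hRfin t).lt_top).ne
  refine (ENNReal.add_le_add_iff_right hfin).1 (h1.trans ?_)
  change ∑ t, (testWeight c l₁ l₂ t : ℝ≥0∞) * L t ≤ _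
  rw [hsplit, hsplit]
  calc _ ≤ c * (∑ t : Fin n, R (Sum.inl t) + ENNReal.ofReal (Real.log M))
        + (l₁ * (R (Sum.inr true) + ENNReal.ofReal (Real.log M₀))
          + l₂ * (R (Sum.inr false) + 0)) := by
        gcongr
        · exact hother true
        · exact hother false
    _ = _ := by ring

end Test

/-! ### Scalar bounds for matrices -/

section ScalarBounds

variable {k k₀ : ℕ}

lemma smul_one_transpose (s : ℝ) :
    (s • (1 : Matrix (Fin k) (Fin k) ℝ))ᵀ = s • (1 : Matrix (Fin k) (Fin k) ℝ) := by
  rw [Matrix.transpose_smul, Matrix.transpose_one]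

lemma quad_smul_one (s : ℝ) (v : Vec k) :
    v ⬝ᵥ ((s • (1 : Matrix (Fin k) (Fin k) ℝ)) *ᵥ v) = s * (v ⬝ᵥ v) := by
  rw [Matrix.smul_mulVec, Matrix.one_mulVec, dotProduct_smul, smul_eq_mul]

lemma posSemidef_smul_one {s : ℝ} (hs : 0 ≤ s) :
    (s • (1 : Matrix (Fin k) (Fin k) ℝ)).PosSemidef :=
  Matrix.PosSemidef.one.smul hs

lemma exists_smul_one_sub_posSemidef {A : Matrix (Fin k) (Fin k) ℝ} (hA : A.PosSemidef) :
    ∃ s : ℝ, 0 < s ∧ (s • (1 : Matrix (Fin k) (Fin k) ℝ) - A).PosSemidef := by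
  set s : ℝ := ∑ i, ∑ j, |A i j| + 1 with hs
  have hs0 : 0 < s := by positivity
  refine ⟨s, hs0, posSemidef_of_quad (by rw [Matrix.transpose_sub, smul_one_transpose,
    transpose_eq_of_posSemidef hA]) fun v => ?_⟩
  rw [Matrix.sub_mulVec, dotProduct_sub, quad_smul_one, sub_nonneg]
  have hv : ∀ i, v i ^ 2 ≤ v ⬝ᵥ v := fun i => by
    rw [sq]
    exact Finset.single_le_sum (f := fun i => v i * v i) (fun i _ => mul_self_nonneg _)
      (Finset.mem_univ i)
  have hvv : 0 ≤ v ⬝ᵥ v := Finset.sum_nonneg fun i _ => mul_self_nonneg _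
  have hij : ∀ i j, v i * (A i j * v j) ≤ |A i j| * (v ⬝ᵥ v) := fun i j => by
    calc v i * (A i j * v j) ≤ |v i * (A i j * v j)| := le_abs_self _
      _ = |A i j| * (|v i| * |v j|) := by rw [abs_mul, abs_mul]; ring
      _ ≤ |A i j| * (v ⬝ᵥ v) := by
        gcongr
        nlinarith [hv i, hv j, sq_abs (v i), sq_abs (v j), sq_nonneg (|v i| - |v j|)]
  calc v ⬝ᵥ (A *ᵥ v) = ∑ i, ∑ j, v i * (A i j * v j) := by
        simp_rw [dotProduct, Matrix.mulVec, dotProduct, Finset.mul_sum]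
    _ ≤ ∑ i, ∑ j, |A i j| * (v ⬝ᵥ v) :=
        Finset.sum_le_sum fun i _ => Finset.sum_le_sum fun j _ => hij i j
    _ = (s - 1) * (v ⬝ᵥ v) := by simp_rw [hs, ← Finset.sum_mul]; ring
    _ ≤ s * (v ⬝ᵥ v) := by gcongr; linarith

/-- An upper scalar bound for `D⁻¹` inverts to a lower scalar bound for `D`. -/
lemma exists_sub_smul_one_posSemidef {D : Matrix (Fin k) (Fin k) ℝ} (hD : D.PosDef) :
    ∃ d : ℝ, 0 < d ∧ (D - d • (1 : Matrix (Fin k) (Fin k) ℝ)).PosSemidef := by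
  obtain ⟨s, hs, h⟩ := exists_smul_one_sub_posSemidef hD.inv.posSemidef
  refine ⟨s⁻¹, inv_pos.2 hs, ?_⟩
  have h1 := inv_sub_inv_posSemidef hD.inv h
  have h2 : (s • (1 : Matrix (Fin k) (Fin k) ℝ))⁻¹ = s⁻¹ • (1 : Matrix (Fin k) (Fin k) ℝ) := by
    refine Matrix.inv_eq_left_inv ?_
    rw [smul_mul_smul_comm, one_mul, inv_mul_cancel₀ hs.ne', one_smul]
  rwa [Matrix.nonsing_inv_nonsing_inv _ ((Matrix.isUnit_iff_isUnit_det _).1 hD.isUnit), h2] at h1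

lemma smul_one_sub_posSemidef_mono {A : Matrix (Fin k) (Fin k) ℝ} {s s' : ℝ} (h : s ≤ s')
    (hA : (s • (1 : Matrix (Fin k) (Fin k) ℝ) - A).PosSemidef) :
    (s' • (1 : Matrix (Fin k) (Fin k) ℝ) - A).PosSemidef := by
  refine posSemidef_sub_trans hA ?_
  rw [← sub_smul]
  exact posSemidef_smul_one (by linarith)

lemma sub_smul_one_posSemidef_mono {A : Matrix (Fin k) (Fin k) ℝ} {s s' : ℝ} (h : s' ≤ s)
    (hA : (A - s • (1 : Matrix (Fin k) (Fin k) ℝ)).PosSemidef) :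
    (A - s' • (1 : Matrix (Fin k) (Fin k) ℝ)).PosSemidef := by
  refine posSemidef_sub_trans ?_ hA
  rw [← sub_smul]
  exact posSemidef_smul_one (by linarith)

lemma smul_one_sub_toLin_posSemidef (Γ : DistortionMap k k₀) {A : Matrix (Fin k) (Fin k) ℝ}
    (hA : A.PosSemidef) {s γ : ℝ} (hs : 0 ≤ s)
    (hsA : (s • (1 : Matrix (Fin k) (Fin k) ℝ) - A).PosSemidef)
    (hγ : (γ • (1 : Matrix (Fin k₀) (Fin k₀) ℝ) - Γ.toLin 1).PosSemidef) :
    ((s * γ) • (1 : Matrix (Fin k₀) (Fin k₀) ℝ) - Γ.toLin A).PosSemidef := by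
  have h1 := Γ.mono A _ hA (posSemidef_smul_one hs) hsA
  rw [map_smul] at h1
  refine posSemidef_sub_trans h1 ?_
  rw [mul_smul, ← smul_sub]
  exact hγ.smul hs

/-- The distortion budget of a mixture of a block code, a fine quantizer and a blank test. -/
lemma mixture_distortion_budget {D S A B : Matrix (Fin k) (Fin k) ℝ} {n : ℕ} (hn : 0 < n)
    {c l₁ l₂ : ℝ≥0} (hp : n * c + l₁ + l₂ = 1) {d g ε : ℝ} (hd : 0 ≤ d) (hε : 0 ≤ ε)
    (hD : (D - d • (1 : Matrix (Fin k) (Fin k) ℝ)).PosSemidef)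
    (hS : (D + ε • (1 : Matrix (Fin k) (Fin k) ℝ) - (1 / (n : ℝ)) • S).PosSemidef)
    (hA : ((d / 2) • (1 : Matrix (Fin k) (Fin k) ℝ) - A).PosSemidef)
    (hB : (g • (1 : Matrix (Fin k) (Fin k) ℝ) - B).PosSemidef)
    (h : ε + l₂ * g ≤ l₁ * d / 2) :
    (D - ((c : ℝ) • S + ((l₁ : ℝ) • A + (l₂ : ℝ) • B))).PosSemidef := by
  have hp' : (n : ℝ) * c + l₁ + l₂ = 1 := by exact_mod_cast hp
  have hn' : (n : ℝ) ≠ 0 := by positivity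
  -- The scalar left over after the slacks of code, quantizer and blank test are weighted by n c, l₁
  -- and l₂ and the slack D - dI by l₁ + l₂. Nonnegative because the gain l₁ d / 2 of the quantizer
  -- covers both ε and the blank loss l₂ g.
  have hκ : 0 ≤ (l₁ : ℝ) * d / 2 + l₂ * d - l₂ * g - n * c * ε := by
    have h1 : (n : ℝ) * c ≤ 1 := by
      have := l₁.2
      have := l₂.2
      linarith [l₁.coe_nonneg, l₂.coe_nonneg]
    have h2 : (n : ℝ) * c * ε ≤ ε := by nlinarith
    have h3 : 0 ≤ (l₂ : ℝ) * d := by positivity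
    linarith
  have hsum := ((hS.smul (show (0 : ℝ) ≤ n * c by positivity)).add
    (hD.smul (show (0 : ℝ) ≤ l₁ + l₂ by positivity))).add
    ((hA.smul l₁.coe_nonneg).add ((hB.smul l₂.coe_nonneg).add (posSemidef_smul_one hκ)))
  convert hsum using 1
  ext i j
  simp only [Matrix.sub_apply, Matrix.add_apply, Matrix.smul_apply, smul_eq_mul]
  have e1 : (n : ℝ) * c * (1 / n * S i j) = c * S i j := by field_simp
  rw [show (n : ℝ) * c * (D i j + ε * (1 : Matrix (Fin k) (Fin k) ℝ) i j - 1 / n * S i j)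
    = n * c * (D i j + ε * (1 : Matrix (Fin k) (Fin k) ℝ) i j) - n * c * (1 / n * S i j) by ring, e1]
  linear_combination (-(D i j)) * hp'

end ScalarBounds

/-! ### Quantization -/

/-- A square-integrable vector is approximated in mean square by finitely many values. -/
lemma exists_quantizer {Ω : Type} [MeasurableSpace Ω] {μ : Measure Ω} [IsProbabilityMeasure μ]
    {k : ℕ} {X : Ω → Vec k} (hXm : Measurable X) (hX : ∀ i, MemLp (fun ω => X ω i) 2 μ) {η : ℝ}
    (hη : 0 < η) :
    ∃ (M : ℕ) (_ : NeZero M) (r : Vec k → Fin M) (v : Fin M → Vec k), Measurable r ∧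
      (∀ i, MemLp (fun ω => (X ω - v (r (X ω))) i) 2 μ) ∧
      (η • (1 : Matrix (Fin k) (Fin k) ℝ)
        - secondMoment μ (fun ω => X ω - v (r (X ω)))).PosSemidef := by
  have hXL : MemLp X 2 μ := MemLp.of_eval hX
  have hid : MemLp (id : Vec k → Vec k) 2 (μ.map X) :=
    (memLp_map_measure_iff (by fun_prop) hXm.aemeasurable).2 hXL
  -- The factor k from comparing the sum of squares with the squared sup norm is absorbed here; the
  -- `+ 1` covers k = 0.
  set ζ : ℝ := η / (k + 1) with hζ
  have hζ0 : 0 < ζ := by positivity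
  obtain ⟨g, hg, hgL⟩ := hid.exists_simpleFunc_eLpNorm_sub_lt (by norm_num)
    (ε := ENNReal.ofReal (Real.sqrt ζ)) (by simpa using hζ0)
  have hne : g.range.Nonempty := ⟨g 0, g.mem_range_self 0⟩
  have hcard : NeZero g.range.card := ⟨hne.card_ne_zero⟩
  set eqv := g.range.equivFin
  have hv : ∀ a, ((eqv.symm (eqv ⟨g a, g.mem_range_self a⟩)) : Vec k) = g a := fun a => by simp
  have herr : MemLp (fun ω => X ω - g (X ω)) 2 μ :=
    (memLp_map_measure_iff (hid.sub hgL).1 hXm.aemeasurable).1 (hid.sub hgL)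
  refine ⟨g.range.card, hcard, fun a => eqv ⟨g a, g.mem_range_self a⟩, fun j => eqv.symm j, ?_, ?_,
    ?_⟩
  · refine measurable_to_countable' fun j => ?_
    have : (fun a => eqv ⟨g a, g.mem_range_self a⟩) ⁻¹' {j} = g ⁻¹' {((eqv.symm j : _) : Vec k)} := by
      ext a
      simp only [Set.mem_preimage, Set.mem_singleton_iff]
      rw [← Equiv.eq_symm_apply, Subtype.ext_iff]
    rw [this]
    exact g.measurableSet_fiber _
  · intro i
    simp only [hv]
    exact herr.eval i
  simp only [hv]
  have hei : ∀ i, MemLp (fun ω => (X ω - g (X ω)) i) 2 μ := fun i => herr.eval i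
  have hint : ∫ ω, ‖X ω - g (X ω)‖ ^ 2 ∂μ ≤ ζ := by
    have h1 : eLpNorm (fun ω => X ω - g (X ω)) 2 μ < ENNReal.ofReal (Real.sqrt ζ) := by
      rw [eLpNorm_map_measure (hid.sub hgL).1 hXm.aemeasurable] at hg
      exact hg
    rw [herr.eLpNorm_eq_integral_rpow_norm (by norm_num) (by norm_num)] at h1
    have h2 := (ENNReal.ofReal_lt_ofReal_iff (Real.sqrt_pos.2 hζ0)).1 h1
    simp only [ENNReal.toReal_ofNat, Real.rpow_two] at h2
    rw [show ((2 : ℝ)⁻¹) = 1 / 2 by norm_num, ← Real.sqrt_eq_rpow] at h2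
    exact ((Real.sqrt_lt_sqrt_iff (integral_nonneg fun ω => by positivity)).1 h2).le
  refine posSemidef_of_quad (by rw [Matrix.transpose_sub, smul_one_transpose,
    secondMoment_transpose]) fun w => ?_
  rw [Matrix.sub_mulVec, dotProduct_sub, quad_smul_one, sub_nonneg, quad_secondMoment hei]
  have hww : 0 ≤ w ⬝ᵥ w := Finset.sum_nonneg fun i _ => mul_self_nonneg _
  have hpt : ∀ ω, (w ⬝ᵥ (X ω - g (X ω))) ^ 2 ≤ (w ⬝ᵥ w) * k * ‖X ω - g (X ω)‖ ^ 2 := by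
    intro ω
    have h1 := Finset.sum_mul_sq_le_sq_mul_sq Finset.univ w (X ω - g (X ω))
    have h2 : ∑ i, (X ω - g (X ω)) i ^ 2 ≤ k * ‖X ω - g (X ω)‖ ^ 2 := by
      calc ∑ i, (X ω - g (X ω)) i ^ 2 ≤ ∑ _i : Fin k, ‖X ω - g (X ω)‖ ^ 2 := by
            refine Finset.sum_le_sum fun i _ => ?_
            rw [← sq_abs]
            have := norm_le_pi_norm (X ω - g (X ω)) i
            rw [Real.norm_eq_abs] at this
            gcongr
        _ = _ := by simp
    have h3 : ∑ i, w i ^ 2 = w ⬝ᵥ w := Finset.sum_congr rfl fun i _ => sq _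
    rw [h3] at h1
    calc _ ≤ (w ⬝ᵥ w) * ∑ i, (X ω - g (X ω)) i ^ 2 := h1
      _ ≤ (w ⬝ᵥ w) * (k * ‖X ω - g (X ω)‖ ^ 2) := by gcongr
      _ = _ := by ring
  calc ∫ ω, (w ⬝ᵥ (X ω - g (X ω))) ^ 2 ∂μ
      ≤ ∫ ω, (w ⬝ᵥ w) * k * ‖X ω - g (X ω)‖ ^ 2 ∂μ :=
        integral_mono (memLp_dotProduct hei w).integrable_sq
          ((herr.norm.integrable_sq).const_mul _) hpt
    _ = (w ⬝ᵥ w) * k * ∫ ω, ‖X ω - g (X ω)‖ ^ 2 ∂μ := integral_const_mul _ _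
    _ ≤ (w ⬝ᵥ w) * k * ζ := by gcongr
    _ = (w ⬝ᵥ w) * (k * ζ) := by ring
    _ ≤ (w ⬝ᵥ w) * η := by
        gcongr
        rw [hζ, mul_div_assoc', div_le_iff₀ (by positivity)]
        nlinarith
    _ = _ := mul_comm _ _

/-! ### Integrals over an indexed product -/

section IndexIntegral

variable {ι N E : Type} [Fintype ι] [MeasurableSpace ι] [DiscreteMeasurableSpace ι]
  [MeasurableSpace N] [MeasurableSpace E] (p : ι → ℝ≥0) (ν : Measure N) [IsProbabilityMeasure ν]
  (Q : Measure E) [IsProbabilityMeasure Q]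

lemma indexLaw_prod_prod :
    ((indexLaw p).prod ν).prod Q = (mixture p fun _ => ν.prod Q).map
      (MeasurableEquiv.prodAssoc (α := ι) (β := N) (γ := E)).symm := by
  have hs : SFinite (indexLaw p) := by unfold indexLaw; infer_instance
  rw [prod_prod_eq_map, indexLaw_prod]
  rfl

variable {p ν Q}

lemma integrable_mixture {F : ι → N × E → ℝ} (hF : ∀ t, Integrable (F t) (ν.prod Q)) :
    Integrable (fun q : ι × N × E => F q.1 q.2) (mixture p fun _ => ν.prod Q) := by
  unfold mixture
  refine integrable_finsetSum_measure.2 fun t _ => Integrable.smul_measure_nnreal ?_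
  rw [(measurableEmbedding_prodMk_left t).integrable_map_iff]
  exact hF t

lemma integrable_index {F : ι → N × E → ℝ} (hF : ∀ t, Integrable (F t) (ν.prod Q)) :
    Integrable (fun q : (ι × N) × E => F q.1.1 (q.1.2, q.2)) (((indexLaw p).prod ν).prod Q) := by
  rw [indexLaw_prod_prod, integrable_map_equiv]
  exact integrable_mixture hF

lemma integral_index {F : ι → N × E → ℝ} (hF : ∀ t, Integrable (F t) (ν.prod Q)) :
    ∫ q : (ι × N) × E, F q.1.1 (q.1.2, q.2) ∂(((indexLaw p).prod ν).prod Q)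
      = ∑ t, (p t : ℝ) * ∫ r, F t r ∂(ν.prod Q) := by
  have h := integrable_mixture (p := p) hF
  rw [indexLaw_prod_prod, integral_map_equiv]
  change ∫ q : ι × N × E, F q.1 q.2 ∂(mixture p fun _ => ν.prod Q) = _
  unfold mixture at h ⊢
  rw [integral_finsetSum_measure (integrable_finsetSum_measure.1 h)]
  refine Finset.sum_congr rfl fun t _ => ?_
  rw [integral_smul_nnreal_measure, (measurableEmbedding_prodMk_left t).integral_map]
  rfl

/-- An estimator that works index by index bounds the conditional covariance. -/
lemma index_estimator {k k₀ : ℕ} (Γ : DistortionMap k k₀) (hp : ∑ t, p t = 1) {β : Type}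
    [MeasurableSpace β] {X : E → Vec k}
    (hX : ∀ i, MemLp (fun e => X e i) 2 Q) {Z : (ι × N) × E → β} (hZ : Measurable Z)
    {h : β → Vec k} (hh : Measurable h) {err : ι → N × E → Vec k}
    (he : ∀ q, X q.2 - h (Z q) = err q.1.1 (q.1.2, q.2))
    (hint : ∀ t a b, Integrable (fun r => errorDistortion Γ (err t r) a b) (ν.prod Q)) :
    ((∑ t, (p t : ℝ) • meanDistortion (ν.prod Q) Γ (err t))
      - Γ.toLin (condCov (((indexLaw p).prod ν).prod Q) (fun q => X q.2) Z)).PosSemidef := by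
  have hip := isProbabilityMeasure_indexLaw hp
  have hmp : MeasurePreserving (Prod.snd : (ι × N) × E → E) (((indexLaw p).prod ν).prod Q) Q :=
    ⟨measurable_snd, map_snd_prod_eq _ Q⟩
  have h1 := meanDistortion_sub_condCov_posSemidef (μ := ((indexLaw p).prod ν).prod Q) Γ
    (X := fun q => X q.2) (fun i => (hX i).comp_measurePreserving hmp) hZ hh (fun a b => by
      simp_rw [he]
      exact integrable_index (F := fun t r => errorDistortion Γ (err t r) a b)
        fun t => hint t a b)
  have h2 : meanDistortion (((indexLaw p).prod ν).prod Q) Γ (fun q => X q.2 - h (Z q))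
      = ∑ t, (p t : ℝ) • meanDistortion (ν.prod Q) Γ (err t) := by
    ext a b
    simp only [meanDistortion, Matrix.of_apply, Matrix.sum_apply, Matrix.smul_apply, smul_eq_mul]
    simp_rw [he]
    exact integral_index (F := fun t r => errorDistortion Γ (err t r) a b) fun t => hint t a b
  rwa [h2] at h1

end IndexIntegral

/-! ### Distortion constraints along measure preserving maps -/

section Distortion

variable {Ω Ω' : Type} [MeasurableSpace Ω] [MeasurableSpace Ω'] {k k₀ n : ℕ}
  {μ : Measure Ω} {μ' : Measure Ω'} {φ : Ω → Ω'}

lemma integral_comp_measurePreserving (hφ : MeasurePreserving φ μ μ') {F : Ω' → ℝ}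
    (hF : AEStronglyMeasurable F μ') : ∫ ω, F (φ ω) ∂μ = ∫ ω, F ω ∂μ' := by
  have h := integral_map (μ := μ) hφ.measurable.aemeasurable (f := F) (by rwa [hφ.map_eq])
  rw [← h, hφ.map_eq]

lemma meanDistortion_comp (Γ : DistortionMap k k₀) (hφ : MeasurePreserving φ μ μ')
    {e : Ω' → Vec k} (he : ∀ a b, Integrable (fun ω => errorDistortion Γ (e ω) a b) μ') :
    meanDistortion μ Γ (fun ω => e (φ ω)) = meanDistortion μ' Γ e := by
  ext a b
  exact integral_comp_measurePreserving hφ (he a b).1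

lemma MeetsDistortion.comp {Γ : DistortionMap k k₀} {D : Matrix (Fin k₀) (Fin k₀) ℝ}
    {x xhat : Ω' → Fin n → Vec k} (h : MeetsDistortion μ' Γ D x xhat)
    (hφ : MeasurePreserving φ μ μ') :
    MeetsDistortion μ Γ D (fun ω => x (φ ω)) (fun ω => xhat (φ ω)) := by
  refine ⟨fun t a b => hφ.integrable_comp_of_integrable (h.1 t a b), ?_⟩
  convert h.2 using 2
  ext a b
  have hi : Integrable (fun ω => ((1 / (n : ℝ)) •
      ∑ t, errorDistortion Γ (x ω t - xhat ω t)) a b) μ' := by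
    simp only [Matrix.smul_apply, Matrix.sum_apply, smul_eq_mul]
    exact (integrable_finsetSum _ fun t _ => h.1 t a b).const_mul _
  exact integral_comp_measurePreserving hφ hi.1

lemma MeetsDistortion.sub_sum_posSemidef {Γ : DistortionMap k k₀}
    {D : Matrix (Fin k₀) (Fin k₀) ℝ} {x xhat : Ω → Fin n → Vec k}
    (h : MeetsDistortion μ Γ D x xhat) :
    (D - (1 / (n : ℝ)) • ∑ t, meanDistortion μ Γ fun ω => x ω t - xhat ω t).PosSemidef := by
  convert h.2 using 2
  ext a b
  simp only [Matrix.smul_apply, Matrix.sum_apply, smul_eq_mul, Matrix.of_apply, meanDistortion]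
  rw [integral_const_mul, integral_finsetSum _ fun t _ => h.1 t a b]

end Distortion

/-! ### Distortion of the test channel -/

lemma comp_update {E β : Type} {n : ℕ} (z : E → β) (s : Fin n → E) (t : Fin n) (e : E) :
    (fun i => z (Function.update s t e i)) = Function.update (fun i => z (s i)) t (z e) := by
  funext i
  by_cases hi : i = t
  · subst hi; simp
  · simp [Function.update_of_ne hi]

lemma update_hideAt {β : Type} {n : ℕ} (t : Fin n) (b c : β) (s : Fin n → β) :
    Function.update (hideAt t b s) t c = Function.update s t c := by
  funext i
  by_cases hi : i = t
  · subst hi; simp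
  · simp [hideAt, hi]

section TestDistortion

variable {E : Type} [MeasurableSpace E] {k k₀ l m la lb n M M₀ : ℕ}

/-- Putting the true letter at `t` into the stale block gives an i.i.d. block, so the code's
distortion at time `t` is the distortion of the test `t`. -/
lemma measurePreserving_update [NeZero M] [NeZero M₀] (Q : Measure E) [IsProbabilityMeasure Q]
    (t : Fin n) : MeasurePreserving (fun q : Context E n M M₀ × E => Function.update q.1.1 t q.2)
      ((contextLaw Q n M M₀).prod Q) (Measure.pi fun _ : Fin n => Q) := by
  have hm := measurable_update_pair (α := E) t
  refine ⟨hm.comp (show Measurable fun q : Context E n M M₀ × E => (q.1.1, q.2) by fun_prop), ?_⟩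
  have h1 : ((contextLaw Q n M M₀).prod Q).map (fun q => (q.1.1, q.2))
      = (Measure.pi fun _ : Fin n => Q).prod Q := by
    have := Measure.map_prod_map (contextLaw Q n M M₀) Q
      (measurable_fst (α := Fin n → E) (β := Message M M₀)) measurable_id
    rw [Measure.map_id, contextLaw, Measure.map_fst_prod, measure_univ, one_smul] at this
    exact this.symm
  rw [← map_update_pi Q t, ← h1, Measure.map_map hm (by fun_prop)]
  rfl

/-- The reconstruction errors of the tests, for a decoder with side information `z`. -/
def testErr (x : E → Vec k) (z : E → Vec l) (f : (Fin n → Vec k) → Fin M) (r : Vec k → Fin M₀)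
    (v : Fin M₀ → Vec k) (g : Fin M × (Fin n → Vec l) → Fin n → Vec k) :
    TestIndex n → Context E n M M₀ × E → Vec k
  | Sum.inl t => fun q => x q.2 - g (f (Function.update (fun i => x (q.1.1 i)) t (x q.2)),
      Function.update (fun i => z (q.1.1 i)) t (z q.2)) t
  | Sum.inr true => fun q => x q.2 - v (r (x q.2))
  | Sum.inr false => fun q => x q.2

theorem test_distortion [NeZero M] [NeZero M₀] (hn : 0 < n) {Q : Measure E}
    [IsProbabilityMeasure Q] {x : E → Vec k} {z : E → Vec l} {f : (Fin n → Vec k) → Fin M}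
    {r : Vec k → Fin M₀} {v : Fin M₀ → Vec k} {g : Fin M × (Fin n → Vec l) → Fin n → Vec k}
    (hx : ∀ i, MemLp (fun e => x e i) 2 Q)
    (hv : ∀ i, MemLp (fun e => (x e - v (r (x e))) i) 2 Q) {Γ : DistortionMap k k₀}
    {D : Matrix (Fin k₀) (Fin k₀) ℝ} {c l₁ l₂ : ℝ≥0} (hp : n * c + l₁ + l₂ = 1) {d γ ε : ℝ}
    (hd : 0 ≤ d) (hε : 0 ≤ ε) (hD : (D - d • (1 : Matrix (Fin k₀) (Fin k₀) ℝ)).PosSemidef)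
    (hmeets : MeetsDistortion (Measure.pi fun _ : Fin n => Q) Γ (D + ε • 1)
      (fun s t => x (s t)) (fun s => g (f fun t => x (s t), fun t => z (s t))))
    (hA : ((d / 2) • (1 : Matrix (Fin k₀) (Fin k₀) ℝ)
      - Γ.toLin (secondMoment Q fun e => x e - v (r (x e)))).PosSemidef)
    (hB : (γ • (1 : Matrix (Fin k₀) (Fin k₀) ℝ) - Γ.toLin (secondMoment Q x)).PosSemidef)
    (h : ε + l₂ * γ ≤ l₁ * d / 2) :
    (∀ t a b, Integrable (fun q => errorDistortion Γ (testErr x z f r v g t q) a b)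
        ((contextLaw Q n M M₀).prod Q)) ∧
      (D - ∑ t, (testWeight c l₁ l₂ t : ℝ) •
        meanDistortion ((contextLaw Q n M M₀).prod Q) Γ (testErr x z f r v g t)).PosSemidef := by
  have hsnd : MeasurePreserving (Prod.snd : Context E n M M₀ × E → E)
      ((contextLaw Q n M M₀).prod Q) Q := ⟨measurable_snd, map_snd_prod_eq _ Q⟩
  have herr : ∀ t : Fin n, testErr x z f r v g (M₀ := M₀) (Sum.inl t)
      = fun q => (fun s : Fin n → E => x (s t)
        - g (f fun t => x (s t), fun t => z (s t)) t) (Function.update q.1.1 t q.2) := by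
    intro t
    funext q
    simp only [testErr, comp_update, Function.update_self]
  have hiA := integrable_errorDistortion Γ hv
  have hiB := integrable_errorDistortion Γ hx
  have m1 : ∀ t : Fin n, meanDistortion ((contextLaw Q n M M₀).prod Q) Γ
      (testErr x z f r v g (Sum.inl t)) = meanDistortion (Measure.pi fun _ : Fin n => Q) Γ
        (fun s => x (s t) - g (f fun t => x (s t), fun t => z (s t)) t) := fun t => by
    rw [herr]
    exact meanDistortion_comp Γ (measurePreserving_update Q t) (hmeets.1 t)
  have m2 : meanDistortion ((contextLaw Q n M M₀).prod Q) Γ (testErr x z f r v g (Sum.inr true))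
      = Γ.toLin (secondMoment Q fun e => x e - v (r (x e))) := by
    rw [← meanDistortion_eq Γ hv]
    exact meanDistortion_comp Γ hsnd hiA
  have m3 : meanDistortion ((contextLaw Q n M M₀).prod Q) Γ (testErr x z f r v g (Sum.inr false))
      = Γ.toLin (secondMoment Q x) := by
    rw [← meanDistortion_eq Γ hx]
    exact meanDistortion_comp Γ hsnd hiB
  refine ⟨fun t a b => ?_, ?_⟩
  · match t with
    | Sum.inl t =>
      rw [herr]
      exact (measurePreserving_update Q t).integrable_comp_of_integrable (hmeets.1 t a b)
    | Sum.inr true => exact hsnd.integrable_comp_of_integrable (hiA a b)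
    | Sum.inr false => exact hsnd.integrable_comp_of_integrable (hiB a b)
  · rw [Fintype.sum_sum_type, Fintype.sum_bool, m2, m3]
    simp_rw [m1]
    simp only [testWeight]
    rw [← Finset.smul_sum]
    exact mixture_distortion_budget hn hp hd hε hD hmeets.sub_sum_posSemidef hA hB h

/-- The estimator of the decoder that observes the context shown to both tests. -/
def decodeG (v : Fin M₀ → Vec k) (g : Fin M × (Fin n → Vec la) → Fin n → Vec k) :
    TestIndex n → (Message M M₀ × (Fin n → Vec la) × (Fin n → Vec m)) × Vec la → Vec k
  | Sum.inl t => fun z => g (z.1.1.1, Function.update z.1.2.1 t z.2) t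
  | Sum.inr true => fun z => v z.1.1.2
  | Sum.inr false => fun _ => 0

/-- The estimator of the decoder that observes the context of the refined test. -/
def decodeV (v : Fin M₀ → Vec k) (g : Fin M × (Fin n → Vec lb) → Fin n → Vec k) :
    TestIndex n → ((Message M M₀ × (Fin n → Vec la) × (Fin n → Vec m))
      × (Fin n → Vec lb) × (Fin n → Vec m) × (Fin n → Vec k)) × Vec lb → Vec k
  | Sum.inl t => fun z => g (z.1.1.1.1, Function.update z.1.2.1 t z.2) t
  | Sum.inr true => fun z => v z.1.1.1.2
  | Sum.inr false => fun _ => 0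

lemma measurable_decodeG (v : Fin M₀ → Vec k) {g : Fin M × (Fin n → Vec la) → Fin n → Vec k}
    (hg : Measurable g) (t : TestIndex n) : Measurable (decodeG (m := m) v g t) := by
  match t with
  | Sum.inl t =>
    have h1 : Measurable fun z : (Message M M₀ × (Fin n → Vec la) × (Fin n → Vec m)) × Vec la =>
        Function.update z.1.2.1 t z.2 := (measurable_update_pair t).comp
      (show Measurable fun z : (Message M M₀ × (Fin n → Vec la) × (Fin n → Vec m)) × Vec la =>
        (z.1.2.1, z.2) by fun_prop)
    exact (measurable_pi_apply t).comp (hg.comp (measurable_fst.fst.fst.prodMk h1))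
  | Sum.inr true => exact (measurable_of_countable v).comp measurable_fst.fst.snd
  | Sum.inr false => exact measurable_const

lemma measurable_decodeV (v : Fin M₀ → Vec k) {g : Fin M × (Fin n → Vec lb) → Fin n → Vec k}
    (hg : Measurable g) (t : TestIndex n) :
    Measurable (decodeV (m := m) (la := la) v g t) := by
  match t with
  | Sum.inl t =>
    have h1 : Measurable fun z : ((Message M M₀ × (Fin n → Vec la) × (Fin n → Vec m))
        × (Fin n → Vec lb) × (Fin n → Vec m) × (Fin n → Vec k)) × Vec lb =>
        Function.update z.1.2.1 t z.2 := (measurable_update_pair t).comp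
      (show Measurable fun z : ((Message M M₀ × (Fin n → Vec la) × (Fin n → Vec m))
        × (Fin n → Vec lb) × (Fin n → Vec m) × (Fin n → Vec k)) × Vec lb =>
        (z.1.2.1, z.2) by fun_prop)
    exact (measurable_pi_apply t).comp (hg.comp (measurable_fst.fst.fst.fst.prodMk h1))
  | Sum.inr true => exact (measurable_of_countable v).comp measurable_fst.fst.fst.snd
  | Sum.inr false => exact measurable_const

variable {x : E → Vec k} {y : E → Vec m} {ya : E → Vec la} {yb : E → Vec lb}
  {f : (Fin n → Vec k) → Fin M} {r : Vec k → Fin M₀}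

/-- The coordinate hidden at `t` is the one that decoder a fills with its own current side
information, so its reconstruction from `G` and `ya` is that of the code. -/
lemma sub_decodeG (v : Fin M₀ → Vec k) (g : Fin M × (Fin n → Vec la) → Fin n → Vec k)
    (t : TestIndex n) (q : Context E n M M₀) (e : E) :
    x e - decodeG v g t (testG y ya t (testUpdate x f r t q (x e)), ya e)
      = testErr x ya f r v g t (q, e) := by
  match t with
  | Sum.inl t => simp only [decodeG, testG, blockG, testUpdate, blockUpdate, testErr, update_hideAt]
  | Sum.inr true => rfl
  | Sum.inr false => exact sub_zero _

lemma sub_decodeV (v : Fin M₀ → Vec k) (g : Fin M × (Fin n → Vec lb) → Fin n → Vec k)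
    (t : TestIndex n) (q : Context E n M M₀) (e : E) :
    x e - decodeV v g t ((testG y ya t (testUpdate x f r t q (x e)),
        testV x y yb t (testUpdate x f r t q (x e))), yb e)
      = testErr x yb f r v g t (q, e) := by
  match t with
  | Sum.inl t =>
    simp only [decodeV, testG, blockG, testV, blockV, testUpdate, blockUpdate, testErr,
      update_hideAt]
  | Sum.inr true => rfl
  | Sum.inr false => exact sub_zero _

end TestDistortion

/-! ### Encoding observations as vectors -/

/-- The auxiliary variables must be finite-length real vectors. A standard Borel space embeds
measurably in the line, so length one suffices and no information is lost. -/
lemma exists_vec_embedding (α : Type) [MeasurableSpace α] [StandardBorelSpace α] [Nonempty α] :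
    ∃ (w : α → Vec 1) (w' : Vec 1 → α), Measurable w ∧ Measurable w' ∧ ∀ z, w' (w z) = z := by
  obtain ⟨g, hg, hge⟩ := (measurableEmbedding_embeddingReal α).exists_measurable_extend
    measurable_id fun _ => inferInstance
  refine ⟨fun a _ => embeddingReal α a, fun v => g (v 0), ?_, by fun_prop, fun z =>
    congrFun hge z⟩
  exact measurable_pi_lambda _ fun _ => (measurableEmbedding_embeddingReal α).measurable

lemma indexLaw_singleton_ne_zero {ι : Type} [Fintype ι] [MeasurableSpace ι]
    [DiscreteMeasurableSpace ι] {p : ι → ℝ≥0} {t : ι} (h : p t ≠ 0) : indexLaw p {t} ≠ 0 := by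
  unfold indexLaw
  rw [Measure.finsetSum_apply]
  intro h0
  have := (Finset.sum_eq_zero_iff.1 h0) t (Finset.mem_univ t)
  rw [Measure.smul_apply, Measure.dirac_apply_of_mem (Set.mem_singleton t), ENNReal.smul_def,
    smul_eq_mul, mul_one, ENNReal.coe_eq_zero] at this
  exact h this

/-! ### Assembly of the test channel. -/

section TestChannel

variable {E : Type} [MeasurableSpace E] [StandardBorelSpace E] {k k₀ m la lb : ℕ}

/-- There is a positive mixing budget for the auxiliary tests. -/
lemma exists_mixing_weights {d g δ L : ℝ} (hd : 0 < d) (hg : 0 ≤ g) (hδ : 0 < δ) (hL : 0 ≤ L) :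
    ∃ (l₁ l₂ : ℝ≥0) (ε : ℝ), l₂ ≠ 0 ∧ l₁ + l₂ ≤ 1 ∧ 0 < ε ∧ ε ≤ δ / 2 ∧
      (l₁ : ℝ) * L ≤ δ / 2 ∧ ε + l₂ * g ≤ l₁ * d / 2 := by
  -- The weight `a` of the quantizer keeps its rate below δ / 2. Its gain a d / 2 is then shared
  -- equally between ε and the blank weight `b`, each limited to a d / 4; the denominators L + 1 and
  -- g + 1 avoid division by zero.
  set a : ℝ := min (1 / 4) (δ / 2 / (L + 1)) with ha
  have ha0 : 0 < a := lt_min (by norm_num) (by positivity)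
  set b : ℝ := min (1 / 4) (a * d / 4 / (g + 1)) with hb
  have hb0 : 0 < b := lt_min (by norm_num) (by positivity)
  refine ⟨⟨a, ha0.le⟩, ⟨b, hb0.le⟩, min (δ / 2) (a * d / 4), ?_, ?_,
    lt_min (by positivity) (by positivity), min_le_left _ _, ?_, ?_⟩
  · intro h
    exact hb0.ne' (congrArg NNReal.toReal h)
  · rw [← NNReal.coe_le_coe]
    change a + b ≤ 1
    have := min_le_left (1 / 4) (δ / 2 / (L + 1))
    have := min_le_left (1 / 4) (a * d / 4 / (g + 1))
    linarith
  · change a * L ≤ δ / 2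
    have h1 : a ≤ δ / 2 / (L + 1) := min_le_right _ _
    rw [le_div_iff₀ (by positivity)] at h1
    nlinarith
  · change min (δ / 2) (a * d / 4) + b * g ≤ a * d / 2
    have h1 : b ≤ a * d / 4 / (g + 1) := min_le_right _ _
    rw [le_div_iff₀ (by positivity)] at h1
    have h2 := min_le_right (δ / 2) (a * d / 4)
    nlinarith

lemma exists_bounds {Q : Measure E} [IsProbabilityMeasure Q] {x : E → Vec k} (hxm : Measurable x)
    (hx : ∀ i, MemLp (fun e => x e i) 2 Q) (Γ₁ Γ₂ : DistortionMap k k₀) {d : ℝ} (hd : 0 < d) :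
    ∃ (g : ℝ) (M : ℕ) (_ : NeZero M) (r : Vec k → Fin M) (v : Fin M → Vec k), 0 ≤ g ∧
      Measurable r ∧ (∀ i, MemLp (fun e => (x e - v (r (x e))) i) 2 Q) ∧
      ∀ Γ ∈ ({Γ₁, Γ₂} : Set (DistortionMap k k₀)),
        ((d / 2) • (1 : Matrix (Fin k₀) (Fin k₀) ℝ)
          - Γ.toLin (secondMoment Q fun e => x e - v (r (x e)))).PosSemidef ∧
        (g • (1 : Matrix (Fin k₀) (Fin k₀) ℝ) - Γ.toLin (secondMoment Q x)).PosSemidef := by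
  have hX := secondMoment_posSemidef hx
  obtain ⟨γ₁, h₁, hγ₁⟩ := exists_smul_one_sub_posSemidef
    (toLin_posSemidef Γ₁ (Matrix.PosSemidef.one (n := Fin k) (R := ℝ)))
  obtain ⟨γ₂, h₂, hγ₂⟩ := exists_smul_one_sub_posSemidef
    (toLin_posSemidef Γ₂ (Matrix.PosSemidef.one (n := Fin k) (R := ℝ)))
  obtain ⟨s, hs, hsX⟩ := exists_smul_one_sub_posSemidef hX
  set γ := max γ₁ γ₂ with hγ
  have hγ0 : 0 < γ := lt_max_of_lt_left h₁
  -- Quantizer precision chosen so that Γ of its error covariance is at most (d / 2) I for both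
  -- distortion maps, γ bounding both values at the identity.
  have hη : 0 < d / 2 / γ := by positivity
  obtain ⟨M, hM, r, v, hr, hL, hq⟩ := exists_quantizer hxm hx hη
  refine ⟨s * γ, M, hM, r, v, by positivity, hr, hL, fun Γ hΓ => ?_⟩
  have hΓγ : (γ • (1 : Matrix (Fin k₀) (Fin k₀) ℝ) - Γ.toLin 1).PosSemidef := by
    rcases hΓ with rfl | rfl
    · exact smul_one_sub_posSemidef_mono (le_max_left _ _) hγ₁
    · exact smul_one_sub_posSemidef_mono (le_max_right _ _) hγ₂
  refine ⟨?_, smul_one_sub_toLin_posSemidef Γ hX hs.le hsX hΓγ⟩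
  have := smul_one_sub_toLin_posSemidef Γ (secondMoment_posSemidef hL) hη.le hq hΓγ
  rwa [div_mul_cancel₀ _ hγ0.ne'] at this

/-- Codes of rate close to `R` yield a test channel whose auxiliary outputs `w, v` have rate close
to `R` and let both decoders meet their constraints exactly. -/
theorem exists_test_channel {Q : Measure E} [IsProbabilityMeasure Q]
    {x : E → Vec k} {y : E → Vec m} {ya : E → Vec la} {yb : E → Vec lb}
    (hx : Measurable x) (hy : Measurable y) (hya : Measurable ya) (hyb : Measurable yb)
    (hxL : ∀ i, MemLp (fun e => x e i) 2 Q)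
    {κ : Kernel (Vec m) (Vec la × Vec lb)} [IsMarkovKernel κ]
    (hκ : FactorsVia Q x (fun e => (ya e, yb e)) y κ) (hKY : (condCov Q x y).PosDef)
    (Γa Γb : DistortionMap k k₀) {Da Db : Matrix (Fin k₀) (Fin k₀) ℝ} (hDa : Da.PosDef)
    (hDb : Db.PosDef) {R : ℝ}
    (hach : ∀ ε : ℝ, 0 < ε → ∃ (n M : ℕ) (f : (Fin n → Vec k) → Fin M)
      (ga : Fin M × (Fin n → Vec la) → Fin n → Vec k)
      (gb : Fin M × (Fin n → Vec lb) → Fin n → Vec k), 0 < n ∧ Measurable f ∧ Measurable ga ∧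
      Measurable gb ∧
      MeetsDistortion (Measure.pi fun _ : Fin n => Q) Γa (Da + ε • 1)
        (fun s t => x (s t)) (fun s => ga (f fun t => x (s t), fun t => ya (s t))) ∧
      MeetsDistortion (Measure.pi fun _ : Fin n => Q) Γb (Db + ε • 1)
        (fun s t => x (s t)) (fun s => gb (f fun t => x (s t), fun t => yb (s t))) ∧
      Real.log (M : ℝ) / (n : ℝ) ≤ R + ε) {δ : ℝ} (hδ : 0 < δ) :
    ∃ (N : Type) (_ : MeasurableSpace N) (_ : StandardBorelSpace N) (ν : Measure N)
      (_ : IsProbabilityMeasure ν) (w v : N × Vec k → Vec 1), Measurable w ∧ Measurable v ∧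
      condMutualInfo (ν.prod Q) (fun q => x q.2)
          (fun q => (w (q.1, x q.2), (0 : Vec 0))) (fun q => ya q.2)
        + condMutualInfo (ν.prod Q) (fun q => x q.2) (fun q => v (q.1, x q.2))
          (fun q => (w (q.1, x q.2), (0 : Vec 0), y q.2)) ≤ ENNReal.ofReal (R + δ) ∧
      (Da - Γa.toLin (condCov (ν.prod Q) (fun q => x q.2)
        fun q => (w (q.1, x q.2), ya q.2))).PosSemidef ∧
      (Db - Γb.toLin (condCov (ν.prod Q) (fun q => x q.2)
        fun q => ((w (q.1, x q.2), v (q.1, x q.2)), yb q.2))).PosSemidef ∧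
      (condCov (ν.prod Q) (fun q => x q.2)
        fun q => (y q.2, (w (q.1, x q.2), v (q.1, x q.2)))).PosDef := by
  obtain ⟨da, hda, hDad⟩ := exists_sub_smul_one_posSemidef hDa
  obtain ⟨db, hdb, hDbd⟩ := exists_sub_smul_one_posSemidef hDb
  set d := min da db with hd
  have hd0 : 0 < d := lt_min hda hdb
  obtain ⟨g, M₀, hM₀, r, rep, hg, hr, hrL, hΓ⟩ := exists_bounds hx hxL Γa Γb hd0
  have hlog₀ : 0 ≤ Real.log (M₀ : ℝ) := Real.log_natCast_nonneg M₀
  obtain ⟨l₁, l₂, ε, hl₂, hl, hε, hεδ, hl₁, hbudget⟩ := exists_mixing_weights hd0 hg hδ hlog₀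
  obtain ⟨n, M, f, ga, gb, hn, hf, hga, hgb, hma, hmb, hrate⟩ := hach ε hε
  -- The block space is nonempty, so an encoder with no messages is impossible.
  have hM : NeZero M := ⟨fun h => by subst h; exact (f 0).elim0⟩
  have hn0 : (n : ℝ≥0) ≠ 0 := by exact_mod_cast hn.ne'
  -- The time left by the auxiliary tests is shared equally by the n letters; c ≤ 1 / n turns the
  -- budget log M into the rate of the code.
  set c : ℝ≥0 := (1 - (l₁ + l₂)) / n with hc
  have hp : n * c + l₁ + l₂ = 1 := by
    rw [hc, mul_div_cancel₀ _ hn0, add_assoc, tsub_add_cancel_of_le hl]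
  have hcn : (c : ℝ) ≤ 1 / n := by
    have : (n : ℝ) * c + l₁ + l₂ = 1 := by exact_mod_cast hp
    rw [le_div_iff₀ (by exact_mod_cast hn)]
    nlinarith [l₁.coe_nonneg, l₂.coe_nonneg]
  set p : TestIndex n → ℝ≥0 := testWeight c l₁ l₂ with hpdef
  have hp1 : ∑ t, p t = 1 := sum_testWeight hp
  have hip := isProbabilityMeasure_indexLaw hp1
  have hne : Nonempty (Message M M₀) := inferInstance
  have hneV : Nonempty ((Fin n → Vec lb) × (Fin n → Vec m) × (Fin n → Vec k)) := ⟨0⟩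
  have hneG : Nonempty (TestIndex n × Message M M₀ × (Fin n → Vec la) × (Fin n → Vec m)) :=
    ⟨(Sum.inr true, hne.some, 0, 0)⟩
  have hs₁ : StandardBorelSpace ((Fin n → Vec m) × (Fin n → Vec k)) := inferInstance
  have hs₂ : StandardBorelSpace ((Fin n → Vec lb) × (Fin n → Vec m) × (Fin n → Vec k)) :=
    StandardBorelSpace.prod
  obtain ⟨w, w', hw, hw', hww⟩ :=
    exists_vec_embedding (TestIndex n × Message M M₀ × (Fin n → Vec la) × (Fin n → Vec m))
  obtain ⟨v, v', hv, hv', hvv⟩ :=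
    exists_vec_embedding ((Fin n → Vec lb) × (Fin n → Vec m) × (Fin n → Vec k))
  have hφ := measurable_testUpdate (M := M) (M₀ := M₀) hx hf hr
  have hG := measurable_testG (n := n) (M := M) (M₀ := M₀) hy hya
  have hV := measurable_testV (n := n) (M := M) (M₀ := M₀) hx hy hyb
  have hφm : Measurable fun q : (TestIndex n × Context E n M M₀) × Vec k =>
      testUpdate x f r q.1.1 q.1.2 q.2 := by
    have h0 : Measurable fun q : TestIndex n × (Context E n M M₀ × Vec k) =>
      testUpdate x f r q.1 q.2.1 q.2.2 := measurable_of_slices hφ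
    exact h0.comp (show Measurable fun q : (TestIndex n × Context E n M M₀) × Vec k =>
      (q.1.1, (q.1.2, q.2)) by fun_prop)
  have hGm : Measurable fun q : TestIndex n × Context E n M M₀ => testG y ya q.1 q.2 :=
    measurable_of_slices hG
  have hVm : Measurable fun q : TestIndex n × Context E n M M₀ => testV x y yb q.1 q.2 :=
    measurable_of_slices hV
  set ω : (TestIndex n × Context E n M M₀) × Vec k → TestIndex n × Context E n M M₀ := fun q =>
    (q.1.1, testUpdate x f r q.1.1 q.1.2 q.2) with hω
  have hωm : Measurable ω := measurable_fst.fst.prodMk hφm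
  set ν := (indexLaw p).prod (contextLaw Q n M M₀) with hν
  set W : (TestIndex n × Context E n M M₀) × Vec k → Vec 1 := fun q =>
    w ((ω q).1, testG y ya (ω q).1 (ω q).2) with hW
  set V : (TestIndex n × Context E n M M₀) × Vec k → Vec 1 := fun q =>
    v (testV x y yb (ω q).1 (ω q).2) with hVdef
  have hWm : Measurable W := by
    have : Measurable fun q : TestIndex n × Context E n M M₀ => w (q.1, testG y ya q.1 q.2) := by
      fun_prop
    exact this.comp hωm
  have hVm' : Measurable V := by
    have : Measurable fun q : TestIndex n × Context E n M M₀ => v (testV x y yb q.1 q.2) := by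
      fun_prop
    exact this.comp hωm
  refine ⟨TestIndex n × Context E n M M₀, inferInstance, inferInstance, ν, inferInstance, W, V,
    hWm, hVm', ?_, ?_, ?_, ?_⟩
  -- The rate bound is stated for the updated law. Pulling it back along `Φ` exhibits `W` and `V` as
  -- functions of private randomness and the letter `X`, that is, as outputs of a channel.
  · set Φ : (TestIndex n × Context E n M M₀) × E → (TestIndex n × Context E n M M₀) × E :=
      fun q => (ω (q.1, x q.2), q.2) with hΦ
    have hΦm : Measurable Φ := by fun_prop
    have hPp : IsProbabilityMeasure ((ν.prod Q).map Φ) :=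
      Measure.isProbabilityMeasure_map hΦm.aemeasurable
    have h1 := test_rate_le (x := x) (y := y) (ya := ya) (yb := yb) hn (Q := Q) hx hy hya hyb hκ
      hf hr hp (w := fun z => (w z, (0 : Vec 0))) (by fun_prop) (w' := fun z => w' z.1)
      (by fun_prop) hww hv hv' hvv (e := fun z => (w z.1, (0 : Vec 0), z.2)) (by fun_prop)
      (e' := fun z => (w' z.1, z.2.2)) (by fun_prop) (fun z => by simp [hww])
      (P := (ν.prod Q).map Φ) rfl
    rw [condMutualInfo_map _ hΦm (by fun_prop) (by fun_prop) (by fun_prop),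
      condMutualInfo_map _ hΦm (by fun_prop) (by fun_prop) (by fun_prop)] at h1
    refine h1.trans ?_
    rw [← ENNReal.ofReal_coe_nnreal, ← ENNReal.ofReal_coe_nnreal,
      ← ENNReal.ofReal_mul c.coe_nonneg, ← ENNReal.ofReal_mul l₁.coe_nonneg,
      ← ENNReal.ofReal_add (mul_nonneg c.coe_nonneg (Real.log_natCast_nonneg M))
        (mul_nonneg l₁.coe_nonneg hlog₀)]
    refine ENNReal.ofReal_le_ofReal ?_
    have h2 : (c : ℝ) * Real.log M ≤ Real.log M / n := by
      calc (c : ℝ) * Real.log M ≤ 1 / n * Real.log M := by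
            gcongr
        _ = _ := by ring
    linarith
  · obtain ⟨hA, hB⟩ := hΓ Γa (by simp)
    obtain ⟨hint, hps⟩ := test_distortion (z := ya) hn hxL hrL hp hd0.le hε.le
      (sub_smul_one_posSemidef_mono (min_le_left _ _) hDad) hma hA hB hbudget
    have hdec : Measurable fun z : TestIndex n ×
        ((Message M M₀ × (Fin n → Vec la) × (Fin n → Vec m)) × Vec la) =>
        decodeG rep ga z.1 z.2 := measurable_of_slices (measurable_decodeG rep hga)
    refine posSemidef_sub_trans (index_estimator Γa hp1 hxL (Z := fun q => (W (q.1, x q.2), ya q.2))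
      (by fun_prop) (h := fun z => decodeG rep ga (w' z.1).1 ((w' z.1).2, z.2)) ?_ ?_ hint) hps
    · exact hdec.comp (show Measurable fun z : Vec 1 × Vec la =>
        ((w' z.1).1, ((w' z.1).2, z.2)) by fun_prop)
    · intro q
      simp only [hW, hww]
      exact sub_decodeG rep ga q.1.1 q.1.2 q.2
  · obtain ⟨hA, hB⟩ := hΓ Γb (by simp)
    obtain ⟨hint, hps⟩ := test_distortion (z := yb) hn hxL hrL hp hd0.le hε.le
      (sub_smul_one_posSemidef_mono (min_le_right _ _) hDbd) hmb hA hB hbudget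
    have hdec : Measurable fun z : TestIndex n ×
        (((Message M M₀ × (Fin n → Vec la) × (Fin n → Vec m))
          × (Fin n → Vec lb) × (Fin n → Vec m) × (Fin n → Vec k)) × Vec lb) =>
        decodeV rep gb z.1 z.2 := measurable_of_slices (measurable_decodeV rep hgb)
    refine posSemidef_sub_trans (index_estimator Γb hp1 hxL
      (Z := fun q => ((W (q.1, x q.2), V (q.1, x q.2)), yb q.2))
      (by fun_prop) (h := fun z => decodeV rep gb (w' z.1.1).1 (((w' z.1.1).2, v' z.1.2), z.2))
      ?_ ?_ hint) hps
    · exact hdec.comp (show Measurable fun z : (Vec 1 × Vec 1) × Vec lb =>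
        ((w' z.1.1).1, (((w' z.1.1).2, v' z.1.2), z.2)) by fun_prop)
    · intro q
      simp only [hW, hVdef, hww, hvv]
      exact sub_decodeV rep gb q.1.1 q.1.2 q.2
  -- The blank index has positive weight `l₂`, and there the update ignores the letter.
  · refine condCov_posDef_of_blank hx hxL hy hKY (hWm.prodMk hVm')
      (B := {Sum.inr false} ×ˢ Set.univ) ?_ ?_
    · rw [hν, Measure.prod_prod, measure_univ, mul_one]
      exact indexLaw_singleton_ne_zero hl₂
    · rintro ⟨t, q⟩ ⟨ht, -⟩ a a'
      obtain rfl : t = Sum.inr false := ht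
      rfl

end TestChannel

lemma condCov_congr_of_comp {Ω α β : Type} [MeasurableSpace Ω] [MeasurableSpace α]
    [MeasurableSpace β] {μ : Measure Ω} {k : ℕ} (X : Ω → Vec k) {Z : Ω → α} {Z' : Ω → β}
    {h : α → β} (hh : Measurable h) {h' : β → α} (hh' : Measurable h') (e : ∀ ω, Z' ω = h (Z ω))
    (e' : ∀ ω, Z ω = h' (Z' ω)) : condCov μ X Z' = condCov μ X Z := by
  have : MeasurableSpace.comap Z' inferInstance = MeasurableSpace.comap Z inferInstance := by
    refine le_antisymm (measurable_iff_comap_le.1 ?_) (measurable_iff_comap_le.1 ?_)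
    · rw [show Z' = h ∘ Z from funext e]
      exact hh.comp (comap_measurable Z)
    · rw [show Z = h' ∘ Z' from funext e']
      exact hh'.comp (comap_measurable Z')
  unfold condCov
  rw [this]

/-- The test channel of a sequence of codes, including the enhanced decoder constraint. -/
theorem exists_enhanced_test_channel {E : Type} [NormedAddCommGroup E] [NormedSpace ℝ E]
    [CompleteSpace E] [SecondCountableTopology E] [MeasurableSpace E] [BorelSpace E]
    [StandardBorelSpace E] {Q : Measure E} [IsGaussian Q] {k k₀ m la lb : ℕ}
    (hQ : ∫ e, e ∂Q = 0) (X : E →L[ℝ] Vec k) (Y : E →L[ℝ] Vec m) (Ya : E →L[ℝ] Vec la)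
    (Yb : E →L[ℝ] Vec lb)
    (hmk : CondIndepFun (MeasurableSpace.comap Y inferInstance) Y.continuous.measurable.comap_le
      X (fun e => (Ya e, Yb e)) Q)
    (hKY : (condCov Q X Y).PosDef) (hKb : (condCov Q X Yb).PosDef)
    (Γa Γb : DistortionMap k k₀) {Da Db : Matrix (Fin k₀) (Fin k₀) ℝ} (hDa : Da.PosDef)
    (hDb : Db.PosDef) {R : ℝ}
    (hach : ∀ ε : ℝ, 0 < ε → ∃ (n M : ℕ) (f : (Fin n → Vec k) → Fin M)
      (ga : Fin M × (Fin n → Vec la) → Fin n → Vec k)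
      (gb : Fin M × (Fin n → Vec lb) → Fin n → Vec k), 0 < n ∧ Measurable f ∧ Measurable ga ∧
      Measurable gb ∧
      MeetsDistortion (Measure.pi fun _ : Fin n => Q) Γa (Da + ε • 1)
        (fun s t => X (s t)) (fun s => ga (f fun t => X (s t), fun t => Ya (s t))) ∧
      MeetsDistortion (Measure.pi fun _ : Fin n => Q) Γb (Db + ε • 1)
        (fun s t => X (s t)) (fun s => gb (f fun t => X (s t), fun t => Yb (s t))) ∧
      Real.log (M : ℝ) / (n : ℝ) ≤ R + ε) {δ : ℝ} (hδ : 0 < δ) :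
    ∃ (N : Type) (_ : MeasurableSpace N) (ν : Measure N)
      (_ : IsProbabilityMeasure ν) (w v : N × Vec k → Vec 1), Measurable w ∧ Measurable v ∧
      condMutualInfo (ν.prod Q) (fun q => X q.2)
          (fun q => (w (q.1, X q.2), (0 : Vec 0))) (fun q => Ya q.2)
        + condMutualInfo (ν.prod Q) (fun q => X q.2) (fun q => v (q.1, X q.2))
          (fun q => (w (q.1, X q.2), (0 : Vec 0), Y q.2)) ≤ ENNReal.ofReal (R + δ) ∧
      (Da - Γa.toLin (condCov (ν.prod Q) (fun q => X q.2)
        fun q => (w (q.1, X q.2), Ya q.2))).PosSemidef ∧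
      (condCov (ν.prod Q) (fun q => X q.2)
        fun q => (Y q.2, (w (q.1, X q.2), v (q.1, X q.2)))).PosDef ∧
      (Db - Γb.toLin ((condCov (ν.prod Q) (fun q => X q.2)
        fun q => (Y q.2, (w (q.1, X q.2), v (q.1, X q.2))))⁻¹
          - ((condCov Q X Y)⁻¹ - (condCov Q X Yb)⁻¹))⁻¹).PosSemidef := by
  have hX : Measurable X := X.continuous.measurable
  have hY : Measurable Y := Y.continuous.measurable
  have hYa : Measurable Ya := Ya.continuous.measurable
  have hYb : Measurable Yb := Yb.continuous.measurable
  have hXL := memLp_clm (Q := Q) X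
  obtain ⟨N, iN, hN, ν, hν, w, v, hw, hv, h1, h2, h3, h4⟩ :=
    exists_test_channel hX hY hYa hYb hXL
      (factorsVia_of_condIndepFun hX (hYa.prodMk hYb) hY hmk) hKY Γa Γb hDa hDb hach hδ
  refine ⟨N, iN, ν, hν, w, v, hw, hv, h1, h2, h4, ?_⟩
  have h5 := channel_enhancement hQ ν X Y Yb (hmk.comp measurable_id measurable_snd) hKY hKb
    (s := fun q => (w q, v q)) (hw.prodMk hv) h4
  -- The enhanced matrix is below the true error covariance of decoder b, which already satisfies
  -- its constraint.
  refine posSemidef_sub_trans (Γb.mono _ _ h5.1.inv.posSemidef ?_ h5.2) h3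
  have hmp : MeasurePreserving (Prod.snd : N × E → E) (ν.prod Q) Q :=
    ⟨measurable_snd, map_snd_prod_eq ν Q⟩
  exact condCov_posSemidef (fun i => (hXL i).comp_measurePreserving hmp) _

/-! ### Joint laws of the source and the channel outputs -/

section JointLaw

variable {k k₁ k₂ k₀ m a b c : ℕ}

@[fun_prop] lemma measurable_xC : Measurable (xC : Aux k k₁ k₂ m a b c → _) := by
  unfold xC; fun_prop
@[fun_prop] lemma measurable_y₁C : Measurable (y₁C : Aux k k₁ k₂ m a b c → _) := by
  unfold y₁C; fun_prop
@[fun_prop] lemma measurable_y₂C : Measurable (y₂C : Aux k k₁ k₂ m a b c → _) := by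
  unfold y₂C; fun_prop
@[fun_prop] lemma measurable_yC : Measurable (yC : Aux k k₁ k₂ m a b c → _) := by
  unfold yC; fun_prop
@[fun_prop] lemma measurable_wC : Measurable (wC : Aux k k₁ k₂ m a b c → _) := by
  unfold wC; fun_prop
@[fun_prop] lemma measurable_uC : Measurable (uC : Aux k k₁ k₂ m a b c → _) := by
  unfold uC; fun_prop
@[fun_prop] lemma measurable_vC : Measurable (vC : Aux k k₁ k₂ m a b c → _) := by
  unfold vC; fun_prop

/-- The source coordinate. -/
def xL (k k₁ k₂ m : ℕ) : Enhanced k k₁ k₂ m →L[ℝ] Vec k :=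
  (ContinuousLinearMap.fst ℝ _ _).comp (ContinuousLinearMap.fst ℝ _ _)
/-- The first side information. -/
def y₁L (k k₁ k₂ m : ℕ) : Enhanced k k₁ k₂ m →L[ℝ] Vec k₁ :=
  (ContinuousLinearMap.fst ℝ _ _).comp
    ((ContinuousLinearMap.snd ℝ _ _).comp (ContinuousLinearMap.fst ℝ _ _))
/-- The second side information. -/
def y₂L (k k₁ k₂ m : ℕ) : Enhanced k k₁ k₂ m →L[ℝ] Vec k₂ :=
  (ContinuousLinearMap.snd ℝ _ _).comp
    ((ContinuousLinearMap.snd ℝ _ _).comp (ContinuousLinearMap.fst ℝ _ _))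
/-- The enhanced side information. -/
def yL (k k₁ k₂ m : ℕ) : Enhanced k k₁ k₂ m →L[ℝ] Vec m := ContinuousLinearMap.snd ℝ _ _

variable {N : Type} [MeasurableSpace N]

/-- A letter together with the outputs of a channel fed by the source. -/
def attach (s : N × Vec k → Vec a × Vec b × Vec c) (q : N × Enhanced k k₁ k₂ m) :
    Aux k k₁ k₂ m a b c := (q.2, s (q.1, q.2.1.1))

lemma measurable_attach {s : N × Vec k → Vec a × Vec b × Vec c} (hs : Measurable s) :
    Measurable (attach (k₁ := k₁) (k₂ := k₂) (m := m) s) := by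
  unfold attach; fun_prop

variable {Q : Measure (Enhanced k k₁ k₂ m)} [IsProbabilityMeasure Q] {ν : Measure N}
  [IsProbabilityMeasure ν]

lemma map_fst_attach {s : N × Vec k → Vec a × Vec b × Vec c} (hs : Measurable s) :
    ((ν.prod Q).map (attach s)).map Prod.fst = Q := by
  rw [Measure.map_map measurable_fst (measurable_attach hs)]
  exact map_snd_prod_eq ν Q

/-- The outputs depend only on `X` and on independent randomness, so given `X` the side informations
keep their conditional law under `Q`. -/
lemma markovChain_attach {s : N × Vec k → Vec a × Vec b × Vec c} (hs : Measurable s)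
    [IsProbabilityMeasure ((ν.prod Q).map (attach s))] :
    MarkovChain ((ν.prod Q).map (attach s)) (fun ω => (wC ω, uC ω, vC ω)) xC
      (fun ω => (y₁C ω, y₂C ω, yC ω)) := by
  have hx : Measurable fun e : Enhanced k k₁ k₂ m => e.1.1 := by fun_prop
  have hB : Measurable fun e : Enhanced k k₁ k₂ m => (e.1.2.1, e.1.2.2, e.2) := by fun_prop
  have h1 := ((factorsVia_self (μ := Q) hB hx).prod_left (ν := ν) hx hB hx).comp
    (by fun_prop) (by fun_prop) (by fun_prop) (g := fun q : Vec k × N × Vec k => s q.2)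
    (by fun_prop)
  have h2 : FactorsVia ((ν.prod Q).map (attach s)) (fun ω => (wC ω, uC ω, vC ω))
      (fun ω => (y₁C ω, y₂C ω, yC ω)) xC
      (condDistrib (fun e : Enhanced k k₁ k₂ m => (e.1.2.1, e.1.2.2, e.2)) (fun e => e.1.1) Q) :=
    FactorsVia.of_map_eq (measurable_attach hs) (by fun_prop) (by fun_prop) (by fun_prop) h1
  exact ⟨measurable_xC, h2.condIndepFun (by fun_prop) (by fun_prop) (by fun_prop)⟩

lemma condCov_attach [IsGaussian Q] {s : N × Vec k → Vec a × Vec b × Vec c} (hs : Measurable s)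
    {β : Type} [MeasurableSpace β] {Z : Aux k k₁ k₂ m a b c → β} (hZ : Measurable Z) :
    condCov ((ν.prod Q).map (attach s)) xC Z
      = condCov (ν.prod Q) (fun q => xL k k₁ k₂ m q.2) (fun q => Z (attach s q)) := by
  have h1 : MeasurePreserving (Prod.fst : Aux k k₁ k₂ m a b c → _)
      ((ν.prod Q).map (attach s)) Q := ⟨measurable_fst, map_fst_attach hs⟩
  exact condCov_map (measurable_attach hs)
    (fun i => (memLp_clm (Q := Q) (xL k k₁ k₂ m) i).comp_measurePreserving h1) hZ

lemma condCov_attach_fst [IsGaussian Q] {s : N × Vec k → Vec a × Vec b × Vec c}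
    (hs : Measurable s) {β : Type} [MeasurableSpace β] {Z : Enhanced k k₁ k₂ m → β}
    (hZ : Measurable Z) :
    condCov ((ν.prod Q).map (attach s)) xC (fun ω => Z ω.1) = condCov Q (xL k k₁ k₂ m) Z := by
  have := Measure.isProbabilityMeasure_map (μ := ν.prod Q)
    (measurable_attach (k₁ := k₁) (k₂ := k₂) (m := m) hs).aemeasurable
  have h1 := map_fst_attach (ν := ν) (Q := Q) hs
  have h2 := condCov_map (μ := (ν.prod Q).map (attach s)) measurable_fst (Z := Z)
    (X := xL k k₁ k₂ m) (fun i => by rw [h1]; exact memLp_clm _ i) hZ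
  rw [h1] at h2
  exact h2.symm

end JointLaw

/-! ### The two bounds -/

section Bounds

variable {k k₁ k₂ k₀ m : ℕ} {P : Measure (Source k k₁ k₂)} [IsGaussian P]
  {Q : ProbabilityMeasure (Enhanced k k₁ k₂ m)}

lemma IsSG.posDef (hQ : IsSG P Q) :
    (condCov (Q : Measure (Enhanced k k₁ k₂ m)) (xL k k₁ k₂ m) (yL k k₁ k₂ m)).PosDef := by
  have := hQ.gaussian
  exact posDef_of_isUnit (condCov_posSemidef (memLp_clm (xL k k₁ k₂ m)) _) hQ.invertible

lemma IsSG.posDef_of_isUnit (hQ : IsSG P Q) {β : Type} [MeasurableSpace β]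
    {Z : Source k k₁ k₂ → β} (hZ : Measurable Z) (h : IsUnit (condCov P (fun s => s.1) Z)) :
    (condCov (Q : Measure (Enhanced k k₁ k₂ m)) (xL k k₁ k₂ m) (fun e => Z e.1)).PosDef := by
  have := hQ.gaussian
  refine VectorGaussianRD.posDef_of_isUnit (condCov_posSemidef (memLp_clm (xL k k₁ k₂ m)) _) ?_
  have h1 := condCov_map (μ := (Q : Measure (Enhanced k k₁ k₂ m))) measurable_fst
    (X := fun s : Source k k₁ k₂ => s.1) (Z := Z) (fun i => by
      rw [hQ.marginal]
      exact memLp_clm (ContinuousLinearMap.fst ℝ (Vec k) (Vec k₁ × Vec k₂)) i) hZ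
  rw [hQ.marginal] at h1
  rw [h1] at h
  exact h

lemma IsSG.measurePreserving_block (hQ : IsSG P Q) (n : ℕ) :
    MeasurePreserving (fun (s : Fin n → Enhanced k k₁ k₂ m) t => (s t).1)
      (Measure.pi fun _ : Fin n => (Q : Measure (Enhanced k k₁ k₂ m)))
      (Measure.pi fun _ : Fin n => P) :=
  measurePreserving_pi (fun _ => (Q : Measure (Enhanced k k₁ k₂ m))) (fun _ => P)
    fun _ => ⟨measurable_fst, hQ.marginal⟩

variable {Γ₁ Γ₂ : DistortionMap k k₀} {D₁ D₂ : Matrix (Fin k₀) (Fin k₀) ℝ} {R : ℝ}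

lemma infRlo1_le (hK₂ : IsUnit (condCov P (fun s => s.1) (fun s => s.2.2))) (hD₁ : D₁.PosDef)
    (hD₂ : D₂.PosDef) (hR : Achievable P Γ₁ Γ₂ D₁ D₂ R) (hQ : IsSG P Q) {δ : ℝ} (hδ : 0 < δ) :
    infRlo1 Γ₁ Γ₂ D₁ D₂ Q ≤ ENNReal.ofReal (R + δ) := by
  have := hQ.gaussian
  have hKb : (condCov (Q : Measure (Enhanced k k₁ k₂ m)) (xL k k₁ k₂ m) (y₂L k k₁ k₂ m)).PosDef :=
    hQ.posDef_of_isUnit (Z := fun s => s.2.2) (by fun_prop) hK₂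
  obtain ⟨hYm, hci⟩ := hQ.markov
  obtain ⟨N, iN, ν, hν, w, v, hw, hv, h1, h2, h3, h4⟩ :=
    exists_enhanced_test_channel hQ.centered (xL k k₁ k₂ m) (yL k k₁ k₂ m) (y₁L k k₁ k₂ m)
      (y₂L k k₁ k₂ m) hci hQ.posDef hKb Γ₁ Γ₂ hD₁ hD₂ (R := R)
      (fun ε hε => by
        obtain ⟨n, M, hn, ⟨C⟩, hM⟩ := hR ε hε
        exact ⟨n, M, C.f, C.g₁, C.g₂, hn, C.measurable_f, C.measurable_g₁, C.measurable_g₂,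
          C.distortion₁.comp (hQ.measurePreserving_block n),
          C.distortion₂.comp (hQ.measurePreserving_block n), hM⟩) hδ
  -- `U` is taken of length zero, as `(W, U)` enter this bound only jointly.
  set s : N × Vec k → Vec 1 × Vec 0 × Vec 1 := fun q => (w q, 0, v q) with hs
  have hsm : Measurable s := by fun_prop
  have ham := measurable_attach (k₁ := k₁) (k₂ := k₂) (m := m) hsm
  have hρ : IsProbabilityMeasure ((ν.prod (Q : Measure (Enhanced k k₁ k₂ m))).map (attach s)) :=
    Measure.isProbabilityMeasure_map ham.aemeasurable
  set ρ : ProbabilityMeasure (Aux k k₁ k₂ m 1 0 1) :=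
    ⟨(ν.prod (Q : Measure (Enhanced k k₁ k₂ m))).map (attach s), hρ⟩ with hρdef
  have hall : KAll (ρ : Measure (Aux k k₁ k₂ m 1 0 1))
      = condCov (ν.prod (Q : Measure (Enhanced k k₁ k₂ m))) (fun q => xL k k₁ k₂ m q.2)
        (fun q => (yL k k₁ k₂ m q.2, (w (q.1, xL k k₁ k₂ m q.2), v (q.1, xL k k₁ k₂ m q.2)))) :=
    (condCov_attach hsm (by fun_prop)).trans
      (condCov_congr_of_comp _ (h := fun z => (z.2.1, 0, z.2.2, z.1)) (by fun_prop)
        (h' := fun z => (z.2.2.2, z.1, z.2.2.1)) (by fun_prop) (fun _ => rfl) (fun _ => rfl))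
  have hdec : condCov (ρ : Measure (Aux k k₁ k₂ m 1 0 1)) xC (fun ω => (wC ω, uC ω, y₁C ω))
      = condCov (ν.prod (Q : Measure (Enhanced k k₁ k₂ m))) (fun q => xL k k₁ k₂ m q.2)
        (fun q => (w (q.1, xL k k₁ k₂ m q.2), y₁L k k₁ k₂ m q.2)) :=
    (condCov_attach hsm (by fun_prop)).trans
      (condCov_congr_of_comp _ (h := fun z => (z.1, 0, z.2)) (by fun_prop)
        (h' := fun z => (z.1, z.2.2)) (by fun_prop) (fun _ => rfl) (fun _ => rfl))
  have htil : KTilde (ρ : Measure (Aux k k₁ k₂ m 1 0 1))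
      = (condCov (Q : Measure (Enhanced k k₁ k₂ m)) (xL k k₁ k₂ m) (yL k k₁ k₂ m))⁻¹
        - (condCov (Q : Measure (Enhanced k k₁ k₂ m)) (xL k k₁ k₂ m) (y₂L k k₁ k₂ m))⁻¹ := by
    rw [← condCov_attach_fst (ν := ν) hsm (yL k k₁ k₂ m).continuous.measurable,
      ← condCov_attach_fst (ν := ν) hsm (y₂L k k₁ k₂ m).continuous.measurable]
    rfl
  have hC : IsCbar1 Γ₁ Γ₂ D₁ D₂ Q ρ := by
    refine ⟨map_fst_attach hsm, markovChain_attach hsm, ?_, ?_, ?_⟩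
    · rw [hall]; exact h3.isUnit
    · rw [hdec]; exact h2
    · rw [hall, htil]; exact h4
  unfold infRlo1
  refine iInf_le_of_le 1 (iInf_le_of_le 0 (iInf_le_of_le 1 ((iInf₂_le ρ hC).trans ?_)))
  refine le_trans (le_of_eq ?_) h1
  exact congrArg₂ (· + ·) (condMutualInfo_map _ ham (by fun_prop) (by fun_prop) (by fun_prop))
    (condMutualInfo_map _ ham (by fun_prop) (by fun_prop) (by fun_prop))

/-- The mirror image of `infRlo1_le`: the decoders exchange roles, so the refined output is stored
as `U`, and `V` is the empty vector. -/
lemma infRlo2_le (hK₁ : IsUnit (condCov P (fun s => s.1) (fun s => s.2.1))) (hD₁ : D₁.PosDef)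
    (hD₂ : D₂.PosDef) (hR : Achievable P Γ₁ Γ₂ D₁ D₂ R) (hQ : IsSG P Q) {δ : ℝ} (hδ : 0 < δ) :
    infRlo2 Γ₁ Γ₂ D₁ D₂ Q ≤ ENNReal.ofReal (R + δ) := by
  have := hQ.gaussian
  have hKb : (condCov (Q : Measure (Enhanced k k₁ k₂ m)) (xL k k₁ k₂ m) (y₁L k k₁ k₂ m)).PosDef :=
    hQ.posDef_of_isUnit (Z := fun s => s.2.1) (by fun_prop) hK₁
  obtain ⟨hYm, hci⟩ := hQ.markov
  obtain ⟨N, iN, ν, hν, w, v, hw, hv, h1, h2, h3, h4⟩ :=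
    exists_enhanced_test_channel hQ.centered (xL k k₁ k₂ m) (yL k k₁ k₂ m) (y₂L k k₁ k₂ m)
      (y₁L k k₁ k₂ m) (hci.comp measurable_id measurable_swap) hQ.posDef
      hKb Γ₂ Γ₁ hD₂ hD₁ (R := R)
      (fun ε hε => by
        obtain ⟨n, M, hn, ⟨C⟩, hM⟩ := hR ε hε
        exact ⟨n, M, C.f, C.g₂, C.g₁, hn, C.measurable_f, C.measurable_g₂, C.measurable_g₁,
          C.distortion₂.comp (hQ.measurePreserving_block n),
          C.distortion₁.comp (hQ.measurePreserving_block n), hM⟩) hδ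
  set s : N × Vec k → Vec 1 × Vec 1 × Vec 0 := fun q => (w q, v q, 0) with hs
  have hsm : Measurable s := by fun_prop
  have ham := measurable_attach (k₁ := k₁) (k₂ := k₂) (m := m) hsm
  have hρ : IsProbabilityMeasure ((ν.prod (Q : Measure (Enhanced k k₁ k₂ m))).map (attach s)) :=
    Measure.isProbabilityMeasure_map ham.aemeasurable
  set ρ : ProbabilityMeasure (Aux k k₁ k₂ m 1 1 0) :=
    ⟨(ν.prod (Q : Measure (Enhanced k k₁ k₂ m))).map (attach s), hρ⟩ with hρdef
  have hall : KAll (ρ : Measure (Aux k k₁ k₂ m 1 1 0))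
      = condCov (ν.prod (Q : Measure (Enhanced k k₁ k₂ m))) (fun q => xL k k₁ k₂ m q.2)
        (fun q => (yL k k₁ k₂ m q.2, (w (q.1, xL k k₁ k₂ m q.2), v (q.1, xL k k₁ k₂ m q.2)))) :=
    (condCov_attach hsm (by fun_prop)).trans
      (condCov_congr_of_comp _ (h := fun z => (z.2.1, z.2.2, 0, z.1)) (by fun_prop)
        (h' := fun z => (z.2.2.2, z.1, z.2.1)) (by fun_prop) (fun _ => rfl) (fun _ => rfl))
  have hdec : condCov (ρ : Measure (Aux k k₁ k₂ m 1 1 0)) xC (fun ω => (wC ω, vC ω, y₂C ω))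
      = condCov (ν.prod (Q : Measure (Enhanced k k₁ k₂ m))) (fun q => xL k k₁ k₂ m q.2)
        (fun q => (w (q.1, xL k k₁ k₂ m q.2), y₂L k k₁ k₂ m q.2)) :=
    (condCov_attach hsm (by fun_prop)).trans
      (condCov_congr_of_comp _ (h := fun z => (z.1, 0, z.2)) (by fun_prop)
        (h' := fun z => (z.1, z.2.2)) (by fun_prop) (fun _ => rfl) (fun _ => rfl))
  have hhat : KHat (ρ : Measure (Aux k k₁ k₂ m 1 1 0))
      = (condCov (Q : Measure (Enhanced k k₁ k₂ m)) (xL k k₁ k₂ m) (yL k k₁ k₂ m))⁻¹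
        - (condCov (Q : Measure (Enhanced k k₁ k₂ m)) (xL k k₁ k₂ m) (y₁L k k₁ k₂ m))⁻¹ := by
    rw [← condCov_attach_fst (ν := ν) hsm (yL k k₁ k₂ m).continuous.measurable,
      ← condCov_attach_fst (ν := ν) hsm (y₁L k k₁ k₂ m).continuous.measurable]
    rfl
  have hC : IsCbar2 Γ₁ Γ₂ D₁ D₂ Q ρ := by
    refine ⟨map_fst_attach hsm, markovChain_attach hsm, ?_, ?_, ?_⟩
    · rw [hall]; exact h3.isUnit
    · rw [hall, hhat]; exact h4
    · rw [hdec]; exact h2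
  unfold infRlo2
  refine iInf_le_of_le 1 (iInf_le_of_le 1 (iInf_le_of_le 0 ((iInf₂_le ρ hC).trans ?_)))
  refine le_trans (le_of_eq ?_) h1
  exact congrArg₂ (· + ·) (condMutualInfo_map _ ham (by fun_prop) (by fun_prop) (by fun_prop))
    (condMutualInfo_map _ ham (by fun_prop) (by fun_prop) (by fun_prop))

lemma Achievable.nonneg (hR : Achievable P Γ₁ Γ₂ D₁ D₂ R) : 0 ≤ R := by
  refine le_of_forall_pos_le_add fun ε hε => ?_
  obtain ⟨n, M, hn, -, hM⟩ := hR ε hε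
  exact (div_nonneg (Real.log_natCast_nonneg M) (Nat.cast_nonneg n)).trans hM

lemma ennreal_le_ofReal_of_forall {a : ℝ≥0∞} (h : ∀ δ : ℝ, 0 < δ → a ≤ ENNReal.ofReal (R + δ)) :
    a ≤ ENNReal.ofReal R :=
  ENNReal.le_of_forall_pos_le_add fun δ hδ _ => by
    refine (h δ (by exact_mod_cast hδ)).trans (ENNReal.ofReal_add_le.trans ?_)
    rw [ENNReal.ofReal_coe_nnreal]

end Bounds

end

end VectorGaussianRD

/-! ### The lower bound on the rate-distortion function. -/

theorem mainTheorem6 {k k₁ k₂ k₀ : ℕ}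
    (P : Measure (Source k k₁ k₂)) [IsGaussian P] (hP : ∫ s, s ∂P = 0)
    (hK₁ : IsUnit (condCov P (fun s => s.1) (fun s => s.2.1)))
    (hK₂ : IsUnit (condCov P (fun s => s.1) (fun s => s.2.2)))
    (Γ₁ Γ₂ : DistortionMap k k₀) (D₁ D₂ : Matrix (Fin k₀) (Fin k₀) ℝ)
    (hD₁ : D₁.PosDef) (hD₂ : D₂.PosDef) :
    (enhancedELB P Γ₁ Γ₂ D₁ D₂ : EReal) ≤ rateDistortion P Γ₁ Γ₂ D₁ D₂ := by
  refine le_iInf₂ fun R hR => ?_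
  have h : enhancedELB P Γ₁ Γ₂ D₁ D₂ ≤ ENNReal.ofReal R :=
    max_le
      (iSup_le fun m => iSup₂_le fun Q hQ => ennreal_le_ofReal_of_forall fun δ hδ =>
        infRlo1_le hK₂ hD₁ hD₂ hR hQ hδ)
      (iSup_le fun m => iSup₂_le fun Q hQ => ennreal_le_ofReal_of_forall fun δ hδ =>
        infRlo2_le hK₁ hD₁ hD₂ hR hQ hδ)
  refine (EReal.coe_ennreal_le_coe_ennreal_iff.2 h).trans ?_
  -- `ENNReal.ofReal` truncates at zero, which is harmless because achievable rates are nonnegative.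
  rw [EReal.coe_ennreal_ofReal, max_eq_left hR.nonneg]
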